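/- Conventions. All categories are small; composition is written as multiplication, $\alpha\beta$ being "first $\beta$, then $\alpha$"; $r(\alpha)$ and $s(\alpha)$ are the target and the source of $\alpha$, and an object is identified with its identity morphism. For an object $X$ of $\mathcal C$ the slice category $\mathcal C/X$ has the morphisms with target $X$ as objects and the commutative triangles over $X$ as morphisms. A functor $F:\mathcal E\to\mathcal B$ is a Kumjian–Pask fibration if (i) $\mathcal B$ is strongly right Ore: for all $m,n$ with $r(m)=r(n)$ there are $p,q$ with $mp=nq$, and if $mp_i=nq_i$ for $i=1,2$, then there are $a,b$ with $p_1a=p_2b$ and $q_1a=q_2b$; (ii) $F$ is a discrete Conduché fibration: for every morphism $\phi$ of $\mathcal E$, every factorization of $F(\phi)$ in $\mathcal B$ lifts uniquely to a factorization of $\phi$; (iii) for every object $X$ of $\mathcal E$ the induced functor $\mathcal E/X\to\mathcal B/F(X)$ has a section. It is row-finite if for all $X$ and all $b$ with $r(b)=F(X)$ the set $\{\alpha: r(\alpha)=X,\ F(\alpha)=b\}$ is finite. Let $F$ be a row-finite Kumjian–Pask fibration. A Cuntz–Krieger system for $F$ in a $C^*$-algebra consists of projections $P_X$ ($X$ an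 object of $\mathcal E$) and partial isometries $S_\alpha$ ($\alpha$ a morphism of $\mathcal E$) such that $P_XP_Y=0$ for $X\ne Y$; $S_{\alpha\beta}=S_\alpha S_\beta$ for composable $\alpha,\beta$; $P_X=S_{\mathrm{id}_X}=S_{\mathrm{id}_X}^*$; $S_\alpha^*S_\alpha=P_{s(\alpha)}$; $S_\beta^*S_\alpha=0$ if $F(\alpha)=F(\beta)$ and $\alpha\neq\beta$; and $\sum_{r(\alpha)=X,\,F(\alpha)=b}S_\alpha S_\alpha^*=P_X$ for all $X$ and all $b$ with $r(b)=F(X)$. $C^*(F)$ is the universal $C^*$-algebra generated by a Cuntz–Krieger system $\{p_X,s_\alpha\}$: the completion of the $*$-algebra on these generators and relations in the supremum of the norms in all Cuntz–Krieger systems of operators on Hilbert spaces. An infinite path to $X$ is a section $x:\mathcal B/F(X)\to\mathcal E/X$ of the induced functor; we write $r(x)=X$, $F^\infty$ for the set of all infinite paths, and $Z(\alpha)=\{x: r(x)=r(\alpha),\ x(F(\alpha))=\alpha\}$. For every morphism $\mu$ of $\mathcal E$ there are mutually inverse bijections $\mathrm{res}_\mu$ from $Z(\mu)$ to the set of the infinite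 paths to $s(\mu)$, and $\mathrm{ind}_\mu$ in the other direction, with $\mathrm{ind}_\mu(x)(F(\mu)a)=\mu\,x(a)$. The groupoid $G_F$ consists of the classes $[\mu,\nu,x]$ of triples with $s(\mu)=s(\nu)$ and $x\in Z(\nu)$, where $(\mu,\nu,x)\sim(\mu',\nu',x')$ iff $x=x'$, there is $\lambda$ with $x\in Z(\lambda)\subset Z(\nu)\cap Z(\nu')$ and $\mathrm{ind}_\mu\circ\mathrm{res}_\nu=\mathrm{ind}_{\mu'}\circ\mathrm{res}_{\nu'}$ on $Z(\lambda)$, and there are $a,b$ in $\mathcal B$ with $F(\mu)a=F(\mu')b$ and $F(\nu)a=F(\nu')b$. The arrow $[\mu,\nu,x]$ goes from $x$ to $\mathrm{ind}_\mu(\mathrm{res}_\nu(x))$, and $[\mu,\nu,\mathrm{ind}_\sigma(\mathrm{res}_\tau(y))]\,[\sigma,\tau,y]=[\mu\gamma,\tau\eta,y]$ whenever $\nu\gamma=\sigma\eta$ and $\mathrm{ind}_\sigma(\mathrm{res}_\tau(y))\in Z(\nu\gamma)$. The topology of $G_F$ has the sets $Z(\mu,\nu)=\{[\mu,\nu,x]:x\in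 Z(\nu)\}$ as a basis. $C^*(G_F)$ is the full $C^*$-algebra of $G_F$: the completion of $C_c(G_F)$, with $f*g(\gamma)=\sum_{r(\eta)=r(\gamma)}f(\eta)g(\eta^{-1}\gamma)$ and $f^*(\gamma)=\overline{f(\gamma^{-1})}$, in the norm $\|f\|=\sup\|\pi(f)\|$ over all $*$-representations $\pi$ of $C_c(G_F)$ on Hilbert spaces that map sequences converging in the inductive limit topology (uniformly, with supports eventually in a common compact set) to weak-$*$ convergent sequences. Theorem. Let $F:\mathcal E\to\mathcal B$ be a row-finite Kumjian–Pask fibration such that all morphisms of $\mathcal B$ are monic. Then for every morphism $\alpha$ of $\mathcal E$ the indicator function $\mathbb 1_{Z(\alpha,s(\alpha))}$ belongs to $C_c(G_F)$, and there is a $*$-isomorphism $\Upsilon:C^*(F)\to C^*(G_F)$ with $\Upsilon(s_\alpha)=\mathbb 1_{Z(\alpha,s(\alpha))}$ for every $\alpha$; it is the only $*$-homomorphism $C^*(F)\to C^*(G_F)$ with this property. -/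

import Mathlib

open CategoryTheory
open scoped CompactlySupported

universe v v₁ v₂ u u₁ u₂

namespace KPFib

section Fibrations

variable {E : Type u₁} [Category.{v₁} E] {B : Type u₂} [Category.{v₂} B]

/-- Every cospan can be completed to a commutative square. -/
def IsRightOre (B : Type u₂) [Category.{v₂} B] : Prop :=
  ∀ ⦃a b c : B⦄ (m : a ⟶ c) (n : b ⟶ c),
    ∃ (d : B) (p : d ⟶ a) (q : d ⟶ b), p ≫ m = q ≫ n

/-- Right Ore, and any two completions of the same cospan can be equalized. -/
def IsStronglyRightOre (B : Type u₂) [Category.{v₂} B] : Prop :=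
  IsRightOre B ∧
    ∀ ⦃a b c : B⦄ (m : a ⟶ c) (n : b ⟶ c) ⦃d₁ d₂ : B⦄
      (p₁ : d₁ ⟶ a) (q₁ : d₁ ⟶ b) (p₂ : d₂ ⟶ a) (q₂ : d₂ ⟶ b),
      p₁ ≫ m = q₁ ≫ n → p₂ ≫ m = q₂ ≫ n →
        ∃ (e : B) (s : e ⟶ d₁) (t : e ⟶ d₂), s ≫ p₁ = t ≫ p₂ ∧ s ≫ q₁ = t ≫ q₂

/-- Discrete Conduché fibrations: every factorization of `F φ` lifts uniquely to a factorization
of `φ`. -/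
def IsDiscreteConduche (F : E ⥤ B) : Prop :=
  ∀ ⦃Y X : E⦄ (φ : Y ⟶ X) (b : B) (l : F.obj Y ⟶ b) (ρ : b ⟶ F.obj X),
    F.map φ = l ≫ ρ →
      ∃! t : (Σ Z : E, (Y ⟶ Z) × (Z ⟶ X)),
        t.2.1 ≫ t.2.2 = φ ∧ F.obj t.1 = b ∧ F.map t.2.1 ≍ l ∧ F.map t.2.2 ≍ ρ

/-- For every object `X` of `E`, every morphism of `B` with target `F X` has only finitely many
preimages among the morphisms with target `X`. -/
class IsRowFinite (F : E ⥤ B) : Prop where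
  finite : ∀ (X : E) (b : Over (F.obj X)), {α : Over X | (Over.post F).obj α = b}.Finite

/-- An infinite path to `X`: a section of the functor between slice categories induced by `F`. -/
structure InfinitePath (F : E ⥤ B) (X : E) where
  toFunctor : Over (F.obj X) ⥤ Over X
  section_eq : toFunctor ⋙ Over.post F = 𝟭 (Over (F.obj X))

/-- Kumjian-Pask fibrations: locally split discrete Conduché fibrations over a strongly right
Ore category. -/
class IsKPFibration (F : E ⥤ B) : Prop where
  stronglyRightOre : IsStronglyRightOre B
  conduche : IsDiscreteConduche F
  locallySplit : ∀ X : E, Nonempty (InfinitePath F X)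

variable {F : E ⥤ B}

/-- The set `Z(α)` of the infinite paths `x` with `x (F α) = α`. -/
def cylinder (F : E ⥤ B) {W X : E} (α : W ⟶ X) : Set (InfinitePath F X) :=
  {x | x.toFunctor.obj (Over.mk (F.map α)) = Over.mk α}

theorem IsRightOre.cospan (h : IsRightOre B) {a b c : B} (m : a ⟶ c) (n : b ⟶ c) :
    ∃ (d : B) (p : d ⟶ a) (q : d ⟶ b), p ≫ m = q ≫ n := h m n

theorem over_hom_heq {c : B} {o o' : Over c} (h : o = o') : o.hom ≍ o'.hom := by
  rw [h]

theorem IsStronglyRightOre.cancel (h : IsStronglyRightOre B) {d a a' c : B}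
    (p : d ⟶ a) (m : a ⟶ c) (p' : d ⟶ a') (m' : a' ⟶ c) (hm : Over.mk m = Over.mk m')
    (e : p ≫ m = p' ≫ m') : ∃ (k : B) (s : k ⟶ d), s ≫ p ≍ s ≫ p' := by
  have ha : a = a' := congrArg (fun o : Over c => o.left) hm
  subst ha
  have hm' : m = m' := by
    simpa using over_hom_heq hm
  subst hm'
  obtain ⟨k, s, t, h1, h2⟩ := h.2 m (p ≫ m) p (𝟙 _) p' (𝟙 _) (by simp) (by simpa using e.symm)
  refine ⟨k, s, ?_⟩
  have : s = t := by simpa using h2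
  subst this
  rw [h1]

theorem IsDiscreteConduche.unique (h : IsDiscreteConduche F) {Y X Z Z' : E}
    (g : Y ⟶ Z) (α : Z ⟶ X) (g' : Y ⟶ Z') (α' : Z' ⟶ X) (e : g ≫ α = g' ≫ α')
    (hg : F.map g ≍ F.map g') (hα : Over.mk (F.map α) = Over.mk (F.map α')) :
    (⟨Z, g, α⟩ : Σ Z : E, (Y ⟶ Z) × (Z ⟶ X)) = ⟨Z', g', α'⟩ := by
  have hZ : F.obj Z = F.obj Z' := congrArg (fun o : Over (F.obj X) => o.left) hα
  have hα' : F.map α ≍ F.map α' := over_hom_heq hα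
  obtain ⟨t, -, ht⟩ := h (g ≫ α) (F.obj Z) (F.map g) (F.map α) (F.map_comp _ _)
  exact (ht ⟨Z, g, α⟩ ⟨rfl, rfl, HEq.rfl, HEq.rfl⟩).trans
    (ht ⟨Z', g', α'⟩ ⟨e.symm, hZ.symm, hg.symm, hα'.symm⟩).symm

theorem IsDiscreteConduche.mk_eq (h : IsDiscreteConduche F) {Y X Z Z' : E}
    (g : Y ⟶ Z) (α : Z ⟶ X) (g' : Y ⟶ Z') (α' : Z' ⟶ X) (e : g ≫ α = g' ≫ α')
    (hg : F.map g ≍ F.map g') (hα : Over.mk (F.map α) = Over.mk (F.map α')) :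
    Over.mk α = Over.mk α' := by
  have := h.unique g α g' α' e hg hα
  cases this
  rfl

theorem IsDiscreteConduche.left_eq (h : IsDiscreteConduche F) {Y X Z : E}
    (g g' : Y ⟶ Z) (α : Z ⟶ X) (e : g ≫ α = g' ≫ α) (hg : F.map g = F.map g') : g = g' := by
  have := h.unique g α g' α e (heq_of_eq hg) rfl
  simpa using this

namespace InfinitePath

variable {X : E}

theorem post_obj (x : InfinitePath F X) (a : Over (F.obj X)) :
    (Over.post F).obj (x.toFunctor.obj a) = a := Functor.congr_obj x.section_eq a

theorem exists_mem (x : InfinitePath F X) (a : Over (F.obj X)) :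
    ∃ (W : E) (α : W ⟶ X), a = Over.mk (F.map α) ∧ x ∈ cylinder F α ∧
      x.toFunctor.obj a = Over.mk α := by
  refine ⟨(x.toFunctor.obj a).left, (x.toFunctor.obj a).hom, (x.post_obj a).symm, ?_, rfl⟩
  have h : Over.mk (F.map (x.toFunctor.obj a).hom) = a := x.post_obj a
  change x.toFunctor.obj (Over.mk (F.map (x.toFunctor.obj a).hom)) = x.toFunctor.obj a
  rw [h]

theorem map_left_heq (x : InfinitePath F X) {a b : Over (F.obj X)} (f : a ⟶ b) :
    F.map (x.toFunctor.map f).left ≍ f.left := by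
  have h1 : (Over.post F).map (x.toFunctor.map f) ≍ f := Functor.hcongr_hom x.section_eq f
  have key : ∀ {a' b' : Over (F.obj X)} (f' : a' ⟶ b'), a' = a → b' = b → f' ≍ f →
      f'.left ≍ f.left := by
    rintro a' b' f' rfl rfl h
    rw [eq_of_heq h]
  exact key ((Over.post F).map (x.toFunctor.map f)) (x.post_obj a) (x.post_obj b) h1

theorem mem_unique {x : InfinitePath F X} {W W' : E} {α : W ⟶ X} {α' : W' ⟶ X}
    (h : x ∈ cylinder F α) (h' : x ∈ cylinder F α')
    (e : Over.mk (F.map α) = Over.mk (F.map α')) : Over.mk α = Over.mk α' :=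
  h.symm.trans ((congrArg x.toFunctor.obj e).trans h')

/-- An infinite path through `α` can be continued along every morphism to `F (s α)`. -/
theorem lift (x : InfinitePath F X) {W : E} {α : W ⟶ X} (hα : x ∈ cylinder F α)
    {A : B} (c : A ⟶ F.obj W) :
    ∃ (V : E) (γ : V ⟶ W) (h : F.obj V = A), F.map γ = eqToHom h ≫ c ∧
      x ∈ cylinder F (γ ≫ α) := by
  have key : ∀ o : Over X, ∀ (g : o ⟶ Over.mk α), (Over.post F).obj o = Over.mk (c ≫ F.map α) →
      F.map g.left ≍ c → x.toFunctor.obj (Over.mk (c ≫ F.map α)) = o →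
      ∃ (V : E) (γ : V ⟶ W) (h : F.obj V = A), F.map γ = eqToHom h ≫ c ∧
        x ∈ cylinder F (γ ≫ α) := by
    intro o g ho hg hx
    have hA : F.obj o.left = A := congrArg (fun o : Over (F.obj X) => o.left) ho
    refine ⟨o.left, g.left, hA, ?_, ?_⟩
    · subst hA
      simpa using hg
    · have hw : g.left ≫ α = o.hom := Over.w g
      change x.toFunctor.obj (Over.mk (F.map (g.left ≫ α))) = Over.mk (g.left ≫ α)
      rw [hw]
      have : Over.mk (F.map o.hom) = Over.mk (c ≫ F.map α) := ho
      rw [this, hx]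
      rfl
  let f : Over.mk (c ≫ F.map α) ⟶ Over.mk (F.map α) := Over.homMk c rfl
  have e : x.toFunctor.obj (Over.mk (F.map α)) = Over.mk α := hα
  refine key _ (x.toFunctor.map f ≫ eqToHom e) (x.post_obj _) ?_ rfl
  have h2 := x.map_left_heq f
  have : (x.toFunctor.map f ≫ eqToHom e).left ≍ (x.toFunctor.map f).left := by
    rw [Over.comp_left, Over.eqToHom_left]
    exact comp_eqToHom_heq _ _
  refine HEq.trans ?_ h2
  have hl : (Over.mk α).left = (x.toFunctor.obj (Over.mk (F.map α))).left := by rw [e]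
  have key2 : ∀ {V W W' : E} (g : V ⟶ W) (g' : V ⟶ W'), W = W' → g ≍ g' → F.map g ≍ F.map g' := by
    rintro V W W' g g' rfl h
    rw [eq_of_heq h]
  exact key2 _ _ hl this

theorem mem_of_comp (hF : IsDiscreteConduche F) {x : InfinitePath F X} {V W : E} {γ : V ⟶ W}
    {α : W ⟶ X} (h : x ∈ cylinder F (γ ≫ α)) : x ∈ cylinder F α := by
  have key : ∀ o : Over X, ∀ (g : Over.mk (γ ≫ α) ⟶ o),
      (Over.post F).obj o = Over.mk (F.map α) → F.map g.left ≍ F.map γ → o = Over.mk α := by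
    intro o g ho hg
    exact hF.mk_eq g.left o.hom γ α (Over.w g) hg ho
  let f : Over.mk (F.map (γ ≫ α)) ⟶ Over.mk (F.map α) := Over.homMk (F.map γ) (by simp)
  have e : x.toFunctor.obj (Over.mk (F.map (γ ≫ α))) = Over.mk (γ ≫ α) := h
  refine key _ (eqToHom e.symm ≫ x.toFunctor.map f) (x.post_obj _) ?_
  refine HEq.trans ?_ (x.map_left_heq f)
  have : (eqToHom e.symm ≫ x.toFunctor.map f).left ≍ (x.toFunctor.map f).left := by
    rw [Over.comp_left, Over.eqToHom_left]
    exact eqToHom_comp_heq _ _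
  have hl : (Over.mk (γ ≫ α)).left = (x.toFunctor.obj (Over.mk (F.map (γ ≫ α)))).left := by rw [e]
  have key2 : ∀ {V V' W : E} (g : V ⟶ W) (g' : V' ⟶ W), V = V' → g ≍ g' → F.map g ≍ F.map g' := by
    rintro V V' W g g' rfl h
    rw [eq_of_heq h]
  exact key2 _ _ hl this

theorem ext_of_mem (hF : IsDiscreteConduche F) {x y : InfinitePath F X}
    (h : ∀ ⦃W : E⦄ (α : W ⟶ X), x ∈ cylinder F α → y ∈ cylinder F α) : x = y := by
  have hobj : ∀ a, x.toFunctor.obj a = y.toFunctor.obj a := by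
    intro a
    obtain ⟨W, α, ha, hx, hxa⟩ := x.exists_mem a
    rw [hxa, ha]
    exact (h α hx).symm
  have hfun : x.toFunctor = y.toFunctor := by
    refine Functor.hext hobj fun a b f => ?_
    have key : ∀ {o p o' p' : Over X} (g : o ⟶ p) (g' : o' ⟶ p'), o = o' → p = p' →
        F.map g.left ≍ F.map g'.left → g ≍ g' := by
      rintro o p o' p' g g' rfl rfl h
      refine heq_of_eq (Over.OverMorphism.ext ?_)
      exact hF.left_eq g.left g'.left p.hom (by simp) (eq_of_heq h)
    exact key _ _ (hobj a) (hobj b) ((x.map_left_heq f).trans (y.map_left_heq f).symm)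
  obtain ⟨xf, hx⟩ := x
  obtain ⟨yf, hy⟩ := y
  cases hfun
  rfl

/-- An infinite path is determined by the set of the morphisms that it passes through, and every
set with the following three properties is obtained. -/
theorem exists_of_set (hF : IsDiscreteConduche F) (P : Set (Over X))
    (ex : ∀ a : Over (F.obj X), ∃ α ∈ P, (Over.post F).obj α = a)
    (uniq : ∀ α ∈ P, ∀ β ∈ P, (Over.post F).obj α = (Over.post F).obj β → α = β)
    (down : ∀ ⦃V W : E⦄ (γ : V ⟶ W) (α : W ⟶ X), Over.mk (γ ≫ α) ∈ P → Over.mk α ∈ P) :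
    ∃ x : InfinitePath F X, ∀ ⦃W : E⦄ (α : W ⟶ X), x ∈ cylinder F α ↔ Over.mk α ∈ P := by
  choose o hoP ho using ex
  have exm : ∀ (a b : Over (F.obj X)) (f : a ⟶ b), ∃ g : o a ⟶ o b, F.map g.left ≍ f.left := by
    intro a b f
    have key : ∀ a' : Over (F.obj X), ∀ f' : a' ⟶ b, (Over.post F).obj (o a) = a' →
        ∃ g : o a ⟶ o b, F.map g.left ≍ f'.left := by
      rintro _ f' rfl
      obtain ⟨⟨Z, g, β⟩, ⟨h1, h2, h3, h4⟩, -⟩ := hF (o a).hom b.left f'.left b.hom (Over.w f').symm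
      dsimp only at h1 h2 h3 h4
      have hβ : Over.mk β ∈ P := by
        apply down g β
        rw [h1]
        exact hoP a
      have hb : Over.mk (F.map β) = b := by
        have : ∀ (b' : B) (r : b' ⟶ F.obj X), F.obj Z = b' → F.map β ≍ r →
            Over.mk (F.map β) = Over.mk r := by
          rintro _ r rfl h
          rw [eq_of_heq h]
        exact this b.left b.hom h2 h4
      have hob : Over.mk β = o b := uniq _ hβ _ (hoP b) (hb.trans (ho b).symm)
      have : ∀ p : Over X, Over.mk β = p → ∃ g : o a ⟶ p, F.map g.left ≍ f'.left := by
        rintro _ rfl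
        exact ⟨Over.homMk g h1, h3⟩
      exact this _ hob
    exact key a f (ho a)
  choose m hm using exm
  have hmu : ∀ {a b : Over (F.obj X)} (g g' : o a ⟶ o b), F.map g.left = F.map g'.left →
      g = g' := by
    intro a b g g' h
    exact Over.OverMorphism.ext (hF.left_eq g.left g'.left (o b).hom (by simp) h)
  have hl : ∀ a, F.obj (o a).left = a.left := fun a =>
    congrArg (fun p : Over (F.obj X) => p.left) (ho a)
  let x : Over (F.obj X) ⥤ Over X :=
    { obj := o
      map := fun {a b} f => m a b f
      map_id := by
        intro a
        refine hmu _ _ (eq_of_heq ((hm a a (𝟙 a)).trans ?_))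
        rw [Over.id_left, Over.id_left, F.map_id]
        rw [hl]
      map_comp := by
        intro a b c f g
        refine hmu _ _ (eq_of_heq ((hm a c (f ≫ g)).trans ?_))
        rw [Over.comp_left, Over.comp_left, F.map_comp]
        have : ∀ {a b c a' b' c' : B} (f : a ⟶ b) (g : b ⟶ c) (f' : a' ⟶ b') (g' : b' ⟶ c'),
            a = a' → b = b' → c = c' → f ≍ f' → g ≍ g' → f ≫ g ≍ f' ≫ g' := by
          rintro a b c _ _ _ f g f' g' rfl rfl rfl hf hg
          rw [eq_of_heq hf, eq_of_heq hg]
        exact this _ _ _ _ (hl a).symm (hl b).symm (hl c).symm (hm a b f).symm (hm b c g).symm }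
  have hx : x ⋙ Over.post F = 𝟭 _ := by
    refine Functor.hext ho fun a b f => ?_
    have key : ∀ {a b a' b' : Over (F.obj X)} (f : a ⟶ b) (f' : a' ⟶ b'), a = a' → b = b' →
        f.left ≍ f'.left → f ≍ f' := by
      rintro a b _ _ f f' rfl rfl h
      exact heq_of_eq (Over.OverMorphism.ext (eq_of_heq h))
    exact key ((Over.post F).map (m a b f)) f (ho a) (ho b) (hm a b f)
  refine ⟨⟨x, hx⟩, fun W α => ?_⟩
  change o (Over.mk (F.map α)) = Over.mk α ↔ _
  constructor
  · intro h
    rw [← h]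
    exact hoP _
  · intro h
    exact uniq _ (hoP _) _ h (ho _)

/-- Two initial pieces of the same path have a common continuation on the path. -/
theorem common (hO : IsRightOre B) {x : InfinitePath F X} {W W' : E}
    {α : W ⟶ X} {β : W' ⟶ X} (hα : x ∈ cylinder F α) (hβ : x ∈ cylinder F β) :
    ∃ (V : E) (γ : V ⟶ W) (δ : V ⟶ W'), γ ≫ α = δ ≫ β ∧ x ∈ cylinder F (γ ≫ α) := by
  obtain ⟨d, p, q, h⟩ := hO (F.map α) (F.map β)
  obtain ⟨V, γ, hV, hγ, hx⟩ := x.lift hα p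
  subst hV
  obtain ⟨V', δ, hV', hδ, hx'⟩ := x.lift hβ q
  have e : Over.mk (γ ≫ α) = Over.mk (δ ≫ β) := by
    refine mem_unique hx hx' ?_
    rw [F.map_comp, F.map_comp, hγ, hδ]
    simp only [eqToHom_refl, Category.id_comp, h, Category.assoc]
    clear hδ hγ
    revert hV'
    generalize F.obj V' = v
    rintro rfl
    simp
  have hVV : V = V' := congrArg (fun o : Over X => o.left) e
  subst hVV
  have e' : γ ≫ α = δ ≫ β := by simpa using over_hom_heq e
  exact ⟨V, γ, δ, e', hx⟩

/-- Two continuations of an initial piece of a path that give the same initial piece become equal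
further along the path. -/
theorem equalize (hO : IsStronglyRightOre B) (hF : IsDiscreteConduche F) {x : InfinitePath F X}
    {V W : E} {g g' : V ⟶ W} {m : W ⟶ X} (e : g ≫ m = g' ≫ m) (hx : x ∈ cylinder F (g ≫ m)) :
    ∃ (U : E) (θ : U ⟶ V), θ ≫ g = θ ≫ g' ∧ x ∈ cylinder F (θ ≫ g ≫ m) := by
  obtain ⟨k, s, hs⟩ := hO.cancel (F.map g) (F.map m) (F.map g') (F.map m) rfl
    (by rw [← F.map_comp, ← F.map_comp, e])
  obtain ⟨U, θ, hU, hθ, hx'⟩ := x.lift hx s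
  subst hU
  refine ⟨U, θ, ?_, hx'⟩
  refine hF.left_eq _ _ m (by simp [e]) ?_
  simpa [hθ] using hs

end InfinitePath

section ResInd

variable [hF : IsKPFibration F] {W X : E}

theorem exists_res (μ : W ⟶ X) (x : cylinder F μ) :
    ∃ z : InfinitePath F W, ∀ ⦃V : E⦄ (γ : V ⟶ W),
      z ∈ cylinder F γ ↔ x.1 ∈ cylinder F (γ ≫ μ) := by
  refine InfinitePath.exists_of_set hF.conduche {o | x.1 ∈ cylinder F (o.hom ≫ μ)} ?_ ?_ ?_
  · intro a
    obtain ⟨V, γ, hV, hγ, hx⟩ := x.1.lift x.2 a.hom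
    refine ⟨Over.mk γ, hx, ?_⟩
    change Over.mk (F.map γ) = a
    rw [hγ]
    have : ∀ {b c : B} (h : b = c) (f : c ⟶ F.obj W), Over.mk (eqToHom h ≫ f) = Over.mk f := by
      rintro b _ rfl f
      simp
    exact this hV a.hom
  · intro α hα β hβ e
    have e' : Over.mk (F.map α.hom) = Over.mk (F.map β.hom) := e
    have h1 : Over.mk (F.map (α.hom ≫ μ)) = Over.mk (F.map (β.hom ≫ μ)) := by
      have : ∀ {o o' : Over (F.obj W)}, o = o' →
          Over.mk (o.hom ≫ F.map μ) = Over.mk (o'.hom ≫ F.map μ) := by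
        rintro o _ rfl
        rfl
      simpa using this e'
    have h2 := InfinitePath.mem_unique hα hβ h1
    have h3 : ∀ {o o' : Over W}, Over.mk (o.hom ≫ μ) = Over.mk (o'.hom ≫ μ) →
        Over.mk (F.map o.hom) = Over.mk (F.map o'.hom) → o = o' := by
      intro o o' h h'
      obtain ⟨l, ⟨⟨⟩⟩, f⟩ := o
      obtain ⟨l', ⟨⟨⟩⟩, f'⟩ := o'
      have hl : l = l' := congrArg (fun o : Over X => o.left) h
      subst hl
      have hf : f ≫ μ = f' ≫ μ := by simpa using over_hom_heq h
      have hf' : F.map f = F.map f' := by simpa using over_hom_heq h'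
      have : f = f' := hF.conduche.left_eq f f' μ hf hf'
      subst this
      rfl
    exact h3 h2 e'
  · intro V W' γ α h
    have h' : x.1 ∈ cylinder F ((γ ≫ α) ≫ μ) := h
    rw [Category.assoc] at h'
    exact InfinitePath.mem_of_comp hF.conduche h'

/-- The map `res_μ` from `Z(μ)` to the paths to the source of `μ`, which removes `μ`. -/
noncomputable def res (μ : W ⟶ X) (x : cylinder F μ) : InfinitePath F W :=
  (exists_res μ x).choose

theorem mem_res (μ : W ⟶ X) (x : cylinder F μ) {V : E} (γ : V ⟶ W) :
    res μ x ∈ cylinder F γ ↔ x.1 ∈ cylinder F (γ ≫ μ) :=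
  (exists_res μ x).choose_spec γ

theorem exists_ind (μ : W ⟶ X) (z : InfinitePath F W) :
    ∃ x : InfinitePath F X, ∀ ⦃V : E⦄ (α : V ⟶ X),
      x ∈ cylinder F α ↔
        ∃ (U : E) (γ : U ⟶ W) (δ : U ⟶ V), z ∈ cylinder F γ ∧ γ ≫ μ = δ ≫ α := by
  refine InfinitePath.exists_of_set hF.conduche
    {o | ∃ (U : E) (γ : U ⟶ W) (δ : U ⟶ o.left), z ∈ cylinder F γ ∧ γ ≫ μ = δ ≫ o.hom} ?_ ?_ ?_
  · intro a
    obtain ⟨d, p, q, h⟩ := hF.stronglyRightOre.1 (F.map μ) a.hom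
    have hid : z ∈ cylinder F (𝟙 W) := by
      obtain ⟨U, γ, -, hz, -⟩ := z.exists_mem (Over.mk (𝟙 (F.obj W)))
      refine InfinitePath.mem_of_comp hF.conduche (γ := γ) ?_
      simpa using hz
    obtain ⟨U, γ, hU, hγ, hz⟩ := z.lift hid p
    subst hU
    rw [Category.comp_id] at hz
    obtain ⟨⟨Z, δ, α⟩, ⟨h1, h2, h3, h4⟩, -⟩ :=
      hF.conduche (γ ≫ μ) a.left q a.hom (by rw [F.map_comp, hγ, ← h]; simp)
    dsimp only at h1 h2 h3 h4
    refine ⟨Over.mk α, ⟨U, γ, δ, hz, h1.symm⟩, ?_⟩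
    have : ∀ (b' : B) (r : b' ⟶ F.obj X), F.obj Z = b' → F.map α ≍ r →
        Over.mk (F.map α) = Over.mk r := by
      rintro _ r rfl h
      rw [eq_of_heq h]
    exact this _ _ h2 h4
  · rintro α ⟨U, γ, δ, hz, e⟩ β ⟨U', γ', δ', hz', e'⟩ hαβ
    obtain ⟨V, κ, κ', hκ, hz2⟩ := InfinitePath.common hF.stronglyRightOre.1 hz hz'
    have hαβ' : Over.mk (F.map α.hom) = Over.mk (F.map β.hom) := hαβ
    have e2 : (κ ≫ δ) ≫ α.hom = (κ' ≫ δ') ≫ β.hom := by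
      rw [Category.assoc, Category.assoc, ← e, ← e', ← Category.assoc, ← Category.assoc, hκ]
    obtain ⟨k, s, hs⟩ := hF.stronglyRightOre.cancel (F.map (κ ≫ δ)) (F.map α.hom)
      (F.map (κ' ≫ δ')) (F.map β.hom) hαβ' (by rw [← F.map_comp, ← F.map_comp, e2])
    obtain ⟨U2, θ, hU2, hθ, -⟩ := z.lift hz2 s
    subst hU2
    have hθ' : F.map θ = s := by simpa using hθ
    refine hF.conduche.mk_eq (θ ≫ κ ≫ δ) α.hom (θ ≫ κ' ≫ δ') β.hom ?_ ?_ hαβ'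
    · rw [Category.assoc, e2, ← Category.assoc]
    · rw [F.map_comp, F.map_comp θ, hθ']
      exact hs
  · rintro V W' γ α ⟨U, γ', δ, hz, e⟩
    exact ⟨U, γ', δ ≫ γ, hz, by rw [e, Category.assoc]; rfl⟩

theorem mem_cylinder_id (x : InfinitePath F X) : x ∈ cylinder F (𝟙 X) := by
  obtain ⟨U, γ, -, hz, -⟩ := x.exists_mem (Over.mk (𝟙 (F.obj X)))
  refine InfinitePath.mem_of_comp hF.conduche (γ := γ) ?_
  simpa using hz

theorem res_bijective (μ : W ⟶ X) : Function.Bijective (res (F := F) μ) := by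
  constructor
  · intro x y h
    refine Subtype.ext (InfinitePath.ext_of_mem hF.conduche fun V α hα => ?_)
    obtain ⟨U, γ, δ, e, hγ⟩ :=
      InfinitePath.common hF.stronglyRightOre.1 x.2 hα
    rw [← mem_res, h, mem_res, e] at hγ
    exact InfinitePath.mem_of_comp hF.conduche hγ
  · intro z
    obtain ⟨x, hx⟩ := exists_ind μ z
    have hxμ : x ∈ cylinder F μ :=
      (hx μ).2 ⟨W, 𝟙 W, 𝟙 W, mem_cylinder_id z, rfl⟩
    refine ⟨⟨x, hxμ⟩, Eq.symm (InfinitePath.ext_of_mem hF.conduche fun V γ hγ => ?_)⟩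
    rw [mem_res]
    exact (hx _).2 ⟨V, γ, 𝟙 V, hγ, by simp⟩

/-- The map `ind_μ` from the paths to the source of `μ` to `Z(μ)`, inverse to `res_μ`. It is the
only map with `ind_μ(x)(F(μ)a) = μ x(a)` for all `a`: see `mem_ind_comp`. -/
noncomputable def ind (μ : W ⟶ X) (z : InfinitePath F W) : cylinder F μ :=
  (Equiv.ofBijective _ (res_bijective μ)).symm z

theorem res_ind (μ : W ⟶ X) (z : InfinitePath F W) : res μ (ind μ z) = z :=
  (Equiv.ofBijective _ (res_bijective μ)).apply_symm_apply z

theorem ind_res (μ : W ⟶ X) (x : cylinder F μ) : ind μ (res μ x) = x :=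
  (Equiv.ofBijective _ (res_bijective μ)).symm_apply_apply x

theorem mem_ind_comp (μ : W ⟶ X) (z : InfinitePath F W) {V : E} (γ : V ⟶ W) :
    (ind μ z).1 ∈ cylinder F (γ ≫ μ) ↔ z ∈ cylinder F γ := by
  rw [← mem_res, res_ind]

end ResInd

/-- The space `F^∞` of all infinite paths. -/
structure PathSpace (F : E ⥤ B) where
  /-- The object `r(x)`. -/
  r : E
  path : InfinitePath F r

section Groupoid

variable [hF : IsKPFibration F]

/-- The triples `(μ, ν, x)` with `s(μ) = s(ν)`, `x ∈ Z(ν)` and `ind_μ (res_ν x) = y`. -/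
structure Germ (x y : PathSpace F) where
  apex : E
  μ : apex ⟶ y.r
  ν : apex ⟶ x.r
  mem : x.path ∈ cylinder F ν
  ind_res_eq : (ind μ (res ν ⟨x.path, mem⟩)).1 = y.path

/-- The relation `(μ, ν, x) ∼ (μ', ν', x)`: the maps `ind_μ ∘ res_ν` and `ind_μ' ∘ res_ν'` agree on
a neighbourhood `Z(l)` of `x`, and there are `a`, `b` in the base with `F(μ)a = F(μ')b` and
`F(ν)a = F(ν')b`. -/
def Germ.Rel {x y : PathSpace F} (p q : Germ x y) : Prop :=
  (∃ (V : E) (l : V ⟶ x.r), x.path ∈ cylinder F l ∧ ∀ z ∈ cylinder F l,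
      ∃ (h : z ∈ cylinder F p.ν) (h' : z ∈ cylinder F q.ν),
        (ind p.μ (res p.ν ⟨z, h⟩)).1 = (ind q.μ (res q.ν ⟨z, h'⟩)).1) ∧
  ∃ (A : B) (a : A ⟶ F.obj p.apex) (b : A ⟶ F.obj q.apex),
    a ≫ F.map p.μ = b ≫ F.map q.μ ∧ a ≫ F.map p.ν = b ≫ F.map q.ν

theorem ind_res_comp {W V X Y : E} (μ : W ⟶ Y) (ν : W ⟶ X) (γ : V ⟶ W) (z : InfinitePath F X)
    (h : z ∈ cylinder F ν) (h' : z ∈ cylinder F (γ ≫ ν)) :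
    (ind μ (res ν ⟨z, h⟩)).1 = (ind (γ ≫ μ) (res (γ ≫ ν) ⟨z, h'⟩)).1 := by
  have hm : (ind μ (res ν ⟨z, h⟩)).1 ∈ cylinder F (γ ≫ μ) := by
    rw [mem_ind_comp, mem_res]
    exact h'
  have : (⟨_, hm⟩ : cylinder F (γ ≫ μ)) = ind (γ ≫ μ) (res (γ ≫ ν) ⟨z, h'⟩) := by
    apply (res_bijective (F := F) (γ ≫ μ)).1
    rw [res_ind]
    refine InfinitePath.ext_of_mem hF.conduche fun U α hα => ?_
    rw [mem_res] at hα ⊢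
    rw [← Category.assoc, mem_ind_comp, mem_res, Category.assoc] at hα
    exact hα
  exact congrArg Subtype.val this

theorem Germ.mem_iff {x y : PathSpace F} (p : Germ x y) {V : E} (γ : V ⟶ p.apex) :
    y.path ∈ cylinder F (γ ≫ p.μ) ↔ x.path ∈ cylinder F (γ ≫ p.ν) := by
  rw [← p.ind_res_eq, mem_ind_comp, mem_res]

theorem Germ.mem_μ {x y : PathSpace F} (p : Germ x y) : y.path ∈ cylinder F p.μ := by
  rw [← p.ind_res_eq]
  exact (ind _ _).2

/-- The germ `(γμ, γν, x)` for a continuation `γ` along `x`. -/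
def Germ.refine {x y : PathSpace F} (p : Germ x y) {V : E} (γ : V ⟶ p.apex)
    (h : x.path ∈ cylinder F (γ ≫ p.ν)) : Germ x y :=
  ⟨V, γ ≫ p.μ, γ ≫ p.ν, h, by rw [← ind_res_comp _ _ _ _ p.mem, p.ind_res_eq]⟩

theorem Germ.rel_iff {x y : PathSpace F} (p q : Germ x y) :
    p.Rel q ↔ ∃ (V : E) (γ : V ⟶ p.apex) (γ' : V ⟶ q.apex),
      γ ≫ p.μ = γ' ≫ q.μ ∧ γ ≫ p.ν = γ' ≫ q.ν ∧ x.path ∈ cylinder F (γ ≫ p.ν) := by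
  constructor
  · rintro ⟨-, A, a, b, h1, h2⟩
    obtain ⟨V, γ, hV, hγ, hx⟩ := x.path.lift p.mem a
    subst hV
    obtain ⟨V', γ', hV', hγ', hx'⟩ := x.path.lift q.mem b
    have key : ∀ {Y Y' : E} (m : p.apex ⟶ Y) (m' : q.apex ⟶ Y) (z : InfinitePath F Y),
        a ≫ F.map m = b ≫ F.map m' → z ∈ cylinder F (γ ≫ m) → z ∈ cylinder F (γ' ≫ m') →
        Over.mk (γ ≫ m) = Over.mk (γ' ≫ m') := by
      intro Y Y' m m' z e hz hz'
      refine InfinitePath.mem_unique hz hz' ?_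
      rw [F.map_comp, F.map_comp, hγ, hγ']
      simp only [eqToHom_refl, Category.id_comp, e, Category.assoc]
      clear hγ' hγ
      revert hV'
      generalize F.obj V' = v
      rintro rfl
      simp
    have k1 := key (Y' := x.r) p.ν q.ν x.path h2 hx hx'
    have k2 := key (Y' := x.r) p.μ q.μ y.path h1 ((p.mem_iff γ).2 hx) ((q.mem_iff γ').2 hx')
    have hVV : V = V' := congrArg (fun o : Over x.r => o.left) k1
    subst hVV
    exact ⟨V, γ, γ', by simpa using over_hom_heq k2, by simpa using over_hom_heq k1, hx⟩
  · rintro ⟨V, γ, γ', h1, h2, hx⟩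
    refine ⟨⟨V, γ ≫ p.ν, hx, fun z hz => ?_⟩, F.obj V, F.map γ, F.map γ', ?_, ?_⟩
    · have hz' : z ∈ cylinder F (γ' ≫ q.ν) := h2 ▸ hz
      refine ⟨InfinitePath.mem_of_comp hF.conduche hz, InfinitePath.mem_of_comp hF.conduche hz', ?_⟩
      rw [ind_res_comp _ _ γ _ _ hz, ind_res_comp _ _ γ' _ _ hz']
      have key : ∀ (m m' : V ⟶ y.r) (n n' : V ⟶ x.r) (h : z ∈ cylinder F n)
          (h' : z ∈ cylinder F n'), m = m' → n = n' →
          (ind m (res n ⟨z, h⟩)).1 = (ind m' (res n' ⟨z, h'⟩)).1 := by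
        rintro m _ n _ h h' rfl rfl
        rfl
      exact key _ _ _ _ hz hz' h1 h2
    · rw [← F.map_comp, ← F.map_comp, h1]
    · rw [← F.map_comp, ← F.map_comp, h2]

theorem InfinitePath.common' {x : PathSpace F} {W W' : E}
    {α : W ⟶ x.r} {β : W' ⟶ x.r} (hα : x.path ∈ cylinder F α) (hβ : x.path ∈ cylinder F β) :
    ∃ (V : E) (γ : V ⟶ W) (δ : V ⟶ W'), γ ≫ α = δ ≫ β ∧ x.path ∈ cylinder F (γ ≫ α) :=
  InfinitePath.common hF.stronglyRightOre.1 hα hβ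

/-- A common continuation of two initial pieces `α = gm`, `β = hm` that make the same step `m`,
along which also the pieces `g`, `h` before that step agree. -/
theorem InfinitePath.common_over {x : PathSpace F} {W W' T : E}
    {g : W ⟶ T} {h : W' ⟶ T} {m : T ⟶ x.r} (hg : x.path ∈ cylinder F (g ≫ m))
    (hh : x.path ∈ cylinder F (h ≫ m)) :
    ∃ (V : E) (γ : V ⟶ W) (δ : V ⟶ W'), γ ≫ g = δ ≫ h ∧ x.path ∈ cylinder F (γ ≫ g ≫ m) := by
  obtain ⟨V, γ, δ, e, hx⟩ := InfinitePath.common' hg hh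
  have e' : (γ ≫ g) ≫ m = (δ ≫ h) ≫ m := by simpa using e
  obtain ⟨U, θ, hθ, hx'⟩ := InfinitePath.equalize hF.stronglyRightOre hF.conduche e'
    (by simpa using hx)
  exact ⟨U, θ ≫ γ, θ ≫ δ, by simpa using hθ, by simpa using hx'⟩

theorem Germ.rel_refine {x y : PathSpace F} (p : Germ x y) {V : E} (γ : V ⟶ p.apex)
    (h : x.path ∈ cylinder F (γ ≫ p.ν)) : p.Rel (p.refine γ h) := by
  rw [Germ.rel_iff]
  exact ⟨V, γ, 𝟙 V, by simp [Germ.refine], by simp [Germ.refine], h⟩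

theorem Germ.rel_refl {x y : PathSpace F} (p : Germ x y) : p.Rel p := by
  rw [Germ.rel_iff]
  exact ⟨_, 𝟙 _, 𝟙 _, rfl, rfl, by simpa using p.mem⟩

theorem Germ.rel_symm {x y : PathSpace F} {p q : Germ x y} (h : p.Rel q) : q.Rel p := by
  rw [Germ.rel_iff] at h ⊢
  obtain ⟨V, γ, γ', h1, h2, h3⟩ := h
  exact ⟨V, γ', γ, h1.symm, h2.symm, h2 ▸ h3⟩

theorem Germ.rel_trans {x y : PathSpace F} {p q r : Germ x y} (h : p.Rel q) (h' : q.Rel r) :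
    p.Rel r := by
  rw [Germ.rel_iff] at h h' ⊢
  obtain ⟨V, γ, γ', h1, h2, h3⟩ := h
  obtain ⟨U, δ, δ', k1, k2, k3⟩ := h'
  obtain ⟨T, κ, κ', e, hx⟩ := InfinitePath.common_over (h2 ▸ h3) k3
  refine ⟨T, κ ≫ γ, κ' ≫ δ', ?_, ?_, ?_⟩
  · rw [Category.assoc, h1, ← Category.assoc, e, Category.assoc, k1, Category.assoc]
  · rw [Category.assoc, h2, ← Category.assoc, e, Category.assoc, k2, Category.assoc]
  · rw [Category.assoc, h2]
    exact hx

/-- The equivalence relation `∼`. -/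
instance germSetoid (x y : PathSpace F) : Setoid (Germ x y) where
  r := Germ.Rel
  iseqv := ⟨Germ.rel_refl, Germ.rel_symm, Germ.rel_trans⟩

/-- The germ `(μγ, τη, x)`, where `νγ = ση` lies on `y`: the composite of `(μ, ν, y)` and
`(σ, τ, x)`. -/
def Germ.compWith {x y z : PathSpace F} (p : Germ x y) (q : Germ y z) {V : E}
    (η : V ⟶ p.apex) (γ : V ⟶ q.apex) (e : η ≫ p.μ = γ ≫ q.ν)
    (h : y.path ∈ cylinder F (η ≫ p.μ)) : Germ x z where
  apex := V
  μ := γ ≫ q.μ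
  ν := η ≫ p.ν
  mem := (p.mem_iff η).1 h
  ind_res_eq := by
    have hx := (p.mem_iff η).1 h
    have hz : z.path ∈ cylinder F (γ ≫ q.μ) := (q.mem_iff γ).2 (e ▸ h)
    have : (⟨z.path, hz⟩ : cylinder F (γ ≫ q.μ)) =
        ind (γ ≫ q.μ) (res (η ≫ p.ν) ⟨x.path, hx⟩) := by
      apply (res_bijective (F := F) (γ ≫ q.μ)).1
      rw [res_ind]
      refine InfinitePath.ext_of_mem hF.conduche fun U α hα => ?_
      rw [mem_res] at hα ⊢
      rw [← Category.assoc, Germ.mem_iff, Category.assoc, ← e, ← Category.assoc,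
        Germ.mem_iff, Category.assoc] at hα
      exact hα
    exact (congrArg Subtype.val this).symm

theorem Germ.exists_match {x y z : PathSpace F} (p : Germ x y) (q : Germ y z) :
    ∃ (V : E) (η : V ⟶ p.apex) (γ : V ⟶ q.apex), η ≫ p.μ = γ ≫ q.ν ∧
      y.path ∈ cylinder F (η ≫ p.μ) := InfinitePath.common' p.mem_μ q.mem

/-- The composite of two germs; its class does not depend on the choices
(see `Germ.compWith_rel`). -/
noncomputable def Germ.comp {x y z : PathSpace F} (p : Germ x y) (q : Germ y z) : Germ x z :=
  p.compWith q (Germ.exists_match p q).choose_spec.choose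
    (Germ.exists_match p q).choose_spec.choose_spec.choose
    (Germ.exists_match p q).choose_spec.choose_spec.choose_spec.1
    (Germ.exists_match p q).choose_spec.choose_spec.choose_spec.2

theorem Germ.compWith_rel {x y z : PathSpace F} {p p' : Germ x y} {q q' : Germ y z}
    (hp : p.Rel p') (hq : q.Rel q') {V V' : E}
    (η : V ⟶ p.apex) (γ : V ⟶ q.apex) (e : η ≫ p.μ = γ ≫ q.ν)
    (h : y.path ∈ cylinder F (η ≫ p.μ))
    (η' : V' ⟶ p'.apex) (γ' : V' ⟶ q'.apex) (e' : η' ≫ p'.μ = γ' ≫ q'.ν)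
    (h' : y.path ∈ cylinder F (η' ≫ p'.μ)) :
    (p.compWith q η γ e h).Rel (p'.compWith q' η' γ' e' h') := by
  rw [Germ.rel_iff] at hp hq
  obtain ⟨A, a, a', a1, a2, a3⟩ := hp
  obtain ⟨C, c, c', c1, c2, c3⟩ := hq
  have a4 : y.path ∈ cylinder F (a ≫ p.μ) := (p.mem_iff a).2 a3
  -- equalize `η` with `a`, then `η'` with `a'`
  obtain ⟨T, k, l, kl, hT⟩ := InfinitePath.common_over h a4
  have hT' : y.path ∈ cylinder F ((l ≫ a') ≫ p'.μ) := by
    rw [Category.assoc, ← a1, ← Category.assoc, ← kl, Category.assoc]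
    exact hT
  obtain ⟨S, k', l', kl', hS⟩ := InfinitePath.common_over h' hT'
  -- now equalize over `q.ν` and `q'.ν`
  have hS1 : y.path ∈ cylinder F ((l' ≫ k ≫ γ) ≫ q.ν) := by
    have : (l' ≫ k ≫ γ) ≫ q.ν = k' ≫ η' ≫ p'.μ := by
      rw [← Category.assoc k', kl']
      simp only [Category.assoc]
      rw [← e, ← a1, ← Category.assoc k, kl, Category.assoc]
    rw [this]
    exact hS
  obtain ⟨R, m, n, mn, hR⟩ := InfinitePath.common_over hS1 c3
  have eR : m ≫ (l' ≫ k ≫ γ) ≫ q.ν = (m ≫ k' ≫ γ') ≫ q'.ν := by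
    simp only [Category.assoc]
    rw [← e, ← e', ← Category.assoc k', kl', ← Category.assoc k, kl]
    simp only [Category.assoc]
    rw [a1]
  have hR1 : y.path ∈ cylinder F ((m ≫ k' ≫ γ') ≫ q'.ν) := eR ▸ hR
  have hR2 : y.path ∈ cylinder F ((n ≫ c') ≫ q'.ν) := by
    rw [Category.assoc, ← c2, ← Category.assoc, ← mn, Category.assoc]
    exact hR
  have e2 : (m ≫ k' ≫ γ') ≫ q'.ν = (n ≫ c') ≫ q'.ν := by
    rw [← eR, Category.assoc n, ← c2, ← Category.assoc m, mn, Category.assoc]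
  obtain ⟨Q, θ, hθ, hQ⟩ := InfinitePath.equalize hF.stronglyRightOre hF.conduche e2 hR1
  rw [Germ.rel_iff]
  refine ⟨Q, θ ≫ m ≫ l' ≫ k, θ ≫ m ≫ k', ?_, ?_, ?_⟩
  · change (θ ≫ m ≫ l' ≫ k) ≫ γ ≫ q.μ = (θ ≫ m ≫ k') ≫ γ' ≫ q'.μ
    have w1 : (θ ≫ m ≫ l' ≫ k) ≫ γ ≫ q.μ = θ ≫ (m ≫ l' ≫ k ≫ γ) ≫ q.μ := by simp
    have w2 : (θ ≫ m ≫ k') ≫ γ' ≫ q'.μ = (θ ≫ m ≫ k' ≫ γ') ≫ q'.μ := by simp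
    rw [w1, mn, w2, hθ]
    simp [c1]
  · change (θ ≫ m ≫ l' ≫ k) ≫ η ≫ p.ν = (θ ≫ m ≫ k') ≫ η' ≫ p'.ν
    have w1 : (θ ≫ m ≫ l' ≫ k) ≫ η ≫ p.ν = θ ≫ m ≫ l' ≫ (k ≫ η) ≫ p.ν := by simp
    have w2 : (θ ≫ m ≫ k') ≫ η' ≫ p'.ν = θ ≫ m ≫ (k' ≫ η') ≫ p'.ν := by simp
    rw [w1, w2, kl, kl']
    simp [a2]
  · change x.path ∈ cylinder F ((θ ≫ m ≫ l' ≫ k) ≫ η ≫ p.ν)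
    rw [← Category.assoc, ← Germ.mem_iff]
    have : θ ≫ (m ≫ k' ≫ γ') ≫ q'.ν = ((θ ≫ m ≫ l' ≫ k) ≫ η) ≫ p.μ := by
      rw [← eR]
      simp [e]
    rw [← this]
    exact hQ

/-- The identity germ `(r(x), r(x), x)`. -/
def Germ.id (x : PathSpace F) : Germ x x :=
  ⟨x.r, 𝟙 _, 𝟙 _, mem_cylinder_id _, congrArg Subtype.val (ind_res (𝟙 x.r) ⟨x.path, _⟩)⟩

/-- The germ `(ν, μ, ind_μ (res_ν x))`. -/
def Germ.inv {x y : PathSpace F} (p : Germ x y) : Germ y x where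
  apex := p.apex
  μ := p.ν
  ν := p.μ
  mem := p.mem_μ
  ind_res_eq := by
    have h : (⟨y.path, p.mem_μ⟩ : cylinder F p.μ) = ind p.μ (res p.ν ⟨x.path, p.mem⟩) :=
      Subtype.ext p.ind_res_eq.symm
    rw [h, res_ind, ind_res]

theorem Germ.inv_rel {x y : PathSpace F} {p q : Germ x y} (h : p.Rel q) : p.inv.Rel q.inv := by
  rw [Germ.rel_iff] at h ⊢
  obtain ⟨V, γ, γ', h1, h2, h3⟩ := h
  exact ⟨V, γ, γ', h2, h1, (p.mem_iff γ).2 h3⟩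

theorem Germ.comp_rel {x y z : PathSpace F} {p p' : Germ x y} {q q' : Germ y z}
    (hp : p.Rel p') (hq : q.Rel q') : (p.comp q).Rel (p'.comp q') :=
  Germ.compWith_rel hp hq _ _ _ _ _ _ _ _

theorem Germ.comp_rel_compWith {x y z : PathSpace F} (p : Germ x y) (q : Germ y z) {V : E}
    (η : V ⟶ p.apex) (γ : V ⟶ q.apex) (e : η ≫ p.μ = γ ≫ q.ν)
    (h : y.path ∈ cylinder F (η ≫ p.μ)) : (p.comp q).Rel (p.compWith q η γ e h) :=
  Germ.compWith_rel p.rel_refl q.rel_refl _ _ _ _ _ _ _ _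

/-- The groupoid `G_F`, with the unit space `F^∞`: an arrow from `x` to `y` is a class
`[μ, ν, x]` with `ind_μ (res_ν x) = y`. -/
noncomputable instance pathGroupoid : Groupoid (PathSpace F) where
  Hom x y := _root_.Quotient (germSetoid x y)
  id x := _root_.Quotient.mk _ (Germ.id x)
  comp := _root_.Quotient.map₂ Germ.comp fun _ _ hp _ _ hq => Germ.comp_rel hp hq
  inv := _root_.Quotient.map Germ.inv fun _ _ h => Germ.inv_rel h
  id_comp := by
    rintro x y ⟨p⟩
    refine _root_.Quotient.sound (Germ.rel_trans
      (Germ.comp_rel_compWith (Germ.id x) p p.ν (𝟙 _) (by simp [Germ.id]) ?_) ?_)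
    · simpa [Germ.id] using p.mem
    · rw [Germ.rel_iff]
      exact ⟨_, 𝟙 _, 𝟙 _, by simp [Germ.compWith], by simp [Germ.compWith, Germ.id],
        by simpa [Germ.compWith, Germ.id] using p.mem⟩
  comp_id := by
    rintro x y ⟨p⟩
    refine _root_.Quotient.sound (Germ.rel_trans
      (Germ.comp_rel_compWith p (Germ.id y) (𝟙 _) p.μ (by simp [Germ.id]) ?_) ?_)
    · simpa using p.mem_μ
    · rw [Germ.rel_iff]
      exact ⟨_, 𝟙 _, 𝟙 _, by simp [Germ.compWith, Germ.id], by simp [Germ.compWith],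
        by simpa [Germ.compWith] using p.mem⟩
  assoc := by
    rintro w x y z ⟨p⟩ ⟨q⟩ ⟨r⟩
    obtain ⟨V, η, γ, e, h⟩ := Germ.exists_match p q
    have hm : ∃ (U : E) (κ : U ⟶ V) (δ : U ⟶ r.apex), κ ≫ γ ≫ q.μ = δ ≫ r.ν ∧
        y.path ∈ cylinder F (κ ≫ γ ≫ q.μ) := Germ.exists_match (p.compWith q η γ e h) r
    obtain ⟨U, κ, δ, e1, h1⟩ := hm
    have h2 : x.path ∈ cylinder F (κ ≫ η ≫ p.μ) := by
      rw [e, ← Category.assoc, ← Germ.mem_iff, Category.assoc]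
      exact h1
    have h3 : y.path ∈ cylinder F ((κ ≫ γ) ≫ q.μ) := by simpa using h1
    have e3 : (κ ≫ γ) ≫ q.μ = δ ≫ r.ν := by simpa using e1
    refine _root_.Quotient.sound (Germ.rel_trans (Germ.comp_rel
      (Germ.comp_rel_compWith p q η γ e h) r.rel_refl) ?_)
    refine Germ.rel_trans (Germ.comp_rel_compWith _ r κ δ e1 h1) (Germ.rel_symm ?_)
    refine Germ.rel_trans (Germ.comp_rel p.rel_refl
      (Germ.comp_rel_compWith q r (κ ≫ γ) δ e3 h3)) ?_
    have e4 : (κ ≫ η) ≫ p.μ = 𝟙 U ≫ (κ ≫ γ) ≫ q.ν := by simp [e]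
    refine Germ.rel_trans (Germ.comp_rel_compWith p _ (κ ≫ η) (𝟙 U) e4 (by simpa using h2)) ?_
    · rw [Germ.rel_iff]
      refine ⟨U, 𝟙 U, 𝟙 U, by simp [Germ.compWith], by simp [Germ.compWith], ?_⟩
      have : w.path ∈ cylinder F ((κ ≫ η) ≫ p.ν) := by
        rw [← Germ.mem_iff]
        simpa using h2
      simpa [Germ.compWith] using this
  inv_comp := by
    rintro x y ⟨p⟩
    refine _root_.Quotient.sound (Germ.rel_trans
      (Germ.comp_rel_compWith p.inv p (𝟙 _) (𝟙 _) rfl (by simpa [Germ.inv] using p.mem)) ?_)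
    rw [Germ.rel_iff]
    have e1 : 𝟙 p.apex ≫ 𝟙 p.apex ≫ p.μ = p.μ ≫ 𝟙 y.r := by simp
    have h1 : y.path ∈ cylinder F (𝟙 p.apex ≫ 𝟙 p.apex ≫ p.μ) := by simpa using p.mem_μ
    exact ⟨p.apex, 𝟙 p.apex, p.μ, e1, e1, h1⟩
  comp_inv := by
    rintro x y ⟨p⟩
    refine _root_.Quotient.sound (Germ.rel_trans
      (Germ.comp_rel_compWith p p.inv (𝟙 _) (𝟙 _) rfl (by simpa using p.mem_μ)) ?_)
    rw [Germ.rel_iff]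
    have e1 : 𝟙 p.apex ≫ 𝟙 p.apex ≫ p.ν = p.ν ≫ 𝟙 x.r := by simp
    have h1 : x.path ∈ cylinder F (𝟙 p.apex ≫ 𝟙 p.apex ≫ p.ν) := by simpa using p.mem
    exact ⟨p.apex, 𝟙 p.apex, p.ν, e1, e1, h1⟩

/-- The arrow `[μ, ν, x]`. -/
noncomputable def germArrow {W X Y : E} (μ : W ⟶ Y) (ν : W ⟶ X) (x : cylinder F ν) : Arrow (PathSpace F) :=
  Arrow.mk (X := (⟨X, x.1⟩ : PathSpace F)) (Y := ⟨Y, (ind μ (res ν x)).1⟩)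
    (_root_.Quotient.mk (germSetoid _ _) ⟨W, μ, ν, x.2, rfl⟩)

/-- The set `Z(μ, ν)` of the arrows `[μ, ν, x]` with `x ∈ Z(ν)`. -/
def bisection (F : E ⥤ B) [IsKPFibration F] {W X Y : E} (μ : W ⟶ Y) (ν : W ⟶ X) :
    Set (Arrow (PathSpace F)) :=
  Set.range (germArrow μ ν)

/-- The topology on the set of the arrows of `G_F` that has the sets `Z(μ, ν)` as a basis. -/
noncomputable instance arrowTopology : TopologicalSpace (Arrow (PathSpace F)) :=
  TopologicalSpace.generateFrom
    {U | ∃ (W X Y : E) (μ : W ⟶ Y) (ν : W ⟶ X), U = bisection F μ ν}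

end Groupoid
end Fibrations

section BoundedFamilies

variable {I : Type*} (H : I → Type*) [∀ i, NormedAddCommGroup (H i)]
  [∀ i, InnerProductSpace ℂ (H i)] [∀ i, CompleteSpace (H i)]

/-- The C*-algebra of the bounded families `(a_i)` of operators `a_i` on the Hilbert spaces `H i`,
with the supremum norm. -/
def BoundedFamily : Type _ := lp (fun i => H i →L[ℂ] H i) ⊤

noncomputable instance : NonUnitalCStarAlgebra (BoundedFamily H) :=
  inferInstanceAs (NonUnitalCStarAlgebra (lp (fun i => H i →L[ℂ] H i) ⊤))

/-- The component `a_i` of a bounded family. -/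
def BoundedFamily.at {H : I → Type*} [∀ i, NormedAddCommGroup (H i)]
    [∀ i, InnerProductSpace ℂ (H i)] [∀ i, CompleteSpace (H i)]
    (a : BoundedFamily H) (i : I) : H i →L[ℂ] H i :=
  (show lp (fun i => H i →L[ℂ] H i) ⊤ from a) i

variable {H} in
/-- The closed `*`-subalgebra generated by a set of bounded families. -/
noncomputable def generated (s : Set (BoundedFamily H)) :
    NonUnitalStarSubalgebra ℂ (BoundedFamily H) :=
  (NonUnitalStarAlgebra.adjoin ℂ s).topologicalClosure

noncomputable instance (s : Set (BoundedFamily H)) : NonUnitalCStarAlgebra (generated s) :=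
  letI : IsClosed (generated s : Set (BoundedFamily H)) :=
    NonUnitalStarSubalgebra.isClosed_topologicalClosure _
  NonUnitalStarSubalgebra.nonUnitalCStarAlgebra _

theorem mem_generated {s : Set (BoundedFamily H)} {a : BoundedFamily H} (h : a ∈ s) :
    a ∈ generated s :=
  NonUnitalStarSubalgebra.le_topologicalClosure _ (NonUnitalStarAlgebra.subset_adjoin ℂ _ h)

end BoundedFamilies

section CuntzKrieger

variable {E : Type u₁} [Category.{v₁} E] {B : Type u₂} [Category.{v₂} B]

/-- A Cuntz-Krieger system associated to a row-finite functor `F`, in a C*-algebra `D`. -/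
structure CKSystem (F : E ⥤ B) [IsRowFinite F] (D : Type*) [NonUnitalCStarAlgebra D] where
  P : E → D
  S : ∀ ⦃Y X : E⦄, (Y ⟶ X) → D
  isStarProjection : ∀ X, IsStarProjection (P X)
  partialIsometry : ∀ ⦃Y X : E⦄ (α : Y ⟶ X), S α * star (S α) * S α = S α
  orthogonal : ∀ X Y : E, X ≠ Y → P X * P Y = 0
  comp : ∀ ⦃Z Y X : E⦄ (β : Z ⟶ Y) (α : Y ⟶ X), S (β ≫ α) = S α * S β
  id : ∀ X : E, P X = S (𝟙 X) ∧ P X = star (S (𝟙 X))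
  source : ∀ ⦃Y X : E⦄ (α : Y ⟶ X), star (S α) * S α = P Y
  disjoint : ∀ ⦃Y X Y' X' : E⦄ (α : Y ⟶ X) (β : Y' ⟶ X'),
    F.mapArrow.obj (Arrow.mk α) = F.mapArrow.obj (Arrow.mk β) → Arrow.mk α ≠ Arrow.mk β →
      star (S β) * S α = 0
  sum : ∀ (X : E) (b : Over (F.obj X)),
    ∑ α ∈ (IsRowFinite.finite X b).toFinset, S α.hom * star (S α.hom) = P X

variable (F : E ⥤ B) [IsRowFinite F]

/-- A Cuntz-Krieger system of operators on a Hilbert space. The universe of the Hilbert spaces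
is large enough for all cyclic representations of the relations. -/
structure CKRepresentation where
  H : Type (max u₁ v₁ u₂ v₂)
  [normed : NormedAddCommGroup H]
  [innerProduct : InnerProductSpace ℂ H]
  [complete : CompleteSpace H]
  system : CKSystem F (H →L[ℂ] H)

attribute [instance] CKRepresentation.normed CKRepresentation.innerProduct CKRepresentation.complete

variable {F}

theorem CKSystem.norm_P_le {D : Type*} [NonUnitalCStarAlgebra D] (c : CKSystem F D) (X : E) :
    ‖c.P X‖ ≤ 1 := by
  have h := CStarRing.norm_star_mul_self (x := c.P X)
  rw [(c.isStarProjection X).isSelfAdjoint.star_eq, (c.isStarProjection X).isIdempotentElem.eq] at h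
  nlinarith [norm_nonneg (c.P X)]

theorem CKSystem.norm_S_le {D : Type*} [NonUnitalCStarAlgebra D] (c : CKSystem F D) {Y X : E}
    (α : Y ⟶ X) : ‖c.S α‖ ≤ 1 := by
  have h := CStarRing.norm_star_mul_self (x := c.S α)
  rw [c.source] at h
  nlinarith [norm_nonneg (c.S α), c.norm_P_le Y]

/-- The family `(P_X)` over all Cuntz-Krieger representations. -/
def univP (F : E ⥤ B) [IsRowFinite F] (X : E) : BoundedFamily (CKRepresentation.H (F := F)) :=
  ⟨fun i => i.system.P X, memℓp_infty ⟨1, by rintro _ ⟨i, rfl⟩; exact i.system.norm_P_le X⟩⟩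

/-- The family `(S_α)` over all Cuntz-Krieger representations. -/
def univS (F : E ⥤ B) [IsRowFinite F] {Y X : E} (α : Y ⟶ X) :
    BoundedFamily (CKRepresentation.H (F := F)) :=
  ⟨fun i => i.system.S α, memℓp_infty ⟨1, by rintro _ ⟨i, rfl⟩; exact i.system.norm_S_le α⟩⟩

/-- The universal C*-algebra `C*(F)`: the completion of the `*`-algebra generated by symbols `p_X`,
`s_α` in the norm `‖a‖ = sup ‖ρ(a)‖` over all Cuntz-Krieger representations `ρ` on Hilbert spaces,
that is, the closure of its image in the product of all these representations. -/
abbrev CuntzKriegerAlgebra (F : E ⥤ B) [IsRowFinite F] : Type _ :=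
  generated ({a | ∃ X : E, a = univP F X} ∪ {a | ∃ (Y X : E) (α : Y ⟶ X), a = univS F α})

/-- The generator `p_X` of `C*(F)`. -/
noncomputable def genP (F : E ⥤ B) [IsRowFinite F] (X : E) : CuntzKriegerAlgebra F :=
  ⟨univP F X, mem_generated _ (Or.inl ⟨X, rfl⟩)⟩

/-- The generator `s_α` of `C*(F)`. -/
noncomputable def genS (F : E ⥤ B) [IsRowFinite F] {Y X : E} (α : Y ⟶ X) :
    CuntzKriegerAlgebra F :=
  ⟨univS F α, mem_generated _ (Or.inr ⟨Y, X, α, rfl⟩)⟩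

end CuntzKrieger

section GroupoidAlgebra

open Filter

variable (U : Type u) [Groupoid.{v} U] [TopologicalSpace (Arrow U)]

variable {U} in
/-- The convolution `(f * g)(γ) = ∑ f(η) g(η⁻¹γ)` over the arrows `η` with the same range as `γ`
(in diagrammatic order, `η⁻¹γ` is `γ ≫ η⁻¹`). For an étale groupoid and `f` with compact support,
only finitely many terms are not zero. -/
noncomputable def convolution (f g : Arrow U → ℂ) (γ : Arrow U) : ℂ :=
  ∑ᶠ η : Over γ.right, f (Arrow.mk η.hom) * g (Arrow.mk (γ.hom ≫ Groupoid.inv η.hom))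

variable {U} in
/-- The involution `f*(γ) = conj (f(γ⁻¹))`. -/
noncomputable def involution (f : Arrow U → ℂ) (γ : Arrow U) : ℂ :=
  star (f (Arrow.mk (Groupoid.inv γ.hom)))

/-- A representation of the convolution `*`-algebra `C_c(G)` of an étale groupoid `G` on a Hilbert
space, which maps sequences that converge in the inductive limit topology to weak-`*` convergent
sequences (for sequences of operators this is convergence of all matrix coefficients, as these
sequences are bounded). -/
structure ConvRepresentation where
  H : Type (max u v)
  [normed : NormedAddCommGroup H]
  [innerProduct : InnerProductSpace ℂ H]
  [complete : CompleteSpace H]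
  π : C_c(Arrow U, ℂ) →ₗ[ℂ] (H →L[ℂ] H)
  map_convolution : ∀ f g h : C_c(Arrow U, ℂ), ⇑h = convolution ⇑f ⇑g → π h = π f * π g
  map_involution : ∀ f h : C_c(Arrow U, ℂ), ⇑h = involution ⇑f → π h = star (π f)
  tendsto : ∀ (f : ℕ → C_c(Arrow U, ℂ)) (g : C_c(Arrow U, ℂ)),
    (∃ K : Set (Arrow U), IsCompact K ∧ ∀ᶠ n in atTop, tsupport ⇑(f n) ⊆ K) →
    TendstoUniformly (fun n => ⇑(f n)) ⇑g atTop →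
    ∀ ξ ζ : H, Tendsto (fun n => inner ℂ ζ (π (f n) ξ)) atTop (nhds (inner ℂ ζ (π g ξ)))

attribute [instance] ConvRepresentation.normed ConvRepresentation.innerProduct ConvRepresentation.complete

/-- The full C*-algebra `C*(G)` of an étale groupoid `G`: the completion of `C_c(G)` in the norm
`‖f‖ = sup ‖π(f)‖` over all representations `π`, that is, the closure of the set of the families
`(π(f))`, `f ∈ C_c(G)`, in the product of all representations. (These families are bounded, and
they form a `*`-algebra, as `C_c(G)` is closed under convolution and involution.) -/
abbrev GroupoidCStarAlgebra : Type _ :=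
  generated {a : BoundedFamily (ConvRepresentation.H (U := U)) |
    ∃ f : C_c(Arrow U, ℂ), ∀ i : ConvRepresentation U, a.at i = i.π f}

variable {U} in
/-- `a` is the image of `f ∈ C_c(G)` in `C*(G)`. -/
def IsImageOf (a : GroupoidCStarAlgebra U) (f : C_c(Arrow U, ℂ)) : Prop :=
  ∀ i : ConvRepresentation U, a.1.at i = i.π f

end GroupoidAlgebra

end KPFib

/-! For a Cuntz–Krieger system put V(μ,ν) = S_μ S_ν^* and compare these elements with the indicator
functions of the sets Z(μ,ν). Both families obey the same rules. Each is additive under refinement: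
the term at (μ,ν) is the sum of the terms at (μγ,νγ), with γ running over the lifts of one morphism
of the base. The adjoint exchanges μ and ν. The product of (μ,ν) and (ν,τ) is (μ,τ). A product
vanishes if the inner legs have different targets, or if they are different lifts of one base
morphism. By the Ore condition, refinement reduces every product to these cases. Conversely, a
family with these rules comes from the Cuntz–Krieger system S_α = W(α,s(α))
(`IsForkSystem.ckSystem`). So every representation of C_c(G_F) yields a Cuntz–Krieger
representation, and this gives the homomorphism C*(F) → C*(G_F).

For the inverse, the assignment 1_{Z(μ,ν)} ↦ S_μ S_ν^* has to be extended to C_c(G_F), continuously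
for the inductive limit topology. The decisive estimate is `CKSystem.norm_le_of_mem_graph`: if a
linear combination f of indicators is supported in a union of N sets Z(μ,ν), then the same
combination of the S_μ S_ν^* has norm at most N sup |f|. Indeed, as the morphisms of the base are
monic, finitely many forks have refinements whose pieces are equal or disjoint
(`exists_disjoint_pieces`), so that the coefficients become values of f. The pieces of a single
(μ,ν) add up to S_μ (∑ k_γ S_γ S_γ^*) S_ν^* with pairwise orthogonal projections in the middle, and
this has norm at most max |k_γ|.

The sets Z(μ,ν) are compact, open and closed, so functions in C_c(G_F) are uniform limits of step
functions with supports in a fixed finite union (`CKSystem.exists_mem_graph_norm_sub_le`). The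
estimate gives the extension `CKSystem.integrated`, its uniqueness, its multiplicativity and its
continuity. The two homomorphisms are mutually inverse: one composite is checked on generators; for
the other, a representation of C_c(G_F) is determined by its values on indicators, because it is
continuous (`evalCK_integrated`). -/

namespace KPFib

/-! ### Forks: pairs of morphisms with the same source -/

section Forks

variable {E : Type u₁} [Category.{v₁} E] {B : Type u₂} [Category.{v₂} B]

/-- A pair of morphisms of `E` with the same source and with targets `Y` and `X`. -/
structure Fork (Y X : E) where
  apex : E
  μ : apex ⟶ Y
  ν : apex ⟶ X

/-- The fork `(μγ, νγ)`. -/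
@[reducible]
def Fork.child {Y X : E} (t : Fork Y X) (γ : Over t.apex) : Fork Y X :=
  ⟨γ.left, γ.hom ≫ t.μ, γ.hom ≫ t.ν⟩

/-- The fork `(ν, μ)`. -/
@[reducible]
def Fork.swap {Y X : E} (t : Fork Y X) : Fork X Y := ⟨t.apex, t.ν, t.μ⟩

theorem Fork.child_child {Y X : E} (t : Fork Y X) (γ : Over t.apex) (δ : Over γ.left) :
    (t.child γ).child δ = t.child (Over.mk (δ.hom ≫ γ.hom)) := by
  simp [Fork.child]

/-- Monicity passes from the base to the total category: the images under F agree because F(ν) is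
monic, and a factorization is determined by its image. Everything that needs monic morphisms rests
on this cancellation. -/
theorem IsDiscreteConduche.cancel {F : E ⥤ B} (h : IsDiscreteConduche F)
    (hmono : ∀ ⦃a b : B⦄ (f : a ⟶ b), Mono f) {V W X : E} {γ γ' : V ⟶ W} {ν : W ⟶ X}
    (e : γ ≫ ν = γ' ≫ ν) : γ = γ' := by
  refine h.left_eq γ γ' ν e ?_
  have := hmono (F.map ν)
  rw [← cancel_mono (F.map ν), ← F.map_comp, ← F.map_comp, e]

/-- Iterating the Ore condition gives a common refinement of finitely many base morphisms with the
same target. -/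
theorem IsRightOre.exists_le (hO : IsRightOre B) {c : B} {ι : Type*} (o : ι → Over c)
    (s : Finset ι) : ∃ n : Over c, ∀ i ∈ s, Nonempty (n ⟶ o i) := by
  classical
  induction s using Finset.induction_on with
  | empty => exact ⟨Over.mk (𝟙 c), by simp⟩
  | insert i s _ ih =>
    obtain ⟨n, hn⟩ := ih
    obtain ⟨d, p, q, e⟩ := hO n.hom (o i).hom
    refine ⟨Over.mk (p ≫ n.hom), fun j hj => ?_⟩
    rcases Finset.mem_insert.1 hj with rfl | hj
    · exact ⟨Over.homMk q e.symm⟩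
    · exact ⟨Over.homMk p rfl ≫ (hn j hj).some⟩

theorem Over.mk_inj_left {c V W : E} {α : V ⟶ c} {β : W ⟶ c} (h : Over.mk α = Over.mk β) :
    ∃ e : V = W, α = eqToHom e ≫ β := by
  have e : V = W := congrArg (fun o : Over c => o.left) h
  subst e
  exact ⟨rfl, by simpa using over_hom_heq h⟩

theorem Over.mk_comp_congr {c d V W : E} {α : V ⟶ c} {β : W ⟶ c} (h : Over.mk α = Over.mk β)
    (f : c ⟶ d) : Over.mk (α ≫ f) = Over.mk (β ≫ f) := by
  obtain ⟨e, h⟩ := Over.mk_inj_left h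
  subst e
  simp [h]

theorem child_injective {F : E ⥤ B} (h : IsDiscreteConduche F)
    (hmono : ∀ ⦃a b : B⦄ (f : a ⟶ b), Mono f) {Y X : E} (t : Fork Y X) :
    Function.Injective t.child := by
  rintro ⟨V, ⟨⟨⟩⟩, γ⟩ ⟨V', ⟨⟨⟩⟩, γ'⟩ e
  have hV : V = V' := congrArg Fork.apex e
  subst hV
  simp only [Fork.child, Fork.mk.injEq, heq_eq_eq, true_and] at e
  have : γ = γ' := h.cancel hmono e.1
  subst this
  rfl

/-- Let n be the common ν-leg of the two pieces. A common refinement δ, δ' satisfies nδ = nδ', and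
cancellation gives δ = δ'. Then F(δ) equalizes the images of the two μ-legs. -/
theorem exists_equalizer {F : E ⥤ B} (h : IsDiscreteConduche F)
    (hmono : ∀ ⦃a b : B⦄ (f : a ⟶ b), Mono f) {V G G' W W' Y X : E} {A : B} {γ : G ⟶ W}
    {γ' : G' ⟶ W'} {μ : W ⟶ Y} {ν : W ⟶ X} {μ' : W' ⟶ Y} {ν' : W' ⟶ X}
    {a : A ⟶ F.obj W} {a' : A ⟶ F.obj W'} {δ : V ⟶ G} {δ' : V ⟶ G'}
    (hν : Over.mk (γ ≫ ν) = Over.mk (γ' ≫ ν')) (hγ : Over.mk (F.map γ) = Over.mk a)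
    (hγ' : Over.mk (F.map γ') = Over.mk a') (h1 : δ ≫ γ ≫ μ = δ' ≫ γ' ≫ μ')
    (h2 : δ ≫ γ ≫ ν = δ' ≫ γ' ≫ ν') :
    ∃ l : Over A, l.hom ≫ a ≫ F.map μ = l.hom ≫ a' ≫ F.map μ' := by
  obtain ⟨e, hν⟩ := Over.mk_inj_left hν
  subst e
  rw [eqToHom_refl, Category.id_comp] at hν
  rw [hν] at h2
  obtain rfl := h.cancel hmono h2
  obtain ⟨e, hγ⟩ := Over.mk_inj_left hγ
  obtain ⟨e', hγ'⟩ := Over.mk_inj_left hγ'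
  subst e
  refine ⟨Over.mk (F.map δ), ?_⟩
  have := congrArg F.map h1
  simpa [hγ, hγ'] using this

/-- The finite set of the morphisms with target `X` over a given morphism of `B`. -/
noncomputable def fib (F : E ⥤ B) [IsRowFinite F] {X : E} (b : Over (F.obj X)) : Finset (Over X) :=
  (IsRowFinite.finite X b).toFinset

theorem mem_fib {F : E ⥤ B} [IsRowFinite F] {X : E} {b : Over (F.obj X)} {α : Over X} :
    α ∈ fib F b ↔ Over.mk (F.map α.hom) = b := by
  simp only [fib, Set.Finite.mem_toFinset, Set.mem_ofPred_eq]
  rfl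

end Forks

/-! ### The sets Z(μ,ν) and their decomposition under refinement -/

section Bisections

variable {E : Type u₁} [Category.{v₁} E] {B : Type u₂} [Category.{v₂} B] {F : E ⥤ B}
  [hF : IsKPFibration F]

/-- The set `Z(μ, ν)`. -/
abbrev Fork.Z (F : E ⥤ B) [IsKPFibration F] {Y X : E} (t : Fork Y X) :
    Set (Arrow (PathSpace F)) := bisection F t.μ t.ν

/-- The target of `germArrow` is a computed path. Here it is replaced by any path equal to it, so
that two arrows can be compared inside one hom-set. -/
theorem mk_germ_eq {x : PathSpace F} {W Y : E} (μ : W ⟶ Y) (ν : W ⟶ x.r)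
    (h : x.path ∈ cylinder F ν) (y : InfinitePath F Y)
    (e : (ind μ (res ν ⟨x.path, h⟩)).1 = y) :
    germArrow μ ν ⟨x.path, h⟩ = Arrow.mk (X := x) (Y := (⟨Y, y⟩ : PathSpace F))
      (_root_.Quotient.mk (germSetoid x ⟨Y, y⟩) ⟨W, μ, ν, h, e⟩) := by
  subst e
  rfl

theorem mk_germ {x y : PathSpace F} (p : Germ x y) :
    (Arrow.mk (X := x) (Y := y) (_root_.Quotient.mk (germSetoid x y) p)) =
      germArrow p.μ p.ν ⟨x.path, p.mem⟩ :=
  (mk_germ_eq p.μ p.ν p.mem y.path p.ind_res_eq).symm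

theorem exists_germArrow (g : Arrow (PathSpace F)) :
    ∃ (Y X : E) (t : Fork Y X) (x : cylinder F t.ν), g = germArrow t.μ t.ν x := by
  obtain ⟨x, y, p⟩ := g
  induction p using Quotient.inductionOn with
  | h p => exact ⟨_, _, ⟨p.apex, p.μ, p.ν⟩, ⟨x.path, p.mem⟩, mk_germ p⟩

theorem mk_germ_eq_iff {x y : PathSpace F} (p q : Germ x y) :
    Arrow.mk (X := x) (Y := y) (_root_.Quotient.mk (germSetoid x y) p) =
      Arrow.mk (X := x) (Y := y) (_root_.Quotient.mk (germSetoid x y) q) ↔ p.Rel q := by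
  constructor
  · intro h
    have h' : (_root_.Quotient.mk (germSetoid x y) p) = _root_.Quotient.mk (germSetoid x y) q := by
      have := h
      injection this
    exact _root_.Quotient.exact h'
  · intro h
    have : (_root_.Quotient.mk (germSetoid x y) p) = _root_.Quotient.mk (germSetoid x y) q :=
      _root_.Quotient.sound h
    rw [this]

/-- Once the endpoints are identified, this is the description of the germ relation by a common
refinement along x (`Germ.rel_iff`). -/
theorem germArrow_eq_iff {Y X : E} (t t' : Fork Y X) (x : cylinder F t.ν) (x' : cylinder F t'.ν) :
    germArrow t.μ t.ν x = germArrow t'.μ t'.ν x' ↔ x.1 = x'.1 ∧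
      ∃ (V : E) (γ : V ⟶ t.apex) (γ' : V ⟶ t'.apex), γ ≫ t.μ = γ' ≫ t'.μ ∧
        γ ≫ t.ν = γ' ≫ t'.ν ∧ x.1 ∈ cylinder F (γ ≫ t.ν) := by
  obtain ⟨x, hx⟩ := x
  obtain ⟨x', hx'⟩ := x'
  constructor
  · intro h
    have hl : (⟨X, x⟩ : PathSpace F) = ⟨X, x'⟩ := congrArg (fun a : Arrow _ => a.left) h
    have hr : (⟨Y, (ind t.μ (res t.ν ⟨x, hx⟩)).1⟩ : PathSpace F) =
      ⟨Y, (ind t'.μ (res t'.ν ⟨x', hx'⟩)).1⟩ := congrArg (fun a : Arrow _ => a.right) h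
    have hl' : x = x' := by simpa using hl
    have hr' : (ind t.μ (res t.ν ⟨x, hx⟩)).1 = (ind t'.μ (res t'.ν ⟨x', hx'⟩)).1 := by
      simpa using hr
    subst hl'
    refine ⟨rfl, ?_⟩
    rw [mk_germ_eq (x := ⟨X, x⟩) t.μ t.ν hx _ hr', mk_germ_eq (x := ⟨X, x⟩) t'.μ t'.ν hx' _ rfl,
      mk_germ_eq_iff, Germ.rel_iff] at h
    exact h
  · rintro ⟨h, V, γ, γ', h1, h2, h3⟩
    dsimp only at h h3
    subst h
    have hr' : (ind t.μ (res t.ν ⟨x, hx⟩)).1 = (ind t'.μ (res t'.ν ⟨x, hx'⟩)).1 := by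
      have h3' : x ∈ cylinder F (γ' ≫ t'.ν) := h2 ▸ h3
      rw [ind_res_comp t.μ t.ν γ x hx h3, ind_res_comp t'.μ t'.ν γ' x hx' h3']
      have key : ∀ {m m' : V ⟶ Y} {n n' : V ⟶ X} (h : x ∈ cylinder F n)
          (h' : x ∈ cylinder F n'), m = m' → n = n' →
          (ind m (res n ⟨x, h⟩)).1 = (ind m' (res n' ⟨x, h'⟩)).1 := by
        rintro m _ n _ h h' rfl rfl
        rfl
      exact key h3 h3' h1 h2
    rw [mk_germ_eq (x := ⟨X, x⟩) t.μ t.ν hx _ hr', mk_germ_eq (x := ⟨X, x⟩) t'.μ t'.ν hx' _ rfl,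
      mk_germ_eq_iff, Germ.rel_iff]
    exact ⟨V, γ, γ', h1, h2, h3⟩

theorem germArrow_mem_iff {Y X : E} (t t' : Fork Y X) (x : cylinder F t.ν) :
    germArrow t.μ t.ν x ∈ t'.Z F ↔
      ∃ (V : E) (γ : V ⟶ t.apex) (γ' : V ⟶ t'.apex), γ ≫ t.μ = γ' ≫ t'.μ ∧
        γ ≫ t.ν = γ' ≫ t'.ν ∧ x.1 ∈ cylinder F (γ ≫ t.ν) := by
  constructor
  · rintro ⟨x', h⟩
    exact ((germArrow_eq_iff t t' x x').1 h.symm).2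
  · rintro ⟨V, γ, γ', h1, h2, h3⟩
    have h3' : x.1 ∈ cylinder F t'.ν :=
      InfinitePath.mem_of_comp hF.conduche (γ := γ') (h2 ▸ h3)
    exact ⟨⟨x.1, h3'⟩, ((germArrow_eq_iff t t' x ⟨x.1, h3'⟩).2 ⟨rfl, V, γ, γ', h1, h2, h3⟩).symm⟩

theorem left_r_of_mem {Y X : E} {t : Fork Y X} {g : Arrow (PathSpace F)} (h : g ∈ t.Z F) :
    g.left.r = X ∧ g.right.r = Y := by
  obtain ⟨x, rfl⟩ := h
  exact ⟨rfl, rfl⟩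

theorem germArrow_child {Y X : E} (t : Fork Y X) (γ : Over t.apex)
    (x : cylinder F (t.child γ).ν) (hx : x.1 ∈ cylinder F t.ν) :
    germArrow (t.child γ).μ (t.child γ).ν x = germArrow t.μ t.ν ⟨x.1, hx⟩ := by
  rw [germArrow_eq_iff]
  exact ⟨rfl, γ.left, 𝟙 _, γ.hom, Category.id_comp _, Category.id_comp _,
    (Category.id_comp (γ.hom ≫ t.ν)).symm ▸ x.2⟩

theorem germArrow_mem_child {Y X : E} (t : Fork Y X) (γ : Over t.apex) (x : cylinder F t.ν)
    (hx : x.1 ∈ cylinder F (γ.hom ≫ t.ν)) : germArrow t.μ t.ν x ∈ (t.child γ).Z F :=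
  ⟨⟨x.1, hx⟩, germArrow_child t γ ⟨x.1, hx⟩ x.2⟩

theorem child_Z_subset {Y X : E} (t : Fork Y X) (γ : Over t.apex) :
    (t.child γ).Z F ⊆ t.Z F := by
  rintro _ ⟨x, rfl⟩
  exact ⟨⟨x.1, InfinitePath.mem_of_comp hF.conduche x.2⟩, (germArrow_child t γ x _).symm⟩

theorem germArrow_mem_child_iff (t : Σ p : E × E, Fork p.1 p.2) (γ : Over t.2.apex)
    (x : cylinder F t.2.ν) :
    germArrow t.2.μ t.2.ν x ∈ (t.2.child γ).Z F ↔ x.1 ∈ cylinder F (γ.hom ≫ t.2.ν) := by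
  refine ⟨?_, germArrow_mem_child t.2 γ x⟩
  rintro ⟨x', h⟩
  rw [germArrow_child t.2 γ x' (InfinitePath.mem_of_comp hF.conduche x'.2), germArrow_eq_iff] at h
  rw [← h.1]
  exact x'.2

/-- Local splitting provides a path at the apex, and `ind` prolongs it by ν. Nonemptiness lets
coefficients be read off as values of functions. -/
theorem fork_Z_nonempty {Y X : E} (t : Fork Y X) : (t.Z F).Nonempty := by
  obtain ⟨z⟩ := hF.locallySplit t.apex
  exact ⟨_, ind t.ν z, rfl⟩

/-- Forks which are compatible with the same path and lie over the same fork of `B` are equal. -/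
theorem fork_eq {Y X : E} {t t' : Fork Y X} {g : Arrow (PathSpace F)} (h : g ∈ t.Z F)
    (h' : g ∈ t'.Z F) (hν : Over.mk (F.map t.ν) = Over.mk (F.map t'.ν))
    (hμ : Over.mk t.ν = Over.mk t'.ν → Over.mk (F.map t.μ) = Over.mk (F.map t'.μ)) : t = t' := by
  obtain ⟨x, rfl⟩ := h
  obtain ⟨x', h'⟩ := h'
  have hxx : (⟨X, x'.1⟩ : PathSpace F) = ⟨X, x.1⟩ := congrArg (fun a : Arrow _ => a.left) h'
  have hyy : (⟨Y, (ind t'.μ (res t'.ν x')).1⟩ : PathSpace F) =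
    ⟨Y, (ind t.μ (res t.ν x)).1⟩ := congrArg (fun a : Arrow _ => a.right) h'
  have hxx' : x'.1 = x.1 := by simpa using hxx
  have hyy' : (ind t'.μ (res t'.ν x')).1 = (ind t.μ (res t.ν x)).1 := by simpa using hyy
  -- The source path runs through both ν-legs and the range path through both μ-legs; a path has
  -- only one lift of each base morphism.
  have e := InfinitePath.mem_unique x.2 (hxx' ▸ x'.2) hν
  have e' := InfinitePath.mem_unique (ind t.μ (res t.ν x)).2
    (hyy' ▸ (ind t'.μ (res t'.ν x')).2) (hμ e)
  obtain ⟨W, μ, ν⟩ := t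
  obtain ⟨W', μ', ν'⟩ := t'
  obtain ⟨e1, h1⟩ := Over.mk_inj_left e
  obtain ⟨e2, h2⟩ := Over.mk_inj_left e'
  clear e e' hxx hyy hxx' hyy' hν hμ h' x x'
  dsimp only at e1 e2 h1 h2
  subst e1
  simp at h1 h2
  simp [h1, h2]

/-- Distinct lifts of one base morphism give disjoint pieces, because the path left after removing ν
passes through only one of them. -/
theorem child_eq_of_mem {Y X : E} (t : Fork Y X) {γ γ' : Over t.apex}
    (e : Over.mk (F.map γ.hom) = Over.mk (F.map γ'.hom)) {g : Arrow (PathSpace F)}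
    (h : g ∈ (t.child γ).Z F) (h' : g ∈ (t.child γ').Z F) : γ = γ' := by
  obtain ⟨x, rfl⟩ := child_Z_subset t γ h
  have h1 := (germArrow_mem_child_iff ⟨(Y, X), t⟩ γ x).1 h
  have h2 := (germArrow_mem_child_iff ⟨(Y, X), t⟩ γ' x).1 h'
  exact InfinitePath.mem_unique (x := res t.ν x) ((mem_res _ _ _).2 h1) ((mem_res _ _ _).2 h2) e

variable [hfin : IsRowFinite F]

/-- The remaining path passes through some lift of b. With `child_eq_of_mem`, Z(μ,ν) is the disjoint
union of its finitely many pieces over b. -/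
theorem exists_mem_child {Y X : E} (t : Fork Y X) (b : Over (F.obj t.apex))
    {g : Arrow (PathSpace F)} (h : g ∈ t.Z F) : ∃ γ ∈ fib F b, g ∈ (t.child γ).Z F := by
  obtain ⟨x, rfl⟩ := h
  obtain ⟨V, γ, hV, hx, -⟩ := (res t.ν x).exists_mem b
  exact ⟨Over.mk γ, mem_fib.2 hV.symm, germArrow_mem_child t _ x ((mem_res _ _ _).1 hx)⟩

/-- Finitely many forks have refinements such that any two pieces are equal or disjoint. -/
theorem exists_level (hmono : ∀ ⦃a b : B⦄ (f : a ⟶ b), Mono f) {Y X : E} {ι : Type*} [Finite ι]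
    (t : ι → Fork Y X) :
    ∃ lev : ∀ i, Over (F.obj (t i).apex), ∀ i j, ∀ γ ∈ fib F (lev i), ∀ γ' ∈ fib F (lev j),
      (t i).child γ = (t j).child γ' ∨ Disjoint (((t i).child γ).Z F) (((t j).child γ').Z F) := by
  classical
  cases nonempty_fintype ι
  -- Over n all ν-legs acquire the same image in the base; m i is then the image of the i-th μ-leg.
  obtain ⟨n, hn⟩ := hF.stronglyRightOre.1.exists_le (fun i => Over.mk (F.map (t i).ν)) Finset.univ
  have hc : ∀ i, ∃ c : n.left ⟶ F.obj (t i).apex, c ≫ F.map (t i).ν = n.hom := fun i =>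
    ⟨(hn i (Finset.mem_univ i)).some.left, Over.w (hn i (Finset.mem_univ i)).some⟩
  choose c hc using hc
  let m : ∀ i, n.left ⟶ F.obj Y := fun i => c i ≫ F.map (t i).μ
  -- For each pair, κ equalizes m i and m j whenever some morphism does; otherwise its value is
  -- irrelevant and the identity is taken. Refining to a k below all κ settles all pairs at once.
  have hκ : ∀ q : ι × ι, ∃ κ : Over n.left, (∃ l : Over n.left, l.hom ≫ m q.1 = l.hom ≫ m q.2) →
      κ.hom ≫ m q.1 = κ.hom ≫ m q.2 := fun q => by
    by_cases h : ∃ l : Over n.left, l.hom ≫ m q.1 = l.hom ≫ m q.2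
    · exact ⟨h.choose, fun _ => h.choose_spec⟩
    · exact ⟨Over.mk (𝟙 _), fun h' => (h h').elim⟩
  choose κ hκ using hκ
  obtain ⟨k, hk⟩ := hF.stronglyRightOre.1.exists_le κ Finset.univ
  refine ⟨fun i => Over.mk (k.hom ≫ c i), fun i j γ hγ γ' hγ' => ?_⟩
  rw [mem_fib] at hγ hγ'
  dsimp only at hγ hγ'
  rw [or_iff_not_imp_right, Set.not_disjoint_iff]
  rintro ⟨g, h, h'⟩
  have lv : ∀ i, ∀ γ : Over (t i).apex, Over.mk (F.map γ.hom) = Over.mk (k.hom ≫ c i) →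
      Over.mk (F.map ((t i).child γ).ν) = Over.mk (k.hom ≫ n.hom) := by
    intro i γ hγ
    rw [← hc i, F.map_comp, Over.mk_comp_congr hγ, Category.assoc]
  refine fork_eq h h' ((lv i γ hγ).trans (lv j γ' hγ').symm) fun hν => ?_
  -- If two pieces meet, then m i and m j can be equalized by `exists_equalizer`, so k equalizes
  -- them already. The pieces therefore lie over the same fork of the base and are equal by
  -- `fork_eq`.
  have key : k.hom ≫ m i = k.hom ≫ m j := by
    obtain ⟨x, rfl⟩ := h
    obtain ⟨V, δ, δ', h1, h2, -⟩ := (germArrow_mem_iff _ _ x).1 h'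
    obtain ⟨l, hl⟩ := exists_equalizer hF.conduche hmono hν hγ hγ' h1 h2
    have h4 := hκ (i, j) ⟨Over.mk (l.hom ≫ k.hom), by simpa [m] using hl⟩
    have hw := Over.w (hk (i, j) (Finset.mem_univ _)).some
    rw [← hw, Category.assoc, Category.assoc, h4]
  rw [F.map_comp, F.map_comp, Over.mk_comp_congr hγ,
    Over.mk_comp_congr hγ', Category.assoc, Category.assoc]
  exact congrArg Over.mk key

end Bisections


/-! ### Finite sets of forks and sums over their refinements -/

section Refinements

variable {E : Type u₁} [Category.{v₁} E] {B : Type u₂} [Category.{v₂} B]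

/-- A fork with arbitrary targets. -/
abbrev AnyFork (E : Type u₁) [Category.{v₁} E] := Σ p : E × E, Fork p.1 p.2

/-- The fork `(μγ, νγ)`. -/
@[reducible]
def AnyFork.child (t : AnyFork E) (γ : Over t.2.apex) : AnyFork E := ⟨t.1, t.2.child γ⟩

/-- The fork `(ν, μ)`. -/
@[reducible]
def AnyFork.swap (t : AnyFork E) : AnyFork E := ⟨t.1.swap, t.2.swap⟩

/-- The set `Z(μ, ν)`. -/
abbrev AnyFork.Z (F : E ⥤ B) [IsKPFibration F] (t : AnyFork E) : Set (Arrow (PathSpace F)) :=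
  t.2.Z F

/-- The union of finitely many sets `Z(μ, ν)`. -/
def cover (F : E ⥤ B) [IsKPFibration F] (D : Finset (AnyFork E)) : Set (Arrow (PathSpace F)) :=
  ⋃ t ∈ D, t.Z F

theorem mem_cover {F : E ⥤ B} [IsKPFibration F] {D : Finset (AnyFork E)}
    {g : Arrow (PathSpace F)} : g ∈ cover F D ↔ ∃ t ∈ D, g ∈ t.Z F := by
  simp [cover]

theorem cover_mono {F : E ⥤ B} [IsKPFibration F] {D D' : Finset (AnyFork E)} (h : D ⊆ D') :
    cover F D ⊆ cover F D' := fun _ hg =>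
  let ⟨t, ht, hg⟩ := mem_cover.1 hg
  mem_cover.2 ⟨t, h ht, hg⟩

variable {F : E ⥤ B}

theorem AnyFork.child_injective (h : IsDiscreteConduche F)
    (hmono : ∀ ⦃a b : B⦄ (f : a ⟶ b), Mono f) (t : AnyFork E) :
    Function.Injective t.child := fun _ _ e =>
  KPFib.child_injective h hmono t.2 (eq_of_heq (Sigma.mk.inj e).2)

open Classical in
/-- The finite set of the forks `(μγ, νγ)` with `γ` over a given morphism of `B`. -/
noncomputable def children (F : E ⥤ B) [IsRowFinite F] (t : AnyFork E)
    (b : Over (F.obj t.2.apex)) : Finset (AnyFork E) := (fib F b).image t.child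

theorem mem_children [IsRowFinite F] {t d : AnyFork E} {b : Over (F.obj t.2.apex)} :
    d ∈ children F t b ↔ ∃ γ ∈ fib F b, t.child γ = d := by
  simp [children]

/-- Functions on forks which are additive under refinements. -/
def IsRefinable (F : E ⥤ B) [IsRowFinite F] {M : Type*} [AddCommMonoid M]
    (V : AnyFork E → M) : Prop :=
  ∀ (t : AnyFork E) (b : Over (F.obj t.2.apex)), V t = ∑ γ ∈ fib F b, V (t.child γ)

theorem IsRefinable.eq_sum_children [IsRowFinite F] (h : IsDiscreteConduche F)
    (hmono : ∀ ⦃a b : B⦄ (f : a ⟶ b), Mono f) {M : Type*} [AddCommMonoid M]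
    {V : AnyFork E → M} (hV : IsRefinable F V) (t : AnyFork E) (b : Over (F.obj t.2.apex)) :
    V t = ∑ d ∈ children F t b, V d := by
  classical
  rw [hV t b, children, Finset.sum_image fun _ _ _ _ e => t.child_injective h hmono e]

open Classical in
/-- The set of all pieces of the forks in a finite set. -/
noncomputable def pieces (F : E ⥤ B) [IsRowFinite F] (T : Finset (AnyFork E))
    (lev : ∀ t : AnyFork E, Over (F.obj t.2.apex)) : Finset (AnyFork E) :=
  T.biUnion fun t => children F t (lev t)

theorem mem_pieces [IsRowFinite F] {T : Finset (AnyFork E)} {d : AnyFork E}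
    {lev : ∀ t : AnyFork E, Over (F.obj t.2.apex)} :
    d ∈ pieces F T lev ↔ ∃ t ∈ T, d ∈ children F t (lev t) := by
  simp [pieces]

open Classical in
-- The coefficients on the right do not involve V. The same rewriting thus applies to indicator
-- functions and to the elements S_μ S_ν^* simultaneously.
theorem IsRefinable.sum_pieces [IsRowFinite F] (h : IsDiscreteConduche F)
    (hmono : ∀ ⦃a b : B⦄ (f : a ⟶ b), Mono f) {M : Type*} [AddCommMonoid M] [Module ℂ M]
    {V : AnyFork E → M} (hV : IsRefinable F V) (T : Finset (AnyFork E))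
    (lev : ∀ t : AnyFork E, Over (F.obj t.2.apex)) {S : Finset (AnyFork E)} (hS : S ⊆ T)
    (a : AnyFork E → ℂ) :
    ∑ t ∈ S, a t • V t = ∑ d ∈ pieces F T lev,
      (∑ t ∈ S, if d ∈ children F t (lev t) then a t else 0) • V d := by
  simp_rw [Finset.sum_smul]
  rw [Finset.sum_comm]
  refine Finset.sum_congr rfl fun t ht => ?_
  rw [hV.eq_sum_children h hmono t (lev t), Finset.smul_sum]
  simp_rw [ite_smul, zero_smul]
  rw [← Finset.sum_filter]
  congr 1
  ext d
  simp only [Finset.mem_filter]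
  exact ⟨fun hd => ⟨mem_pieces.2 ⟨t, hS ht, hd⟩, hd⟩, fun hd => hd.2⟩

variable [hF : IsKPFibration F] [hfin : IsRowFinite F]

theorem exists_mem_children {t : AnyFork E} (b : Over (F.obj t.2.apex))
    {g : Arrow (PathSpace F)} (h : g ∈ t.Z F) : ∃ d ∈ children F t b, g ∈ d.Z F := by
  obtain ⟨γ, hγ, hg⟩ := exists_mem_child t.2 b h
  exact ⟨t.child γ, mem_children.2 ⟨γ, hγ, rfl⟩, hg⟩

theorem Z_subset_of_mem_children {t d : AnyFork E} {b : Over (F.obj t.2.apex)}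
    (h : d ∈ children F t b) : d.Z F ⊆ t.Z F := by
  obtain ⟨γ, -, rfl⟩ := mem_children.1 h
  exact child_Z_subset t.2 γ

/-- Every finite set of forks has a refinement into pairwise disjoint pieces. -/
theorem exists_disjoint_pieces (hmono : ∀ ⦃a b : B⦄ (f : a ⟶ b), Mono f)
    (T : Finset (AnyFork E)) :
    ∃ lev : ∀ t : AnyFork E, Over (F.obj t.2.apex),
      (pieces F T lev : Set (AnyFork E)).PairwiseDisjoint fun d => d.Z F := by
  classical
  -- Forks with different pairs of targets have disjoint sets Z, so levels can be chosen for each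
  -- pair of targets separately.
  have hL : ∀ p : E × E, _ := fun p =>
    have : Finite {t : Fork p.1 p.2 // (⟨p, t⟩ : AnyFork E) ∈ T} :=
      Finite.of_injective (β := T) (fun t => ⟨⟨p, t.1⟩, t.2⟩) fun t t' e => by
        simpa [Subtype.ext_iff] using e
    exists_level (F := F) hmono
      (fun t : {t : Fork p.1 p.2 // (⟨p, t⟩ : AnyFork E) ∈ T} => t.1)
  choose L hL using hL
  let lev : ∀ t : AnyFork E, Over (F.obj t.2.apex) := fun t =>
    if h : t ∈ T then L t.1 ⟨t.2, h⟩ else Over.mk (𝟙 _)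
  refine ⟨lev, ?_⟩
  intro d hd d' hd' hne
  obtain ⟨⟨p, t⟩, ht, hd⟩ := mem_pieces.1 (Finset.mem_coe.1 hd)
  obtain ⟨⟨p', t'⟩, ht', hd'⟩ := mem_pieces.1 (Finset.mem_coe.1 hd')
  obtain ⟨γ, hγ, rfl⟩ := mem_children.1 hd
  obtain ⟨γ', hγ', rfl⟩ := mem_children.1 hd'
  by_cases hp : p = p'
  · subst hp
    simp only [lev, ht, ht', dif_pos] at hγ hγ'
    refine (hL p ⟨t, ht⟩ ⟨t', ht'⟩ γ hγ γ' hγ').resolve_left fun e => hne ?_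
    exact Sigma.ext rfl (heq_of_eq e)
  · refine Set.disjoint_left.2 fun g hg hg' => hp ?_
    have h1 := left_r_of_mem hg
    have h2 := left_r_of_mem hg'
    exact Prod.ext (h1.2.symm.trans h2.2) (h1.1.symm.trans h2.1)

end Refinements

/-! ### The sets Z(μ,ν) are compact, open and closed -/

section Topology

open Topology

variable {E : Type u₁} [Category.{v₁} E] {B : Type u₂} [Category.{v₂} B] {F : E ⥤ B}
  [hF : IsKPFibration F]

theorem isOpen_Z (t : AnyFork E) : IsOpen (t.Z F) :=
  TopologicalSpace.isOpen_generateFrom_of_mem ⟨_, _, _, t.2.μ, t.2.ν, rfl⟩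

theorem exists_child_subset_Z {t : AnyFork E} {x : cylinder F t.2.ν} {t' : AnyFork E}
    (h : germArrow t.2.μ t.2.ν x ∈ t'.Z F) :
    ∃ γ : Over t.2.apex, x.1 ∈ cylinder F (γ.hom ≫ t.2.ν) ∧ (t.child γ).Z F ⊆ t'.Z F := by
  obtain ⟨⟨Y, X⟩, t⟩ := t
  obtain ⟨⟨Y', X'⟩, t'⟩ := t'
  obtain ⟨rfl, rfl⟩ := left_r_of_mem h
  obtain ⟨V, γ, γ', h1, h2, h3⟩ := (germArrow_mem_iff t t' x).1 h
  refine ⟨Over.mk γ, h3, ?_⟩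
  have : t.child (Over.mk γ) = t'.child (Over.mk γ') := by
    simp only [Fork.child, Over.mk_hom, h1, h2]
    rfl
  change (t.child _).Z F ⊆ _
  rw [this]
  exact child_Z_subset t' _

/-- The pieces of a fork along x form a neighbourhood basis at the arrow [μ,ν,x]. For intersections,
the two refinements lie on the same path and have a common continuation on it by the Ore condition.
-/
theorem exists_child_subset {t : AnyFork E} {x : cylinder F t.2.ν} {O : Set (Arrow (PathSpace F))}
    (hO : IsOpen O) (h : germArrow t.2.μ t.2.ν x ∈ O) :
    ∃ γ : Over t.2.apex, x.1 ∈ cylinder F (γ.hom ≫ t.2.ν) ∧ (t.child γ).Z F ⊆ O := by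
  induction hO with
  | basic s hs =>
    obtain ⟨W, X, Y, μ, ν, rfl⟩ := hs
    exact exists_child_subset_Z (t' := ⟨(Y, X), ⟨W, μ, ν⟩⟩) h
  | univ => exact ⟨Over.mk (𝟙 _), by simp, Set.subset_univ _⟩
  | inter s s' _ _ ih ih' =>
    obtain ⟨γ, hγ, hs⟩ := ih h.1
    obtain ⟨γ', hγ', hs'⟩ := ih' h.2
    obtain ⟨V, δ, δ', e, hx⟩ := InfinitePath.common hF.stronglyRightOre.1 (x := res t.2.ν x)
      ((mem_res _ _ _).2 hγ) ((mem_res _ _ _).2 hγ')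
    refine ⟨Over.mk (δ ≫ γ.hom), (mem_res _ _ _).1 hx, Set.subset_inter ?_ ?_⟩
    · refine subset_trans ?_ hs
      have := child_Z_subset (F := F) (t.2.child γ) (Over.mk δ)
      rwa [Fork.child_child] at this
    · refine subset_trans ?_ hs'
      have := child_Z_subset (F := F) (t.2.child γ') (Over.mk δ')
      rw [Fork.child_child] at this
      rwa [e]
  | sUnion S _ ih =>
    obtain ⟨s, hs, h⟩ := h
    obtain ⟨γ, hγ, hsub⟩ := ih s hs h
    exact ⟨γ, hγ, hsub.trans (Set.subset_sUnion_of_mem hs)⟩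

theorem exists_cover {K : Set (Arrow (PathSpace F))} (hK : IsCompact K) :
    ∃ D : Finset (AnyFork E), K ⊆ cover F D := by
  refine hK.elim_finite_subcover (fun t : AnyFork E => t.Z F) isOpen_Z fun g _ => ?_
  obtain ⟨Y, X, t, x, rfl⟩ := exists_germArrow g
  exact Set.mem_iUnion.2 ⟨⟨(Y, X), t⟩, x, rfl⟩

variable [hfin : IsRowFinite F]

/-- For an ultrafilter containing Z(μ,ν), row-finiteness places exactly one piece over each base
morphism in the ultrafilter. These pieces are compatible and define a path z at the apex; the
ultrafilter converges to the arrow given by z. -/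
theorem isCompact_Z (t : AnyFork E) : IsCompact (t.Z F) := by
  rw [isCompact_iff_ultrafilter_le_nhds]
  intro f hf
  rw [Filter.le_principal_iff] at hf
  obtain ⟨z, hz⟩ := InfinitePath.exists_of_set hF.conduche {α | (t.child α).Z F ∈ f}
    (fun b => by
      have h : t.Z F ⊆ ⋃ α ∈ (fib F b : Set (Over t.2.apex)), (t.child α).Z F := fun g hg => by
        obtain ⟨γ, hγ, hg⟩ := exists_mem_child t.2 b hg
        exact Set.mem_biUnion (Finset.mem_coe.2 hγ) hg
      obtain ⟨α, hα, hαf⟩ := (Ultrafilter.finite_biUnion_mem_iff (Finset.finite_toSet _)).1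
        (Filter.mem_of_superset hf h)
      exact ⟨α, hαf, mem_fib.1 hα⟩)
    (fun α hα β hβ e => by
      obtain ⟨g, hg, hg'⟩ := f.nonempty_of_mem (Filter.inter_mem hα hβ)
      exact child_eq_of_mem t.2 e hg hg')
    (fun V W γ α h => by
      refine Filter.mem_of_superset h ?_
      have := child_Z_subset (F := F) (t.2.child (Over.mk α)) (Over.mk γ)
      rwa [Fork.child_child] at this)
  refine ⟨germArrow t.2.μ t.2.ν (ind t.2.ν z), ⟨_, rfl⟩, fun O hO => ?_⟩
  obtain ⟨O', hO', hopen, hmem⟩ := mem_nhds_iff.1 hO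
  obtain ⟨γ, hγ, hsub⟩ := exists_child_subset hopen hmem
  refine Filter.mem_of_superset ?_ (hsub.trans hO')
  rw [mem_ind_comp, hz] at hγ
  exact hγ

/-- Refine the given fork together with a fork through g until pieces are equal or disjoint. If the
piece containing g met Z(t), it would be a piece of t, and g would lie in Z(t). -/
theorem isClosed_Z (hmono : ∀ ⦃a b : B⦄ (f : a ⟶ b), Mono f) (t : AnyFork E) :
    IsClosed (t.Z F) := by
  classical
  rw [← isOpen_compl_iff, isOpen_iff_forall_mem_open]
  intro g hg
  obtain ⟨Y, X, t', x, hgx⟩ := exists_germArrow g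
  obtain ⟨lev, hlev⟩ := exists_disjoint_pieces (F := F) hmono {t, ⟨(Y, X), t'⟩}
  obtain ⟨d, hd, hgd⟩ := exists_mem_children (t := ⟨(Y, X), t'⟩) (g := g) (lev _) ⟨x, hgx.symm⟩
  refine ⟨d.Z F, fun g' hg' ht => hg ?_, isOpen_Z d, hgd⟩
  obtain ⟨d', hd', hgd'⟩ := exists_mem_children (lev t) ht
  have : d = d' := hlev.elim (mem_pieces.2 ⟨_, by simp, hd⟩) (mem_pieces.2 ⟨t, by simp, hd'⟩)
    (Set.not_disjoint_iff.2 ⟨g', hg', hgd'⟩)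
  subst this
  exact Z_subset_of_mem_children hd' hgd

/-- On sufficiently fine pieces of `Z(μ, ν)` a continuous function is almost constant. -/
theorem exists_level_dist_le {f : Arrow (PathSpace F) → ℂ} (hf : Continuous f) (t : AnyFork E)
    {ε : ℝ} (hε : 0 < ε) : ∃ b : Over (F.obj t.2.apex), ∀ d ∈ children F t b,
      ∀ g ∈ d.Z F, ∀ g' ∈ d.Z F, dist (f g) (f g') ≤ ε := by
  classical
  have h1 : ∀ g : t.Z F, ∃ α : Over t.2.apex, g.1 ∈ (t.child α).Z F ∧
      ∀ g1 ∈ (t.child α).Z F, dist (f g1) (f g.1) < ε / 2 := by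
    rintro ⟨_, x, rfl⟩
    obtain ⟨γ, hγ, hs⟩ := exists_child_subset (t := t) (x := x)
      (Metric.isOpen_ball.preimage hf) (Metric.mem_ball_self (half_pos hε))
    exact ⟨γ, germArrow_mem_child t.2 γ x hγ, fun g1 hg1 => hs hg1⟩
  choose α hα hα' using h1
  obtain ⟨s, hs⟩ := (isCompact_Z (F := F) t).elim_finite_subcover
    (fun g : t.Z F => (t.child (α g)).Z F) (fun _ => isOpen_Z _)
    (fun g hg => Set.mem_iUnion.2 ⟨⟨g, hg⟩, hα ⟨g, hg⟩⟩)
  -- By compactness finitely many pieces α with oscillation controlled by ε/2 suffice; b is a base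
  -- morphism finer than all of them.
  obtain ⟨b, hb⟩ := hF.stronglyRightOre.1.exists_le
    (fun g : t.Z F => Over.mk (F.map (α g).hom)) s
  refine ⟨b, fun d hd => ?_⟩
  obtain ⟨γ, hγ, rfl⟩ := mem_children.1 hd
  obtain ⟨g0, hg0⟩ := fork_Z_nonempty (F := F) (t.child γ).2
  obtain ⟨g, hg, hgs⟩ := Set.mem_iUnion₂.1 (hs (child_Z_subset t.2 γ hg0))
  -- As b refines F(α g), γ factors through a lift β of F(α g). The pieces of β and α g share g0, so
  -- β = α g.
  have key : (t.child γ).Z F ⊆ (t.child (α g)).Z F := by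
    have e := mem_fib.1 hγ
    obtain ⟨q⟩ := hb g hg
    subst e
    obtain ⟨⟨Z, δ, β⟩, ⟨e1, e2, e3, e4⟩, -⟩ :=
      hF.conduche γ.hom _ q.left (F.map (α g).hom) (Over.w q).symm
    dsimp only at e1 e2 e3 e4
    have e5 : Over.mk (F.map β) = Over.mk (F.map (α g).hom) := by
      have : ∀ (b' : B) (r : b' ⟶ F.obj t.2.apex), F.obj Z = b' → F.map β ≍ r →
          Over.mk (F.map β) = Over.mk r := by
        rintro _ r rfl h
        rw [eq_of_heq h]
      exact this _ _ e2 e4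
    have hsub : (t.2.child γ).Z F ⊆ (t.2.child (Over.mk β)).Z F := by
      have := child_Z_subset (F := F) (t.2.child (Over.mk β)) (Over.mk δ)
      rw [Fork.child_child] at this
      have e6 : γ = Over.mk (δ ≫ β) := by rw [e1]; rfl
      rw [e6]
      exact this
    rw [← child_eq_of_mem t.2 (γ := Over.mk β) (γ' := α g) e5 (hsub hg0) hgs]
    exact hsub
  intro g1 hg1 g2 hg2
  have := dist_triangle_right (f g1) (f g2) (f g.1)
  linarith [hα' g g1 (key hg1), hα' g g2 (key hg2)]

end Topology


/-! ### Indicator functions of the sets Z(μ,ν) -/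

section Characteristic

variable {E : Type u₁} [Category.{v₁} E] {B : Type u₂} [Category.{v₂} B] {F : E ⥤ B}

/-- The indicator function of `Z(μ, ν)`. -/
noncomputable def charFn (F : E ⥤ B) [IsKPFibration F] (t : AnyFork E) :
    Arrow (PathSpace F) → ℂ := Set.indicator (t.Z F) 1

variable [hF : IsKPFibration F]

theorem charFn_of_mem {t : AnyFork E} {g : Arrow (PathSpace F)} (h : g ∈ t.Z F) :
    charFn F t g = 1 := Set.indicator_of_mem h _

theorem charFn_of_notMem {t : AnyFork E} {g : Arrow (PathSpace F)} (h : g ∉ t.Z F) :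
    charFn F t g = 0 := Set.indicator_of_notMem h _

theorem charFn_ne_zero_iff {t : AnyFork E} {g : Arrow (PathSpace F)} :
    charFn F t g ≠ 0 ↔ g ∈ t.Z F := by
  by_cases h : g ∈ t.Z F
  · simp [charFn_of_mem h, h]
  · simp [charFn_of_notMem h, h]

/-- At a point of Z(μ,ν) exactly one piece contributes, as the pieces over b partition the set. -/
theorem charFn_isRefinable [IsRowFinite F] : IsRefinable F (charFn F) := by
  intro t b
  funext g
  rw [Finset.sum_apply]
  by_cases h : g ∈ t.Z F
  · obtain ⟨γ, hγ, hg⟩ := exists_mem_child t.2 b h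
    rw [Finset.sum_eq_single γ, charFn_of_mem h, charFn_of_mem (t := t.child γ) hg]
    · intro γ' hγ' hne
      refine charFn_of_notMem (t := t.child γ') fun h' => hne ?_
      exact child_eq_of_mem t.2 ((mem_fib.1 hγ').trans (mem_fib.1 hγ).symm) h' hg
    · exact fun h => (h hγ).elim
  · rw [charFn_of_notMem h]
    refine (Finset.sum_eq_zero fun γ _ => ?_).symm
    exact charFn_of_notMem (t := t.child γ) fun h' => h (child_Z_subset t.2 γ h')

/-- The indicator function of `Z(μ, ν)` as a compactly supported continuous function. -/
noncomputable def charC [IsRowFinite F] (hmono : ∀ ⦃a b : B⦄ (f : a ⟶ b), Mono f)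
    (t : AnyFork E) : C_c(Arrow (PathSpace F), ℂ) where
  toFun := charFn F t
  continuous_toFun := (IsClopen.continuous_indicator ⟨isClosed_Z hmono t, isOpen_Z t⟩
    continuous_one)
  hasCompactSupport' := by
    refine (isCompact_Z (F := F) t).of_isClosed_subset (isClosed_tsupport _) ?_
    refine closure_minimal ?_ (isClosed_Z hmono t)
    exact fun g hg => charFn_ne_zero_iff.1 hg

end Characteristic

/-! ### Products, inverses and ranges of arrows in Z(μ,ν) -/

section Composition

variable {E : Type u₁} [Category.{v₁} E] {B : Type u₂} [Category.{v₂} B] {F : E ⥤ B}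
  [hF : IsKPFibration F]

theorem path_eq_of_mk_eq {F : E ⥤ B} {x : PathSpace F} {a : InfinitePath F x.r}
    (h : (⟨x.r, a⟩ : PathSpace F) = x) : a = x.path := by
  cases x
  simpa using h

theorem mk_mem_bisection {x y : PathSpace F} (f : x ⟶ y) {W : E} {μ : W ⟶ y.r} {ν : W ⟶ x.r}
    (h : Arrow.mk f ∈ bisection F μ ν) :
    ∃ (h : x.path ∈ cylinder F ν) (e : (ind μ (res ν ⟨x.path, h⟩)).1 = y.path),
      f = _root_.Quotient.mk (germSetoid x y) ⟨W, μ, ν, h, e⟩ := by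
  obtain ⟨⟨a, ha⟩, h⟩ := h
  have hl : (⟨x.r, a⟩ : PathSpace F) = x := congrArg (fun a : Arrow _ => a.left) h
  have hr : (⟨y.r, (ind μ (res ν ⟨a, ha⟩)).1⟩ : PathSpace F) = y :=
    congrArg (fun a : Arrow _ => a.right) h
  have hl' := path_eq_of_mk_eq hl
  have hr' := path_eq_of_mk_eq hr
  subst hl'
  refine ⟨ha, hr', ?_⟩
  rw [mk_germ_eq (x := x) μ ν ha y.path hr'] at h
  injection h with _ _ h
  exact h.symm

/-- The inner legs coincide, so the two germs can be composed without refining either of them. -/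
theorem comp_mem_bisection {x y z : PathSpace F} {f : x ⟶ y} {g : y ⟶ z} {W : E}
    {μ : W ⟶ z.r} {ν : W ⟶ y.r} {τ : W ⟶ x.r} (hf : Arrow.mk f ∈ bisection F ν τ)
    (hg : Arrow.mk g ∈ bisection F μ ν) : Arrow.mk (f ≫ g) ∈ bisection F μ τ := by
  obtain ⟨h1, e1, rfl⟩ := mk_mem_bisection f hf
  obtain ⟨h2, e2, rfl⟩ := mk_mem_bisection g hg
  let p : Germ x y := ⟨W, ν, τ, h1, e1⟩
  let q : Germ y z := ⟨W, μ, ν, h2, e2⟩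
  have hr := Germ.comp_rel_compWith p q (𝟙 W) (𝟙 W) rfl (by simpa using p.mem_μ)
  have e : (_root_.Quotient.mk (germSetoid x y) p ≫ _root_.Quotient.mk (germSetoid y z) q :
      x ⟶ z) = _root_.Quotient.mk (germSetoid x z) _ := _root_.Quotient.sound hr
  change Arrow.mk (_root_.Quotient.mk (germSetoid x y) p ≫
    _root_.Quotient.mk (germSetoid y z) q : x ⟶ z) ∈ _
  rw [e, mk_germ]
  have : (⟨W, 𝟙 W ≫ μ, 𝟙 W ≫ τ⟩ : Fork z.r x.r).Z F = bisection F μ τ := by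
    simp [Fork.Z]
  rw [← this]
  exact ⟨_, rfl⟩

theorem inv_mem_bisection {a : Arrow (PathSpace F)} {W Y X : E} {μ : W ⟶ Y} {ν : W ⟶ X}
    (h : a ∈ bisection F μ ν) : Arrow.mk (Groupoid.inv a.hom) ∈ bisection F ν μ := by
  obtain ⟨x, rfl⟩ := h
  let p : Germ (⟨X, x.1⟩ : PathSpace F) ⟨Y, (ind μ (res ν x)).1⟩ := ⟨W, μ, ν, x.2, rfl⟩
  exact ⟨_, (mk_germ p.inv).symm⟩

theorem inv_mem_bisection_iff {a : Arrow (PathSpace F)} {W Y X : E} {μ : W ⟶ Y} {ν : W ⟶ X} :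
    Arrow.mk (Groupoid.inv a.hom) ∈ bisection F ν μ ↔ a ∈ bisection F μ ν := by
  refine ⟨fun h => ?_, inv_mem_bisection⟩
  have := inv_mem_bisection h
  have e : Arrow.mk (Groupoid.inv (Arrow.mk (Groupoid.inv a.hom)).hom) = a := by
    simp only [Arrow.mk_hom, Groupoid.inv_eq_inv, IsIso.inv_inv]
    rfl
  rwa [e] at this

/-- The range determines the arrow within Z(μ,ν): removing μ from the range path and removing ν from
the source path leave the same path. -/
theorem over_eq_of_mem {y : PathSpace F} {η η' : Over y} {t : AnyFork E}
    (h : Arrow.mk η.hom ∈ t.Z F) (h' : Arrow.mk η'.hom ∈ t.Z F) : η = η' := by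
  have key : Arrow.mk η.hom = Arrow.mk η'.hom := by
    obtain ⟨x, hx⟩ := h
    obtain ⟨x', hx'⟩ := h'
    have hr : (⟨t.1.1, (ind t.2.μ (res t.2.ν x)).1⟩ : PathSpace F) =
        ⟨t.1.1, (ind t.2.μ (res t.2.ν x')).1⟩ :=
      (congrArg (fun a : Arrow _ => a.right) hx).trans
        (congrArg (fun a : Arrow _ => a.right) hx').symm
    have hr' : (ind t.2.μ (res t.2.ν x)) = (ind t.2.μ (res t.2.ν x')) :=
      Subtype.ext (by simpa using hr)
    have := congrArg (res t.2.μ) hr'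
    rw [res_ind, res_ind] at this
    rw [← hx, ← hx', (res_bijective t.2.ν).1 this]
  obtain ⟨l, ⟨⟨⟩⟩, f⟩ := η
  obtain ⟨l', ⟨⟨⟩⟩, f'⟩ := η'
  have hl : l = l' := congrArg (fun a : Arrow _ => a.left) key
  subst hl
  have hf : f = f' := by
    injection key
  rw [hf]

theorem left_path_mem {x y : PathSpace F} {f : x ⟶ y} {Y : E} {t : Fork Y x.r}
    (h : Arrow.mk f ∈ t.Z F) : x.path ∈ cylinder F t.ν := by
  obtain ⟨-, rfl⟩ := left_r_of_mem h
  exact (mk_mem_bisection f h).1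

theorem right_path_mem {x y : PathSpace F} {f : x ⟶ y} {X : E} {t : Fork y.r X}
    (h : Arrow.mk f ∈ t.Z F) : y.path ∈ cylinder F t.μ := by
  obtain ⟨rfl, -⟩ := left_r_of_mem h
  obtain ⟨h, e, -⟩ := mk_mem_bisection f h
  rw [← e]
  exact (ind _ _).2

theorem exists_over_mem {y : PathSpace F} {X : E} (t : Fork y.r X)
    (h : y.path ∈ cylinder F t.μ) : ∃ η : Over y, Arrow.mk η.hom ∈ t.Z F := by
  have e : (ind t.μ (res t.ν (ind t.ν (res t.μ ⟨y.path, h⟩)))).1 = y.path := by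
    rw [res_ind, ind_res]
  let x : PathSpace F := ⟨X, (ind t.ν (res t.μ ⟨y.path, h⟩)).1⟩
  let p : Germ x y := ⟨t.apex, t.μ, t.ν, (ind t.ν (res t.μ ⟨y.path, h⟩)).2, e⟩
  exact ⟨Over.mk (Y := x) (_root_.Quotient.mk (germSetoid x y) p : x ⟶ y), _, (mk_germ p).symm⟩

end Composition

/-! ### Convolution of functions supported in finite unions of sets Z(μ,ν) -/

section Convolution

variable {E : Type u₁} [Category.{v₁} E] {B : Type u₂} [Category.{v₂} B] {F : E ⥤ B}
  [hF : IsKPFibration F]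

/-- Each Z(μ,ν) contains at most one arrow with range y. The finite set depends only on the cover
and serves all functions supported there. -/
theorem exists_finset_over (D : Finset (AnyFork E)) (y : PathSpace F) :
    ∃ s : Finset (Over y), s.card ≤ D.card ∧
      ∀ η : Over y, Arrow.mk η.hom ∈ cover F D → η ∈ s := by
  classical
  induction D using Finset.induction_on with
  | empty => exact ⟨∅, by simp, fun η h => by simp [cover] at h⟩
  | insert t D ht ih =>
    obtain ⟨s, hs, h⟩ := ih
    by_cases hη : ∃ η : Over y, Arrow.mk η.hom ∈ t.Z F
    · obtain ⟨η, hη⟩ := hη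
      refine ⟨insert η s, (Finset.card_insert_le _ _).trans ?_, fun η' h' => ?_⟩
      · rw [Finset.card_insert_of_notMem ht]
        omega
      · obtain ⟨t', ht', h''⟩ := mem_cover.1 h'
        rcases Finset.mem_insert.1 ht' with rfl | ht'
        · rw [over_eq_of_mem h'' hη]
          exact Finset.mem_insert_self _ _
        · exact Finset.mem_insert_of_mem (h η' (mem_cover.2 ⟨t', ht', h''⟩))
    · refine ⟨s, hs.trans (Finset.card_le_card (Finset.subset_insert _ _)), fun η' h' => ?_⟩
      obtain ⟨t', ht', h''⟩ := mem_cover.1 h'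
      rcases Finset.mem_insert.1 ht' with rfl | ht'
      · exact (hη ⟨η', h''⟩).elim
      · exact h η' (mem_cover.2 ⟨t', ht', h''⟩)

theorem convolution_eq_sum {D : Finset (AnyFork E)} {f g : Arrow (PathSpace F) → ℂ}
    (hf : Function.support f ⊆ cover F D) {a : Arrow (PathSpace F)} {s : Finset (Over a.right)}
    (hs : ∀ η : Over a.right, Arrow.mk η.hom ∈ cover F D → η ∈ s) :
    convolution f g a = ∑ η ∈ s, f (Arrow.mk η.hom) * g (Arrow.mk (a.hom ≫ Groupoid.inv η.hom)) :=
  finsum_eq_sum_of_support_subset _ fun η hη => hs η (hf (left_ne_zero_of_mul hη))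

/-- At most |D| terms of the convolution are nonzero. This makes convolution continuous under
uniform convergence with supports in a fixed cover. -/
theorem norm_convolution_le {D : Finset (AnyFork E)} {f g : Arrow (PathSpace F) → ℂ}
    (hf : Function.support f ⊆ cover F D) {M N : ℝ} (hM : ∀ a, ‖f a‖ ≤ M) (hN : ∀ a, ‖g a‖ ≤ N)
    (a : Arrow (PathSpace F)) : ‖convolution f g a‖ ≤ D.card * (M * N) := by
  obtain ⟨s, hs, h⟩ := exists_finset_over (F := F) D a.right
  rw [convolution_eq_sum hf h]
  have hM0 : 0 ≤ M := (norm_nonneg _).trans (hM a)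
  have hN0 : 0 ≤ N := (norm_nonneg _).trans (hN a)
  refine (norm_sum_le_of_le s fun η _ => ?_).trans (b := ∑ _ ∈ s, M * N) ?_
  · rw [norm_mul]
    exact mul_le_mul (hM _) (hN _) (norm_nonneg _) hM0
  · rw [Finset.sum_const, nsmul_eq_mul]
    have : (s.card : ℝ) ≤ D.card := by exact_mod_cast hs
    exact mul_le_mul_of_nonneg_right this (mul_nonneg hM0 hN0)

/-- Functions with support in a finite union of sets `Z(μ, ν)`. -/
def IsCovered (f : Arrow (PathSpace F) → ℂ) : Prop :=
  ∃ D : Finset (AnyFork E), Function.support f ⊆ cover F D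

theorem IsCovered.add {f f' : Arrow (PathSpace F) → ℂ} (hf : IsCovered f) (hf' : IsCovered f') :
    IsCovered (f + f') := by
  classical
  obtain ⟨D, hD⟩ := hf
  obtain ⟨D', hD'⟩ := hf'
  refine ⟨D ∪ D', (Function.support_add f f').trans (Set.union_subset ?_ ?_)⟩
  · exact hD.trans (cover_mono Finset.subset_union_left)
  · exact hD'.trans (cover_mono Finset.subset_union_right)

theorem IsCovered.smul {f : Arrow (PathSpace F) → ℂ} (hf : IsCovered f) (c : ℂ) :
    IsCovered (c • f) := by
  obtain ⟨D, hD⟩ := hf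
  exact ⟨D, (Function.support_const_smul_subset c f).trans hD⟩

theorem IsCovered.zero : IsCovered (0 : Arrow (PathSpace F) → ℂ) := ⟨∅, by simp⟩

theorem support_charFn (t : AnyFork E) : Function.support (charFn F t) ⊆ cover F {t} :=
  fun _ hg => mem_cover.2 ⟨t, by simp, charFn_ne_zero_iff.1 hg⟩

theorem IsCovered.charFn (t : AnyFork E) : IsCovered (charFn F t) := ⟨{t}, support_charFn t⟩

theorem convolution_add_left {f f' g : Arrow (PathSpace F) → ℂ} (hf : IsCovered f)
    (hf' : IsCovered f') : convolution (f + f') g = convolution f g + convolution f' g := by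
  classical
  obtain ⟨D, hD⟩ := hf
  obtain ⟨D', hD'⟩ := hf'
  replace hD := hD.trans (cover_mono (F := F) (Finset.subset_union_left (s₂ := D')))
  replace hD' := hD'.trans (cover_mono (F := F) (Finset.subset_union_right (s₁ := D)))
  funext a
  obtain ⟨s, -, h⟩ := exists_finset_over (F := F) (D ∪ D') a.right
  rw [Pi.add_apply, convolution_eq_sum hD h, convolution_eq_sum hD' h,
    convolution_eq_sum (f := f + f')
      ((Function.support_add f f').trans (Set.union_subset hD hD')) h,
    ← Finset.sum_add_distrib]
  simp [add_mul]

theorem convolution_add_right {f g g' : Arrow (PathSpace F) → ℂ} (hf : IsCovered f) :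
    convolution f (g + g') = convolution f g + convolution f g' := by
  obtain ⟨D, hD⟩ := hf
  funext a
  obtain ⟨s, -, h⟩ := exists_finset_over (F := F) D a.right
  rw [Pi.add_apply, convolution_eq_sum hD h, convolution_eq_sum hD h, convolution_eq_sum hD h,
    ← Finset.sum_add_distrib]
  simp [mul_add]

theorem const_mul_finsum {ι : Sort*} (c : ℂ) (f : ι → ℂ) : ∑ᶠ i, c * f i = c * ∑ᶠ i, f i :=
  (smul_finsum c f).symm

theorem convolution_smul_left (c : ℂ) {f g : Arrow (PathSpace F) → ℂ} :
    convolution (c • f) g = c • convolution f g := by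
  funext a
  simp [convolution, mul_assoc, const_mul_finsum]

theorem convolution_smul_right (c : ℂ) {f g : Arrow (PathSpace F) → ℂ} :
    convolution f (c • g) = c • convolution f g := by
  funext a
  simp [convolution, mul_left_comm, const_mul_finsum]

theorem convolution_zero_left {g : Arrow (PathSpace F) → ℂ} : convolution 0 g = 0 := by
  funext a
  simp [convolution]

theorem convolution_zero_right {f : Arrow (PathSpace F) → ℂ} : convolution f 0 = 0 := by
  funext a
  simp [convolution]

theorem convolution_charFn_of_mem {t : AnyFork E} {a : Arrow (PathSpace F)} {η : Over a.right}
    (h : Arrow.mk η.hom ∈ t.Z F) (g : Arrow (PathSpace F) → ℂ) :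
    convolution (charFn F t) g a = g (Arrow.mk (a.hom ≫ Groupoid.inv η.hom)) := by
  rw [convolution_eq_sum (s := {η}) (support_charFn t), Finset.sum_singleton, charFn_of_mem h,
    one_mul]
  intro η' h'
  obtain ⟨t', ht', h''⟩ := mem_cover.1 h'
  rw [Finset.mem_singleton] at ht' ⊢
  subst ht'
  exact over_eq_of_mem h'' h

theorem exists_over_of_convolution_ne_zero {t : AnyFork E} {a : Arrow (PathSpace F)}
    {g : Arrow (PathSpace F) → ℂ} (h : convolution (charFn F t) g a ≠ 0) :
    ∃ η : Over a.right, Arrow.mk η.hom ∈ t.Z F ∧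
      g (Arrow.mk (a.hom ≫ Groupoid.inv η.hom)) ≠ 0 := by
  by_cases hη : ∃ η : Over a.right, Arrow.mk η.hom ∈ t.Z F
  · obtain ⟨η, hη⟩ := hη
    exact ⟨η, hη, by rwa [convolution_charFn_of_mem hη] at h⟩
  · refine (h (finsum_eq_zero_of_forall_eq_zero fun η => ?_)).elim
    rw [charFn_of_notMem fun h' => hη ⟨η, h'⟩, zero_mul]

/-- For an arrow in Z(μ,τ) there is a unique η in Z(μ,ν) with the same range, and the remaining
factor lies in Z(ν,τ). Conversely, such factors compose to an element of Z(μ,τ). -/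
theorem convolution_charFn {W Y X T : E} (μ : W ⟶ Y) (ν : W ⟶ X) (τ : W ⟶ T) :
    convolution (charFn F ⟨(Y, X), ⟨W, μ, ν⟩⟩) (charFn F ⟨(X, T), ⟨W, ν, τ⟩⟩) =
      charFn F ⟨(Y, T), ⟨W, μ, τ⟩⟩ := by
  funext ⟨x, y, f⟩
  change convolution _ _ (Arrow.mk f) = charFn F _ (Arrow.mk f)
  by_cases h : Arrow.mk f ∈ bisection F μ τ
  · obtain ⟨hx, hy⟩ := left_r_of_mem (t := ⟨W, μ, τ⟩) h
    dsimp at hx hy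
    subst hx hy
    obtain ⟨η, hη⟩ := exists_over_mem (⟨W, μ, ν⟩ : Fork y.r X) (right_path_mem (t := ⟨W, μ, τ⟩) h)
    obtain ⟨hX, -⟩ := left_r_of_mem hη
    dsimp at hX
    subst hX
    rw [convolution_charFn_of_mem (a := Arrow.mk f) (t := ⟨(_, _), ⟨W, μ, ν⟩⟩) hη,
      charFn_of_mem (t := ⟨(_, _), ⟨W, μ, τ⟩⟩) h]
    exact charFn_of_mem (t := ⟨(_, _), ⟨W, ν, τ⟩⟩)
      (comp_mem_bisection h (inv_mem_bisection hη))
  · rw [charFn_of_notMem (t := ⟨(Y, T), ⟨W, μ, τ⟩⟩) h]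
    by_contra hne
    obtain ⟨η, hη, h'⟩ := exists_over_of_convolution_ne_zero hne
    rw [charFn_ne_zero_iff] at h'
    obtain ⟨hx, hy⟩ := left_r_of_mem hη
    obtain ⟨hx', -⟩ := left_r_of_mem h'
    dsimp at hx hy hx'
    subst hx hy hx'
    refine h ?_
    have := comp_mem_bisection h' hη
    simpa using this

theorem convolution_charFn_eq_zero {t t' : AnyFork E} (h : t.1.2 ≠ t'.1.1) :
    convolution (charFn F t) (charFn F t') = 0 := by
  funext a
  by_contra hne
  obtain ⟨η, hη, h'⟩ := exists_over_of_convolution_ne_zero hne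
  rw [charFn_ne_zero_iff] at h'
  exact h ((left_r_of_mem hη).1.symm.trans (left_r_of_mem h').2)

/-- A nonzero value would yield a path through two different lifts of the same base morphism. -/
theorem convolution_charFn_eq_zero' {Y X T : E} {t : Fork Y X} {t' : Fork X T}
    (h : Over.mk (F.map t.ν) = Over.mk (F.map t'.μ)) (hne : Over.mk t.ν ≠ Over.mk t'.μ) :
    convolution (charFn F ⟨(Y, X), t⟩) (charFn F ⟨(X, T), t'⟩) = 0 := by
  funext a
  by_contra hne'
  obtain ⟨η, hη, h'⟩ := exists_over_of_convolution_ne_zero hne'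
  rw [charFn_ne_zero_iff] at h'
  obtain ⟨hx, -⟩ := left_r_of_mem hη
  dsimp at hx
  subst hx
  exact hne (InfinitePath.mem_unique (left_path_mem hη) (right_path_mem h') h)

theorem involution_charFn (t : AnyFork E) : involution (charFn F t) = charFn F t.swap := by
  funext a
  have h := inv_mem_bisection_iff (F := F) (a := a) (μ := t.2.ν) (ν := t.2.μ)
  by_cases ha : a ∈ t.swap.Z F
  · rw [charFn_of_mem ha, involution, charFn_of_mem (t := t) (h.2 ha), star_one]
  · rw [charFn_of_notMem ha, involution, charFn_of_notMem (t := t) fun h' => ha (h.1 h'), star_zero]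

/-- A nonzero term f(η)g(η⁻¹a) puts η in some Z(t) and η⁻¹a in some Z(t'); at a the convolution of
these two indicators is 1, so no cancellation can occur. -/
theorem support_convolution_subset {f g : Arrow (PathSpace F) → ℂ} {D D' : Finset (AnyFork E)}
    (hf : Function.support f ⊆ cover F D) (hg : Function.support g ⊆ cover F D') :
    Function.support (convolution f g) ⊆
      ⋃ t ∈ D, ⋃ t' ∈ D', Function.support (convolution (charFn F t) (charFn F t')) := by
  intro a ha
  obtain ⟨η, hη⟩ := not_forall.1 fun h : ∀ η : Over a.right, f (Arrow.mk η.hom) *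
    g (Arrow.mk (a.hom ≫ Groupoid.inv η.hom)) = 0 => ha (finsum_eq_zero_of_forall_eq_zero h)
  obtain ⟨t, ht, h⟩ := mem_cover.1 (hf (left_ne_zero_of_mul hη))
  obtain ⟨t', ht', h'⟩ := mem_cover.1 (hg (right_ne_zero_of_mul hη))
  refine Set.mem_biUnion ht (Set.mem_biUnion ht' ?_)
  rw [Function.mem_support, convolution_charFn_of_mem h, charFn_of_mem h']
  exact one_ne_zero

end Convolution


/-! ### Norms of combinations of orthogonal projections -/

section Norm

variable {A : Type*} [NonUnitalCStarAlgebra A]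

/-- Orthogonality makes k ↦ ∑ k_i Q_i a *-homomorphism from the C*-algebra ℂ^ι, and *-homomorphisms
of C*-algebras are contractive. -/
theorem norm_sum_smul_le {ι : Type*} [Fintype ι] {Q : ι → A} (hQ : ∀ i, IsStarProjection (Q i))
    (hQ' : ∀ i j, i ≠ j → Q i * Q j = 0) (k : ι → ℂ) {M : ℝ} (hM0 : 0 ≤ M)
    (hM : ∀ i, ‖k i‖ ≤ M) : ‖∑ i, k i • Q i‖ ≤ M := by
  classical
  let φ : (ι → ℂ) →⋆ₙₐ[ℂ] A :=
    { toFun := fun k => ∑ i, k i • Q i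
      map_smul' := fun c k => by simp [Finset.smul_sum, mul_smul]
      map_zero' := by simp
      map_add' := fun k l => by simp [add_smul, Finset.sum_add_distrib]
      map_mul' := fun k l => by
        rw [Finset.sum_mul_sum]
        refine Finset.sum_congr rfl fun i _ => ?_
        rw [Finset.sum_eq_single i]
        · rw [smul_mul_smul_comm, (hQ i).isIdempotentElem.eq, Pi.mul_apply]
        · intro j _ hj
          rw [smul_mul_smul_comm, hQ' i j hj.symm, smul_zero]
        · simp
      map_star' := fun k => by
        simp [star_sum, (hQ _).isSelfAdjoint.star_eq] }
  refine (NonUnitalStarAlgHom.norm_apply_le φ k).trans ?_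
  exact (pi_norm_le_iff_of_nonneg hM0).2 hM

end Norm

/-! ### Bilinear extension of product relations -/

section Spans

variable {E : Type u₁} [Category.{v₁} E] {B : Type u₂} [Category.{v₂} B] {F : E ⥤ B}
  [IsKPFibration F] {A : Type*} [NonUnitalCStarAlgebra A]

/-- Additivity of convolution in the first factor requires finitely many nonzero terms; this is why
coveredness is carried through the induction. -/
theorem convolution_mem_span
    {s s' : Set ((Arrow (PathSpace F) → ℂ) × A)} {G : Submodule ℂ ((Arrow (PathSpace F) → ℂ) × A)}
    (hs : ∀ p ∈ s, IsCovered p.1)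
    (h : ∀ p ∈ s, ∀ q ∈ s', (convolution p.1 q.1, p.2 * q.2) ∈ G)
    {p q : (Arrow (PathSpace F) → ℂ) × A} (hp : p ∈ Submodule.span ℂ s)
    (hq : q ∈ Submodule.span ℂ s') :
    IsCovered p.1 ∧ (convolution p.1 q.1, p.2 * q.2) ∈ G := by
  induction hp using Submodule.span_induction with
  | mem p hp =>
    refine ⟨hs p hp, ?_⟩
    induction hq using Submodule.span_induction with
    | mem q hq => exact h p hp q hq
    | zero =>
      have e : (convolution p.1 0, p.2 * 0) = 0 := Prod.ext convolution_zero_right (mul_zero p.2)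
      exact (congrArg (· ∈ G) e).mpr G.zero_mem
    | add q q' _ _ ih ih' =>
      convert G.add_mem ih ih' using 1
      simp [convolution_add_right (hs p hp), mul_add]
    | smul z q _ ih =>
      convert G.smul_mem z ih using 1
      simp [convolution_smul_right, mul_smul_comm]
  | zero =>
    refine ⟨IsCovered.zero, ?_⟩
    have e : (convolution 0 q.1, 0 * q.2) = 0 := Prod.ext convolution_zero_left (zero_mul q.2)
    exact (congrArg (· ∈ G) e).mpr G.zero_mem
  | add p p' _ _ ih ih' =>
    refine ⟨ih.1.add ih'.1, ?_⟩
    convert G.add_mem ih.2 ih'.2 using 1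
    simp [convolution_add_left ih.1 ih'.1, add_mul]
  | smul z p _ ih =>
    refine ⟨ih.1.smul z, ?_⟩
    convert G.smul_mem z ih.2 using 1
    simp [convolution_smul_left, smul_mul_assoc]

end Spans

/-! ### The elements S_μ S_ν^* and the norm estimate -/

section Systems

variable {E : Type u₁} [Category.{v₁} E] {B : Type u₂} [Category.{v₂} B] {F : E ⥤ B}
  [hfin : IsRowFinite F] {A : Type*} [NonUnitalCStarAlgebra A] (c : CKSystem F A)

namespace CKSystem

theorem S_mul_P {Y X : E} (α : Y ⟶ X) : c.S α * c.P Y = c.S α := by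
  rw [(c.id Y).1, ← c.comp, Category.id_comp]

theorem P_mul_S {Y X : E} (α : Y ⟶ X) : c.P X * c.S α = c.S α := by
  rw [(c.id X).1, ← c.comp, Category.comp_id]

theorem star_P (X : E) : star (c.P X) = c.P X := (c.isStarProjection X).isSelfAdjoint.star_eq

theorem star_S_mul_S_of_ne {Y Y' X X' : E} (α : Y ⟶ X) (β : Y' ⟶ X') (h : X ≠ X') :
    star (c.S α) * c.S β = 0 := by
  rw [← c.P_mul_S α, ← c.P_mul_S β, star_mul, c.star_P, mul_assoc, ← mul_assoc (c.P X),
    c.orthogonal X X' h, zero_mul, mul_zero]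

theorem star_S_mul_S_eq_zero {Y Y' X : E} {α : Y ⟶ X} {β : Y' ⟶ X}
    (h : Over.mk (F.map α) = Over.mk (F.map β)) (hne : Over.mk α ≠ Over.mk β) :
    star (c.S α) * c.S β = 0 := by
  refine c.disjoint β α ?_ ?_
  · exact (congrArg (fun o : Over (F.obj X) => Arrow.mk o.hom) h).symm
  · intro e
    have hY : Y' = Y := congrArg (fun a : Arrow E => a.left) e
    subst hY
    have : β = α := by injection e
    exact hne (congrArg Over.mk this.symm)

/-- The element `S_μ S_ν^*`. -/
def V (t : AnyFork E) : A := c.S t.2.μ * star (c.S t.2.ν)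

theorem V_child (t : AnyFork E) (γ : Over t.2.apex) :
    c.V (t.child γ) = c.S t.2.μ * (c.S γ.hom * star (c.S γ.hom)) * star (c.S t.2.ν) := by
  change c.S (γ.hom ≫ t.2.μ) * star (c.S (γ.hom ≫ t.2.ν)) = _
  rw [c.comp, c.comp, star_mul]
  simp only [mul_assoc]

/-- This is the summation relation at the common source, placed between S_μ and S_ν^*. -/
theorem V_isRefinable : IsRefinable F c.V := by
  intro t b
  simp_rw [V_child]
  rw [← Finset.sum_mul, ← Finset.mul_sum]
  have := c.sum t.2.apex b
  rw [fib, this, S_mul_P, V]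

theorem star_V (t : AnyFork E) : star (c.V t) = c.V t.swap := by
  simp [V]

theorem V_mul_V {W Y X T : E} (μ : W ⟶ Y) (ν : W ⟶ X) (τ : W ⟶ T) :
    c.V ⟨(Y, X), ⟨W, μ, ν⟩⟩ * c.V ⟨(X, T), ⟨W, ν, τ⟩⟩ = c.V ⟨(Y, T), ⟨W, μ, τ⟩⟩ := by
  simp only [V]
  rw [mul_assoc, ← mul_assoc (star (c.S ν)), c.source, ← mul_assoc, S_mul_P]

theorem V_mul_V_eq_zero {t t' : AnyFork E} (h : t.1.2 ≠ t'.1.1) : c.V t * c.V t' = 0 := by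
  rw [V, V, mul_assoc, ← mul_assoc (star (c.S t.2.ν)), c.star_S_mul_S_of_ne _ _ h]
  simp

theorem V_mul_V_eq_zero' {Y X T : E} {t : Fork Y X} {t' : Fork X T}
    (h : Over.mk (F.map t.ν) = Over.mk (F.map t'.μ)) (hne : Over.mk t.ν ≠ Over.mk t'.μ) :
    c.V ⟨(Y, X), t⟩ * c.V ⟨(X, T), t'⟩ = 0 := by
  rw [V, V, mul_assoc, ← mul_assoc (star (c.S t.ν)), c.star_S_mul_S_eq_zero h hne]
  simp

/-- The factors S_μ and S_ν^* come out of the sum and are contractions. What remains is a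
combination of the projections S_γ S_γ^*, which are orthogonal because the γ are different lifts of
b. -/
theorem norm_sum_V_child_le (t : AnyFork E) (b : Over (F.obj t.2.apex)) (k : Over t.2.apex → ℂ)
    {M : ℝ} (hM0 : 0 ≤ M) (hM : ∀ γ, ‖k γ‖ ≤ M) :
    ‖∑ γ ∈ fib F b, k γ • c.V (t.child γ)‖ ≤ M := by
  have h1 : ∑ γ ∈ fib F b, k γ • c.V (t.child γ) = c.S t.2.μ *
      (∑ γ : fib F b, k γ • (c.S γ.1.hom * star (c.S γ.1.hom))) * star (c.S t.2.ν) := by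
    rw [Finset.sum_coe_sort (fib F b) fun γ => k γ • (c.S γ.hom * star (c.S γ.hom)),
      Finset.mul_sum, Finset.sum_mul]
    refine Finset.sum_congr rfl fun γ _ => ?_
    rw [V_child, mul_smul_comm, smul_mul_assoc]
  have h2 : ‖∑ γ : fib F b, k γ • (c.S γ.1.hom * star (c.S γ.1.hom))‖ ≤ M := by
    refine norm_sum_smul_le (fun γ => ⟨?_, ?_⟩) (fun γ γ' hne => ?_) _ hM0 fun γ => hM γ
    · rw [IsIdempotentElem, ← mul_assoc, c.partialIsometry]
    · simp [IsSelfAdjoint]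
    · rw [mul_assoc, ← mul_assoc (star _), c.star_S_mul_S_eq_zero, zero_mul, mul_zero]
      · exact (mem_fib.1 γ.2).trans (mem_fib.1 γ'.2).symm
      · exact fun e => hne (Subtype.ext e)
  rw [h1]
  refine (norm_mul_le _ _).trans ?_
  rw [norm_star]
  refine (mul_le_of_le_one_right (norm_nonneg _) (c.norm_S_le _)).trans ?_
  refine (norm_mul_le _ _).trans ?_
  exact (mul_le_of_le_one_left (norm_nonneg _) (c.norm_S_le _)).trans h2

variable [hF : IsKPFibration F]

/-- The linear span of the pairs `(1_{Z(μ, ν)}, S_μ S_ν^*)`. -/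
def graph : Submodule ℂ ((Arrow (PathSpace F) → ℂ) × A) :=
  Submodule.span ℂ (Set.range fun t => (charFn F t, c.V t))

theorem mem_graph (t : AnyFork E) : (charFn F t, c.V t) ∈ c.graph :=
  Submodule.subset_span ⟨t, rfl⟩

/-- The bound depends on the cover D of the support and not on the linear combination. In particular
p.1 = 0 forces p.2 = 0, so the span is the graph of a well-defined map. The forks of the combination
and those of D are refined together into disjoint pieces. -/
theorem norm_le_of_mem_graph (hmono : ∀ ⦃a b : B⦄ (f : a ⟶ b), Mono f)
    {p : (Arrow (PathSpace F) → ℂ) × A} (hp : p ∈ c.graph) {D : Finset (AnyFork E)}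
    (hD : Function.support p.1 ⊆ cover F D) {M : ℝ} (hM0 : 0 ≤ M) (hM : ∀ a, ‖p.1 a‖ ≤ M) :
    ‖p.2‖ ≤ D.card * M := by
  classical
  obtain ⟨a, rfl⟩ := Finsupp.mem_span_range_iff_exists_finsupp.1 hp
  obtain ⟨lev, hlev⟩ := exists_disjoint_pieces (F := F) hmono (a.support ∪ D)
  set P := pieces F (a.support ∪ D) lev with hP
  set k : AnyFork E → ℂ := fun d => ∑ t ∈ a.support, if d ∈ children F t (lev t) then a t else 0
  set p := a.sum fun t z => z • (charFn F t, c.V t)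
  have h1 : p.1 = ∑ d ∈ P, k d • charFn F d := by
    rw [← charFn_isRefinable.sum_pieces hF.conduche hmono (a.support ∪ D) lev
      Finset.subset_union_left]
    simp [p, Finsupp.sum, Prod.fst_sum]
  have h2 : p.2 = ∑ d ∈ P, k d • c.V d := by
    rw [← c.V_isRefinable.sum_pieces hF.conduche hmono (a.support ∪ D) lev
      Finset.subset_union_left]
    simp [p, Finsupp.sum, Prod.snd_sum]
  -- By disjointness the coefficient of a piece is the value of the function there, so it is bounded
  -- by M.
  have h3 : ∀ d ∈ P, ∀ g ∈ d.Z F, p.1 g = k d := by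
    intro d hd g hg
    rw [h1, Finset.sum_apply, Finset.sum_eq_single d]
    · simp [charFn_of_mem hg]
    · intro d' hd' hne
      rw [Pi.smul_apply, charFn_of_notMem, smul_zero]
      exact fun hg' => hne (hlev.elim hd' hd (Set.not_disjoint_iff.2 ⟨g, hg', hg⟩))
    · exact fun h => (h hd).elim
  have hk : ∀ d ∈ P, ‖k d‖ ≤ M := by
    intro d hd
    obtain ⟨g, hg⟩ := fork_Z_nonempty (F := F) d.2
    rw [← h3 d hd g hg]
    exact hM g
  -- A piece with nonzero coefficient meets the support, hence some Z(t) with t in D, and is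
  -- therefore a piece of t.
  have h4 : ∀ d ∈ P.filter fun d => k d ≠ 0, ∃ t ∈ D, d ∈ children F t (lev t) := by
    intro d hd
    rw [Finset.mem_filter] at hd
    obtain ⟨g, hg⟩ := fork_Z_nonempty (F := F) d.2
    have : g ∈ Function.support p.1 := by
      rw [Function.mem_support, h3 d hd.1 g hg]
      exact hd.2
    obtain ⟨t, ht, hgt⟩ := mem_cover.1 (hD this)
    obtain ⟨d', hd', hgd'⟩ := exists_mem_children (lev t) hgt
    have : d' = d := hlev.elim (mem_pieces.2 ⟨t, Finset.mem_union_right _ ht, hd'⟩) hd.1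
      (Set.not_disjoint_iff.2 ⟨g, hgd', hg⟩)
    exact ⟨t, ht, this ▸ hd'⟩
  -- A piece may refine several members of D; fixing one of them counts it once. Grouping by e
  -- leaves |D| sums, each over pieces of a single fork and of norm at most M.
  choose! e he he' using h4
  have h5 : p.2 = ∑ t ∈ D, ∑ γ ∈ fib F (lev t),
      (if t.child γ ∈ P ∧ k (t.child γ) ≠ 0 ∧ e (t.child γ) = t then k (t.child γ) else 0) •
        c.V (t.child γ) := by
    rw [h2, ← Finset.sum_filter_of_ne (p := fun d => k d ≠ 0) fun d _ h hk => h (by simp [hk]),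
      ← Finset.sum_fiberwise_of_maps_to he]
    refine Finset.sum_congr rfl fun t _ => ?_
    rw [← Finset.sum_image (s := fib F (lev t)) (g := t.child)
      (f := fun d => (if d ∈ P ∧ k d ≠ 0 ∧ e d = t then k d else 0) • c.V d)
      fun _ _ _ _ h => t.child_injective hF.conduche hmono h]
    simp_rw [ite_smul, zero_smul]
    rw [← Finset.sum_filter]
    congr 1
    ext d
    simp only [Finset.mem_filter]
    refine ⟨fun ⟨⟨h, h'⟩, h''⟩ => ⟨?_, h, h', h''⟩, fun ⟨_, h, h', h''⟩ => ⟨⟨h, h'⟩, h''⟩⟩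
    have := he' d (Finset.mem_filter.2 ⟨h, h'⟩)
    rw [h''] at this
    exact this
  rw [h5]
  refine (norm_sum_le_of_le _ fun t _ => ?_).trans (b := ∑ _ ∈ D, M) (by simp)
  refine c.norm_sum_V_child_le t (lev t) (fun γ => if t.child γ ∈ P ∧ k (t.child γ) ≠ 0 ∧
    e (t.child γ) = t then k (t.child γ) else 0) hM0 fun γ => ?_
  split_ifs with h
  · exact hk _ h.1
  · simpa using hM0

theorem isCovered_of_mem_graph {p : (Arrow (PathSpace F) → ℂ) × A} (hp : p ∈ c.graph) :
    IsCovered p.1 :=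
  -- Only the coveredness part is wanted; the choices ∅ and ⊤ make the statement about products
  -- empty.
  (convolution_mem_span (s' := ∅) (G := ⊤)
    (by rintro _ ⟨t, rfl⟩; exact IsCovered.charFn t) (by simp) hp (Submodule.zero_mem _)).1

theorem mem_span_children (t : AnyFork E) (b : Over (F.obj t.2.apex)) :
    (charFn F t, c.V t) ∈ Submodule.span ℂ
      ((fun γ : Over t.2.apex => (charFn F (t.child γ), c.V (t.child γ))) '' fib F b) := by
  have : (charFn F t, c.V t) = ∑ γ ∈ fib F b, (charFn F (t.child γ), c.V (t.child γ)) := by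
    refine Prod.ext ?_ ?_
    · rw [Prod.fst_sum]
      exact charFn_isRefinable t b
    · rw [Prod.snd_sum]
      exact c.V_isRefinable t b
  rw [this]
  exact Submodule.sum_mem _ fun γ hγ => Submodule.subset_span ⟨γ, hγ, rfl⟩

/-- Inner legs over the same base morphism are either equal, where both products collapse to one
fork, or different lifts, where both products vanish. -/
theorem convolution_mem_graph_of_map_eq {Y X T : E} {t : Fork Y X} {t' : Fork X T}
    (h : Over.mk (F.map t.ν) = Over.mk (F.map t'.μ)) :
    (convolution (charFn F ⟨(Y, X), t⟩) (charFn F ⟨(X, T), t'⟩),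
      c.V ⟨(Y, X), t⟩ * c.V ⟨(X, T), t'⟩) ∈ c.graph := by
  by_cases hne : Over.mk t.ν = Over.mk t'.μ
  · obtain ⟨W, μ, ν⟩ := t
    obtain ⟨W', ν', τ⟩ := t'
    obtain ⟨e, hν⟩ := Over.mk_inj_left hne
    dsimp only at e hν
    subst e
    rw [eqToHom_refl, Category.id_comp] at hν
    subst hν
    rw [convolution_charFn, V_mul_V]
    exact c.mem_graph _
  · rw [convolution_charFn_eq_zero' h hne, c.V_mul_V_eq_zero' h hne]
    exact c.graph.zero_mem

/-- The Ore condition provides a and b for which the pieces of t over a and of t' over b have inner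
legs with the same image in the base. By bilinearity this suffices. -/
theorem convolution_mem_graph {p q : (Arrow (PathSpace F) → ℂ) × A} (hp : p ∈ c.graph)
    (hq : q ∈ c.graph) : (convolution p.1 q.1, p.2 * q.2) ∈ c.graph := by
  refine (convolution_mem_span (by rintro _ ⟨t, rfl⟩; exact IsCovered.charFn t) ?_ hp hq).2
  rintro _ ⟨⟨⟨Y, X⟩, t⟩, rfl⟩ _ ⟨⟨⟨X', T⟩, t'⟩, rfl⟩
  by_cases hX : X = X'
  · subst hX
    obtain ⟨d, a, b, e⟩ := hF.stronglyRightOre.1 (F.map t.ν) (F.map t'.μ)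
    refine (convolution_mem_span ?_ ?_ (c.mem_span_children ⟨(Y, X), t⟩ (Over.mk a))
      (c.mem_span_children ⟨(X, T), t'⟩ (Over.mk b))).2
    · rintro _ ⟨γ, -, rfl⟩
      exact IsCovered.charFn _
    · rintro _ ⟨γ, hγ, rfl⟩ _ ⟨γ', hγ', rfl⟩
      refine c.convolution_mem_graph_of_map_eq ?_
      have h1 := Over.mk_comp_congr (mem_fib.1 hγ) (F.map t.ν)
      have h2 := Over.mk_comp_congr (mem_fib.1 hγ') (F.map t'.μ)
      change Over.mk (F.map (γ.hom ≫ t.ν)) = Over.mk (F.map (γ'.hom ≫ t'.μ))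
      rw [F.map_comp, F.map_comp, h1, h2]
      exact congrArg Over.mk e
  · dsimp only
    rw [convolution_charFn_eq_zero hX, c.V_mul_V_eq_zero hX]
    exact c.graph.zero_mem

theorem involution_mem_graph {p : (Arrow (PathSpace F) → ℂ) × A} (hp : p ∈ c.graph) :
    (involution p.1, star p.2) ∈ c.graph := by
  induction hp using Submodule.span_induction with
  | mem p hp =>
    obtain ⟨t, rfl⟩ := hp
    dsimp only
    rw [involution_charFn, star_V]
    exact c.mem_graph _
  | zero =>
    convert c.graph.zero_mem
    · funext a
      simp [involution]
    · simp
  | add p q _ _ ih ih' =>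
    convert c.graph.add_mem ih ih' using 1
    refine Prod.ext ?_ ?_
    · funext a
      simp [involution]
    · simp
  | smul z p _ ih =>
    convert c.graph.smul_mem (star z) ih using 1
    refine Prod.ext ?_ ?_
    · funext a
      simp [involution]
    · simp

end CKSystem

end Systems


/-! ### Extension from step functions to C_c(G_F) -/

section Extension

open Filter Topology

variable {E : Type u₁} [Category.{v₁} E] {B : Type u₂} [Category.{v₂} B] {F : E ⥤ B}
  [hfin : IsRowFinite F] {A : Type*} [NonUnitalCStarAlgebra A] (c : CKSystem F A)
  [hF : IsKPFibration F]

theorem isCompact_cover (D : Finset (AnyFork E)) : IsCompact (cover F D) :=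
  D.isCompact_biUnion fun t _ => isCompact_Z t

theorem isClosed_cover (hmono : ∀ ⦃a b : B⦄ (f : a ⟶ b), Mono f) (D : Finset (AnyFork E)) :
    IsClosed (cover F D) :=
  isClosed_biUnion_finset fun t _ => isClosed_Z hmono t

namespace CKSystem

/-- The system enters only through its graph: products of indicators are again combinations of
indicators, hence covered. -/
theorem exists_cover_convolution (c : CKSystem F A) (D D' : Finset (AnyFork E)) :
    ∃ D'' : Finset (AnyFork E), ∀ f g : Arrow (PathSpace F) → ℂ,
      Function.support f ⊆ cover F D → Function.support g ⊆ cover F D' →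
        Function.support (convolution f g) ⊆ cover F D'' := by
  classical
  have h : ∀ t t' : AnyFork E, IsCovered (convolution (charFn F t) (charFn F t')) := fun t t' =>
    c.isCovered_of_mem_graph (c.convolution_mem_graph (c.mem_graph t) (c.mem_graph t'))
  choose C hC using h
  refine ⟨D.biUnion fun t => D'.biUnion fun t' => C t t', fun f g hf hg =>
    (support_convolution_subset hf hg).trans ?_⟩
  refine Set.iUnion₂_subset fun t ht => Set.iUnion₂_subset fun t' ht' => (hC t t').trans ?_
  refine cover_mono fun d hd => Finset.mem_biUnion.2 ⟨t, ht, Finset.mem_biUnion.2 ⟨t', ht', hd⟩⟩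

/-- Continuous functions with compact support can be approximated by linear combinations of
indicator functions of sets `Z(μ, ν)`. -/
theorem exists_mem_graph_norm_sub_le (hmono : ∀ ⦃a b : B⦄ (f : a ⟶ b), Mono f)
    {f : Arrow (PathSpace F) → ℂ} (hf : Continuous f) {D : Finset (AnyFork E)}
    (hD : Function.support f ⊆ cover F D) {ε : ℝ} (hε : 0 < ε) :
    ∃ p ∈ c.graph, Function.support p.1 ⊆ cover F D ∧ ∀ a, ‖p.1 a - f a‖ ≤ ε := by
  classical
  obtain ⟨lev, hlev⟩ := exists_disjoint_pieces (F := F) hmono D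
  choose b hb using fun t : AnyFork E => exists_level_dist_le hf t hε
  choose pt hpt using fun t : AnyFork E => fork_Z_nonempty (F := F) t.2
  -- Each disjoint piece d is refined once more to the level b d, where f varies by at most ε, and f
  -- is sampled at one point of every resulting set.
  let p : (Arrow (PathSpace F) → ℂ) × A := ∑ d ∈ pieces F D lev, ∑ γ ∈ fib F (b d),
    f (pt (d.child γ)) • (charFn F (d.child γ), c.V (d.child γ))
  have hp : ∀ a, p.1 a = ∑ d ∈ pieces F D lev, ∑ γ ∈ fib F (b d),
      f (pt (d.child γ)) * charFn F (d.child γ) a := by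
    intro a
    simp only [p, Prod.fst_sum, Finset.sum_apply, Prod.smul_fst, Pi.smul_apply, smul_eq_mul]
  have hsub : ∀ d ∈ pieces F D lev, d.Z F ⊆ cover F D := by
    intro d hd g hg
    obtain ⟨t, ht, hdt⟩ := mem_pieces.1 hd
    exact mem_cover.2 ⟨t, ht, Z_subset_of_mem_children hdt hg⟩
  have hzero : ∀ a ∉ cover F D, p.1 a = 0 := by
    intro a ha
    rw [hp]
    refine Finset.sum_eq_zero fun d hd => Finset.sum_eq_zero fun γ _ => ?_
    rw [charFn_of_notMem (t := d.child γ) fun h => ha (hsub d hd (child_Z_subset d.2 γ h)),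
      mul_zero]
  refine ⟨p, ?_, fun a ha => by_contra fun h => ha (hzero a h), fun a => ?_⟩
  · exact Submodule.sum_mem _ fun d _ => Submodule.sum_mem _ fun γ _ =>
      Submodule.smul_mem _ _ (c.mem_graph _)
  · by_cases ha : a ∈ cover F D
    · obtain ⟨t, ht, hat⟩ := mem_cover.1 ha
      obtain ⟨d, hd, had⟩ := exists_mem_children (lev t) hat
      obtain ⟨γ, hγ, haγ⟩ := exists_mem_child d.2 (b d) had
      have hdP : d ∈ pieces F D lev := mem_pieces.2 ⟨t, ht, hd⟩
      have : p.1 a = f (pt (d.child γ)) := by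
        rw [hp, Finset.sum_eq_single d, Finset.sum_eq_single γ,
          charFn_of_mem (t := d.child γ) haγ, mul_one]
        · intro γ' hγ' hne
          rw [charFn_of_notMem (t := d.child γ') fun h => hne ?_, mul_zero]
          exact child_eq_of_mem d.2 ((mem_fib.1 hγ').trans (mem_fib.1 hγ).symm) h haγ
        · exact fun h => (h hγ).elim
        · intro d' hd' hne
          refine Finset.sum_eq_zero fun γ' _ => ?_
          rw [charFn_of_notMem (t := d'.child γ') fun h => hne ?_, mul_zero]
          exact hlev.elim hd' hdP (Set.not_disjoint_iff.2 ⟨a, child_Z_subset d'.2 γ' h, had⟩)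
        · exact fun h => (h hdP).elim
      rw [this, ← dist_eq_norm]
      exact hb d _ (mem_children.2 ⟨γ, hγ, rfl⟩) _ (hpt _) _ haγ
    · have : f a = 0 := by_contra fun h => ha (hD h)
      rw [hzero a ha, this, sub_zero, norm_zero]
      exact hε.le

/-- `T` is a limit of linear combinations of the elements `S_μ S_ν^*` for which the corresponding
linear combinations of indicator functions converge to `f` in the inductive limit topology. -/
def IsLimit (f : Arrow (PathSpace F) → ℂ) (T : A) : Prop :=
  (∃ M, ∀ a, ‖f a‖ ≤ M) ∧
    ∃ (D : Finset (AnyFork E)) (p : ℕ → (Arrow (PathSpace F) → ℂ) × A) (δ : ℕ → ℝ),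
      Function.support f ⊆ cover F D ∧ (∀ n, p n ∈ c.graph) ∧
      (∀ n, Function.support (p n).1 ⊆ cover F D) ∧ (∀ n a, ‖(p n).1 a - f a‖ ≤ δ n) ∧
      (∀ n, 0 ≤ δ n) ∧ Tendsto δ atTop (𝓝 0) ∧ Tendsto (fun n => (p n).2) atTop (𝓝 T)

variable {c}

/-- The difference of two approximants is supported in D ∪ D' and uniformly at most δ + ε, so the
norm estimate sends the difference of their operators to 0. -/
theorem IsLimit.unique (hmono : ∀ ⦃a b : B⦄ (f : a ⟶ b), Mono f)
    {f : Arrow (PathSpace F) → ℂ} {T T' : A} (h : c.IsLimit f T) (h' : c.IsLimit f T') :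
    T = T' := by
  classical
  obtain ⟨-, D, p, δ, -, hp, hD, hδ, hδ0, hδ', hT⟩ := h
  obtain ⟨-, D', p', ε, -, hp', hD', hε, hε0, hε', hT'⟩ := h'
  have key : ∀ n, ‖(p n).2 - (p' n).2‖ ≤ (D ∪ D').card * (δ n + ε n) := by
    intro n
    refine c.norm_le_of_mem_graph hmono (c.graph.sub_mem (hp n) (hp' n)) ?_
      (add_nonneg (hδ0 n) (hε0 n)) fun a => ?_
    · refine (Function.support_sub _ _).trans (Set.union_subset ?_ ?_)
      · exact (hD n).trans (cover_mono Finset.subset_union_left)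
      · exact (hD' n).trans (cover_mono Finset.subset_union_right)
    · have : (p n - p' n).1 a = ((p n).1 a - f a) - ((p' n).1 a - f a) := by simp
      rw [this]
      exact (norm_sub_le _ _).trans (add_le_add (hδ n a) (hε n a))
  have h0 : Tendsto (fun n => (p n).2 - (p' n).2) atTop (𝓝 0) := by
    refine squeeze_zero_norm key ?_
    simpa using (hδ'.add hε').const_mul ((D ∪ D').card : ℝ)
  exact sub_eq_zero.1 (tendsto_nhds_unique (hT.sub hT') h0)

theorem isLimit_of_mem_graph {p : (Arrow (PathSpace F) → ℂ) × A} (hp : p ∈ c.graph)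
    (hb : ∃ M, ∀ a, ‖p.1 a‖ ≤ M) : c.IsLimit p.1 p.2 := by
  obtain ⟨D, hD⟩ := c.isCovered_of_mem_graph hp
  exact ⟨hb, D, fun _ => p, fun _ => 0, hD, fun _ => hp, fun _ => hD, by simp, by simp,
    tendsto_const_nhds, tendsto_const_nhds⟩

theorem isLimit_charFn (t : AnyFork E) : c.IsLimit (charFn F t) (c.V t) := by
  refine isLimit_of_mem_graph (c.mem_graph t) ⟨1, fun a => ?_⟩
  by_cases h : a ∈ t.Z F
  · simp [charFn_of_mem h]
  · simp [charFn_of_notMem h]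

theorem IsLimit.add {f g : Arrow (PathSpace F) → ℂ} {T S : A} (h : c.IsLimit f T)
    (h' : c.IsLimit g S) : c.IsLimit (f + g) (T + S) := by
  classical
  obtain ⟨⟨M, hM⟩, D, p, δ, h0, hp, hD, hδ, hδ0, hδ', hT⟩ := h
  obtain ⟨⟨M', hM'⟩, D', p', ε, h0', hp', hD', hε, hε0, hε', hT'⟩ := h'
  have l : cover F D ⊆ cover F (D ∪ D') := cover_mono Finset.subset_union_left
  have r : cover F D' ⊆ cover F (D ∪ D') := cover_mono Finset.subset_union_right
  refine ⟨⟨M + M', fun a => norm_add_le_of_le (hM a) (hM' a)⟩, D ∪ D', p + p', δ + ε,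
    (Function.support_add _ _).trans (Set.union_subset (h0.trans l) (h0'.trans r)),
    fun n => c.graph.add_mem (hp n) (hp' n),
    fun n => (Function.support_add _ _).trans
      (Set.union_subset ((hD n).trans l) ((hD' n).trans r)),
    fun n a => ?_, fun n => add_nonneg (hδ0 n) (hε0 n), (add_zero (0 : ℝ)) ▸ hδ'.add hε', hT.add hT'⟩
  have : ((p + p') n).1 a - (f + g) a = ((p n).1 a - f a) + ((p' n).1 a - g a) := by
    simp only [Pi.add_apply, Prod.fst_add]
    ring
  rw [this]
  exact norm_add_le_of_le (hδ n a) (hε n a)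

theorem IsLimit.smul {f : Arrow (PathSpace F) → ℂ} {T : A} (h : c.IsLimit f T) (z : ℂ) :
    c.IsLimit (z • f) (z • T) := by
  obtain ⟨⟨M, hM⟩, D, p, δ, h0, hp, hD, hδ, hδ0, hδ', hT⟩ := h
  refine ⟨⟨‖z‖ * M, fun a => ?_⟩, D, fun n => z • p n, fun n => ‖z‖ * δ n,
    (Function.support_const_smul_subset _ _).trans h0, fun n => c.graph.smul_mem z (hp n),
    fun n => (Function.support_const_smul_subset _ _).trans (hD n), fun n a => ?_,
    fun n => mul_nonneg (norm_nonneg _) (hδ0 n), by simpa using hδ'.const_mul ‖z‖,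
    hT.const_smul z⟩
  · rw [Pi.smul_apply, norm_smul]
    exact mul_le_mul_of_nonneg_left (hM a) (norm_nonneg _)
  · have : (z • p n).1 a - (z • f) a = z • ((p n).1 a - f a) := by simp [mul_sub]
    rw [this, norm_smul]
    exact mul_le_mul_of_nonneg_left (hδ n a) (norm_nonneg _)

theorem IsLimit.star {f : Arrow (PathSpace F) → ℂ} {T : A} (h : c.IsLimit f T) :
    c.IsLimit (involution f) (star T) := by
  obtain ⟨⟨M, hM⟩, D, p, δ, h0, hp, hD, hδ, hδ0, hδ', hT⟩ := h
  have hs : ∃ D', ∀ g : Arrow (PathSpace F) → ℂ, Function.support g ⊆ cover F D →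
      Function.support (involution g) ⊆ cover F D' := by
    classical
    refine ⟨D.image AnyFork.swap, fun g hg a ha => ?_⟩
    have h0 : g (Arrow.mk (Groupoid.inv a.hom)) ≠ 0 := fun h =>
      ha (by simp only [involution, h, star_zero])
    obtain ⟨t, ht, h⟩ := mem_cover.1 (hg h0)
    exact mem_cover.2 ⟨t.swap, Finset.mem_image_of_mem _ ht, inv_mem_bisection_iff.1 h⟩
  obtain ⟨D', hD'⟩ := hs
  refine ⟨⟨M, fun a => ?_⟩, D', fun n => (involution (p n).1, Star.star (p n).2), δ, hD' _ h0,
    fun n => c.involution_mem_graph (hp n), fun n => hD' _ (hD n), fun n a => ?_, hδ0, hδ',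
    hT.star⟩
  · exact (norm_star (f _)).le.trans (hM _)
  · simp only [involution]
    rw [← star_sub, norm_star]
    exact hδ n _

/-- Write p * p' - f * g = (p - f) * p' + f * (p' - g) and bound each term by `norm_convolution_le`.
-/
theorem IsLimit.mul {f g : Arrow (PathSpace F) → ℂ} {T S : A} (h : c.IsLimit f T)
    (h' : c.IsLimit g S) : c.IsLimit (convolution f g) (T * S) := by
  obtain ⟨⟨M, hM⟩, D, p, δ, h0, hp, hD, hδ, hδ0, hδ', hT⟩ := h
  obtain ⟨⟨M', hM'⟩, D', p', ε, h0', hp', hD', hε, hε0, hε', hT'⟩ := h'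
  obtain ⟨D'', hD''⟩ := c.exists_cover_convolution D D'
  have hM0 : ∀ a : Arrow (PathSpace F), 0 ≤ M := fun a => (norm_nonneg _).trans (hM a)
  have hp'b : ∀ n a, ‖(p' n).1 a‖ ≤ M' + ε n := fun n a => by
    have := norm_add_le (g a) ((p' n).1 a - g a)
    rw [add_sub_cancel] at this
    exact this.trans (add_le_add (hM' a) (hε n a))
  refine ⟨⟨_, norm_convolution_le h0 hM hM'⟩, D'',
    fun n => (convolution (p n).1 (p' n).1, (p n).2 * (p' n).2),
    -- The absolute value secures nonnegativity even if there are no arrows, in which case the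
    -- bounds M, M' could be negative.
    fun n => |D.card * (δ n * (M' + ε n)) + D.card * (M * ε n)|, hD'' _ _ h0 h0',
    fun n => c.convolution_mem_graph (hp n) (hp' n), fun n => hD'' _ _ (hD n) (hD' n),
    fun n a => ?_, fun n => abs_nonneg _, ?_, hT.mul hT'⟩
  · have hsub : Function.support ((p n).1 - f) ⊆ cover F D :=
      (Function.support_sub _ _).trans (Set.union_subset (hD n) h0)
    have e1 : convolution (p n).1 (p' n).1 =
        convolution ((p n).1 - f) (p' n).1 + convolution f (p' n).1 := by
      rw [← convolution_add_left ⟨D, hsub⟩ ⟨D, h0⟩, sub_add_cancel]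
    have e2 : convolution f (p' n).1 = convolution f ((p' n).1 - g) + convolution f g := by
      rw [← convolution_add_right ⟨D, h0⟩, sub_add_cancel]
    have e3 : convolution (p n).1 (p' n).1 a - convolution f g a =
        convolution ((p n).1 - f) (p' n).1 a + convolution f ((p' n).1 - g) a := by
      rw [e1, e2, Pi.add_apply, Pi.add_apply]
      ring
    dsimp only
    rw [e3]
    refine le_trans ?_ (le_abs_self _)
    exact norm_add_le_of_le (norm_convolution_le hsub (hδ n) (hp'b n) a)
      (norm_convolution_le h0 hM (hε n) a)
  · have h1 := (hδ'.mul (hε'.const_add M')).const_mul (D.card : ℝ)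
    have h2 := (hε'.const_mul M).const_mul (D.card : ℝ)
    simpa using (h1.add h2).abs

variable (c)

/-- Step functions within 1/(n+1) of f have supports in the same cover D, so the norm estimate makes
their operators a Cauchy sequence. The estimate also passes to the limit. -/
theorem exists_isLimit (hmono : ∀ ⦃a b : B⦄ (f : a ⟶ b), Mono f)
    {f : Arrow (PathSpace F) → ℂ} (hf : Continuous f) {D : Finset (AnyFork E)}
    (hD : Function.support f ⊆ cover F D) {M : ℝ} (hM0 : 0 ≤ M) (hM : ∀ a, ‖f a‖ ≤ M) :
    ∃ T, c.IsLimit f T ∧ ‖T‖ ≤ D.card * M := by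
  have hδ0 : ∀ n : ℕ, (0 : ℝ) < 1 / ((n : ℝ) + 1) := fun n => Nat.one_div_pos_of_nat
  choose p hp hpD hδ using fun n : ℕ => c.exists_mem_graph_norm_sub_le hmono hf hD (hδ0 n)
  have hδ' := tendsto_one_div_add_atTop_nhds_zero_nat (𝕜 := ℝ)
  have hcauchy : CauchySeq fun n => (p n).2 := by
    refine cauchySeq_of_le_tendsto_0
      (fun N : ℕ => D.card * (1 / ((N : ℝ) + 1) + 1 / ((N : ℝ) + 1))) (fun n m N hn hm => ?_)
      (by simpa using (hδ'.add hδ').const_mul (D.card : ℝ))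
    rw [dist_eq_norm]
    refine c.norm_le_of_mem_graph hmono (c.graph.sub_mem (hp n) (hp m))
      ((Function.support_sub _ _).trans (Set.union_subset (hpD n) (hpD m)))
      (add_nonneg (hδ0 N).le (hδ0 N).le) fun a => ?_
    have e : (p n - p m).1 a = ((p n).1 a - f a) - ((p m).1 a - f a) := by simp
    rw [e]
    refine (norm_sub_le _ _).trans (add_le_add ((hδ n a).trans ?_) ((hδ m a).trans ?_))
    · exact Nat.one_div_le_one_div hn
    · exact Nat.one_div_le_one_div hm
  obtain ⟨T, hT⟩ := cauchySeq_tendsto_of_complete hcauchy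
  refine ⟨T, ⟨⟨M, hM⟩, D, p, _, hD, hp, hpD, hδ, fun n => (hδ0 n).le, hδ', hT⟩, ?_⟩
  have h2 : Tendsto (fun n : ℕ => D.card * (M + 1 / ((n : ℝ) + 1))) atTop (𝓝 (D.card * M)) := by
    simpa using (hδ'.const_add M).const_mul (D.card : ℝ)
  refine le_of_tendsto_of_tendsto' hT.norm h2 fun n => ?_
  refine c.norm_le_of_mem_graph hmono (hp n) (hpD n) (add_nonneg hM0 (hδ0 n).le) fun a => ?_
  have := norm_add_le (f a) ((p n).1 a - f a)
  rw [add_sub_cancel] at this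
  exact this.trans (add_le_add (hM a) (hδ n a))

theorem exists_isLimit_of_compactlySupported (hmono : ∀ ⦃a b : B⦄ (f : a ⟶ b), Mono f)
    (f : C_c(Arrow (PathSpace F), ℂ)) : ∃ T, c.IsLimit f T := by
  obtain ⟨D, hD⟩ := exists_cover f.hasCompactSupport.isCompact
  obtain ⟨M, hM⟩ := f.hasCompactSupport.exists_bound_of_continuous f.continuous
  obtain ⟨T, hT, -⟩ := c.exists_isLimit hmono f.continuous ((subset_tsupport _).trans hD)
    (abs_nonneg M) fun a => (hM a).trans (le_abs_self M)
  exact ⟨T, hT⟩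

/-- The extension of `1_{Z(μ, ν)} ↦ S_μ S_ν^*` to all continuous functions with compact support. -/
noncomputable def integrated (hmono : ∀ ⦃a b : B⦄ (f : a ⟶ b), Mono f) :
    C_c(Arrow (PathSpace F), ℂ) →ₗ[ℂ] A where
  toFun f := (c.exists_isLimit_of_compactlySupported hmono f).choose
  map_add' f g := IsLimit.unique hmono
    (c.exists_isLimit_of_compactlySupported hmono (f + g)).choose_spec
    ((c.exists_isLimit_of_compactlySupported hmono f).choose_spec.add
      (c.exists_isLimit_of_compactlySupported hmono g).choose_spec)
  map_smul' z f := IsLimit.unique hmono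
    (c.exists_isLimit_of_compactlySupported hmono (z • f)).choose_spec
    ((c.exists_isLimit_of_compactlySupported hmono f).choose_spec.smul z)

variable (hmono : ∀ ⦃a b : B⦄ (f : a ⟶ b), Mono f)

theorem isLimit_integrated (f : C_c(Arrow (PathSpace F), ℂ)) :
    c.IsLimit f (c.integrated hmono f) :=
  (c.exists_isLimit_of_compactlySupported hmono f).choose_spec

theorem integrated_convolution {f g h : C_c(Arrow (PathSpace F), ℂ)}
    (e : ⇑h = convolution ⇑f ⇑g) :
    c.integrated hmono h = c.integrated hmono f * c.integrated hmono g :=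
  IsLimit.unique hmono (c.isLimit_integrated hmono h)
    (e ▸ (c.isLimit_integrated hmono f).mul (c.isLimit_integrated hmono g))

theorem integrated_involution {f h : C_c(Arrow (PathSpace F), ℂ)} (e : ⇑h = involution ⇑f) :
    c.integrated hmono h = star (c.integrated hmono f) :=
  IsLimit.unique hmono (c.isLimit_integrated hmono h)
    (e ▸ (c.isLimit_integrated hmono f).star)

theorem integrated_charC (t : AnyFork E) : c.integrated hmono (charC hmono t) = c.V t :=
  IsLimit.unique hmono (c.isLimit_integrated hmono _) (isLimit_charFn t)

theorem norm_integrated_le (f : C_c(Arrow (PathSpace F), ℂ)) {D : Finset (AnyFork E)}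
    (hD : Function.support f ⊆ cover F D) {M : ℝ} (hM0 : 0 ≤ M) (hM : ∀ a, ‖f a‖ ≤ M) :
    ‖c.integrated hmono f‖ ≤ D.card * M := by
  obtain ⟨T, hT, h⟩ := c.exists_isLimit hmono f.continuous hD hM0 hM
  rwa [IsLimit.unique hmono (c.isLimit_integrated hmono f) hT]

/-- The extension is continuous for the inductive limit topology. -/
theorem tendsto_integrated {f : ℕ → C_c(Arrow (PathSpace F), ℂ)}
    {g : C_c(Arrow (PathSpace F), ℂ)}
    (hK : ∃ K : Set (Arrow (PathSpace F)), IsCompact K ∧ ∀ᶠ n in atTop, tsupport ⇑(f n) ⊆ K)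
    (h : TendstoUniformly (fun n => ⇑(f n)) ⇑g atTop) :
    Tendsto (fun n => c.integrated hmono (f n)) atTop (𝓝 (c.integrated hmono g)) := by
  obtain ⟨K, hK, hfK⟩ := hK
  obtain ⟨D, hD⟩ := exists_cover hK
  have hf0 : ∀ᶠ n in atTop, Function.support (f n) ⊆ cover F D :=
    hfK.mono fun n hn => (subset_tsupport _).trans (hn.trans hD)
  -- The compact set controls only the f n; the limit inherits the support condition pointwise.
  have hg0 : Function.support g ⊆ cover F D := by
    intro a ha
    by_contra hna
    refine ha (tendsto_nhds_unique (h.tendsto_at a) ?_)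
    refine tendsto_const_nhds.congr' (hf0.mono fun n hn => ?_)
    exact (by_contra fun hne => hna (hn (Ne.symm hne)))
  rw [Metric.tendsto_nhds]
  intro ε hε
  -- The summand 1 covers an empty D and makes the final inequality strict.
  have hN : (0 : ℝ) < D.card + 1 := by positivity
  filter_upwards [hf0, Metric.tendstoUniformly_iff.1 h (ε / (D.card + 1)) (by positivity)]
    with n hn hn'
  rw [dist_eq_norm, ← map_sub]
  refine (c.norm_integrated_le hmono (f n - g) (D := D) (M := ε / (D.card + 1)) ?_
    (by positivity) fun a => ?_).trans_lt ?_
  · rw [CompactlySupportedContinuousMap.coe_sub]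
    exact (Function.support_sub _ _).trans (Set.union_subset hn hg0)
  · rw [CompactlySupportedContinuousMap.coe_sub, Pi.sub_apply, ← dist_eq_norm, dist_comm]
    exact (hn' a).le
  · rw [mul_div_assoc', div_lt_iff₀ hN]
    nlinarith

end CKSystem

end Extension


/-! ### Homomorphisms on closed *-algebras of bounded families -/

section BoundedFamilyHoms

variable {I : Type*} {H : I → Type*} [∀ i, NormedAddCommGroup (H i)]
  [∀ i, InnerProductSpace ℂ (H i)] [∀ i, CompleteSpace (H i)]

theorem BoundedFamily.ext {a b : BoundedFamily H} (h : ∀ i, a.at i = b.at i) : a = b :=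
  Subtype.ext (funext h)

/-- The component at `i`, as a homomorphism. -/
noncomputable def BoundedFamily.atHom (i : I) : BoundedFamily H →⋆ₙₐ[ℂ] (H i →L[ℂ] H i) where
  toFun a := a.at i
  map_smul' _ _ := rfl
  map_zero' := rfl
  map_add' _ _ := rfl
  map_mul' _ _ := rfl
  map_star' _ := rfl

/-- The homomorphism into bounded families with given components. -/
noncomputable def BoundedFamily.lift {A : Type*} [NonUnitalCStarAlgebra A]
    (θ : ∀ i, A →⋆ₙₐ[ℂ] (H i →L[ℂ] H i)) : A →⋆ₙₐ[ℂ] BoundedFamily H where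
  toFun a := ⟨fun i => θ i a, memℓp_infty ⟨‖a‖, by
    rintro _ ⟨i, rfl⟩
    exact NonUnitalStarAlgHom.norm_apply_le (θ i) a⟩⟩
  map_smul' z a := BoundedFamily.ext fun i => map_smul (θ i) z a
  map_zero' := BoundedFamily.ext fun i => map_zero (θ i)
  map_add' a b := BoundedFamily.ext fun i => map_add (θ i) a b
  map_mul' a b := BoundedFamily.ext fun i => map_mul (θ i) a b
  map_star' a := BoundedFamily.ext fun i => map_star (θ i) a

theorem continuous_starHom {A A' : Type*} [NonUnitalCStarAlgebra A] [NonUnitalCStarAlgebra A']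
    (φ : A →⋆ₙₐ[ℂ] A') : Continuous φ :=
  AddMonoidHomClass.continuous_of_bound φ 1 fun a => by
    simpa using NonUnitalStarAlgHom.norm_apply_le φ a

/-- Properties closed under the algebra operations and limits need checking only on generators,
since the algebraic span is dense in the generated algebra. -/
theorem generated_induction {s : Set (BoundedFamily H)} {p : generated s → Prop}
    (closed : IsClosed {x | p x}) (mem : ∀ a (ha : a ∈ s), p ⟨a, mem_generated _ ha⟩)
    (zero : p 0) (add : ∀ x y, p x → p y → p (x + y)) (mul : ∀ x y, p x → p y → p (x * y))
    (smul : ∀ (z : ℂ) x, p x → p (z • x)) (star : ∀ x, p x → p (star x)) (x : generated s) :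
    p x := by
  have hle : NonUnitalStarAlgebra.adjoin ℂ s ≤ generated s :=
    NonUnitalStarSubalgebra.le_topologicalClosure _
  have hadj : ∀ a (ha : a ∈ NonUnitalStarAlgebra.adjoin ℂ s), p ⟨a, hle ha⟩ := by
    intro a ha
    induction ha using NonUnitalStarAlgebra.adjoin_induction with
    | mem a ha => exact mem a ha
    | zero => exact zero
    | add a b ha hb iha ihb => exact add ⟨a, hle ha⟩ ⟨b, hle hb⟩ iha ihb
    | mul a b ha hb iha ihb => exact mul ⟨a, hle ha⟩ ⟨b, hle hb⟩ iha ihb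
    | smul z a ha iha => exact smul z ⟨a, hle ha⟩ iha
    | star a ha iha => exact star ⟨a, hle ha⟩ iha
  have hsub : {y : generated s | y.1 ∈ NonUnitalStarAlgebra.adjoin ℂ s} ⊆ {x | p x} :=
    fun y hy => hadj y.1 hy
  -- The closure in the subtype is compared with the closure of the image in the ambient algebra,
  -- where membership of x is known.
  refine closure_minimal hsub closed ?_
  rw [closure_subtype]
  have himg : ((↑) : generated s → BoundedFamily H) ''
      {y : generated s | y.1 ∈ NonUnitalStarAlgebra.adjoin ℂ s} =
        NonUnitalStarAlgebra.adjoin ℂ s := by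
    ext a
    exact ⟨fun ⟨y, hy, e⟩ => e ▸ hy, fun ha => ⟨⟨a, hle ha⟩, ha, rfl⟩⟩
  rw [himg]
  exact x.2

theorem generated_hom_ext {s : Set (BoundedFamily H)} {A : Type*} [NonUnitalCStarAlgebra A]
    {φ ψ : generated s →⋆ₙₐ[ℂ] A}
    (h : ∀ a (ha : a ∈ s), φ ⟨a, mem_generated _ ha⟩ = ψ ⟨a, mem_generated _ ha⟩)
    (x : generated s) : φ x = ψ x := by
  refine generated_induction (p := fun x => φ x = ψ x)
    (isClosed_eq (continuous_starHom φ) (continuous_starHom ψ)) h ?_ ?_ ?_ ?_ ?_ x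
  · simp
  · intro x y hx hy
    rw [map_add, map_add, hx, hy]
  · intro x y hx hy
    rw [map_mul, map_mul, hx, hy]
  · intro z x hx
    rw [map_smul, map_smul, hx]
  · intro x hx
    rw [map_star, map_star, hx]

theorem generated_map_mem {s : Set (BoundedFamily H)} {A : Type*} [NonUnitalCStarAlgebra A]
    (φ : generated s →⋆ₙₐ[ℂ] A) {S : NonUnitalStarSubalgebra ℂ A} (hS : IsClosed (S : Set A))
    (h : ∀ a (ha : a ∈ s), φ ⟨a, mem_generated _ ha⟩ ∈ S) (x : generated s) : φ x ∈ S := by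
  refine generated_induction (p := fun x => φ x ∈ S)
    (hS.preimage (continuous_starHom φ)) h ?_ ?_ ?_ ?_ ?_ x
  · rw [map_zero]
    exact zero_mem S
  · intro x y hx hy
    rw [map_add]
    exact add_mem hx hy
  · intro x y hx hy
    rw [map_mul]
    exact mul_mem hx hy
  · intro z x hx
    rw [map_smul]
    exact SMulMemClass.smul_mem z hx
  · intro x hx
    rw [map_star]
    exact star_mem hx

end BoundedFamilyHoms

/-! ### From relations between forks back to Cuntz–Krieger systems -/

section ForkSystems

variable {E : Type u₁} [Category.{v₁} E] {B : Type u₂} [Category.{v₂} B] {F : E ⥤ B}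
  [hfin : IsRowFinite F] {A : Type*} [NonUnitalCStarAlgebra A]

/-- The fork `(α, s(α))`. -/
@[reducible]
def AnyFork.ofHom {Y X : E} (α : Y ⟶ X) : AnyFork E := ⟨(X, Y), ⟨Y, α, 𝟙 Y⟩⟩

variable (F) in
/-- Families of elements indexed by forks that satisfy the relations of the elements
`S_μ S_ν^*` of a Cuntz-Krieger system. -/
structure IsForkSystem (W : AnyFork E → A) : Prop where
  refinable : IsRefinable F W
  star : ∀ t, star (W t) = W t.swap
  mul : ∀ {V Y X T : E} (μ : V ⟶ Y) (ν : V ⟶ X) (τ : V ⟶ T),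
    W ⟨(Y, X), ⟨V, μ, ν⟩⟩ * W ⟨(X, T), ⟨V, ν, τ⟩⟩ = W ⟨(Y, T), ⟨V, μ, τ⟩⟩
  mul_eq_zero : ∀ {t t' : AnyFork E}, t.1.2 ≠ t'.1.1 → W t * W t' = 0
  mul_eq_zero' : ∀ {Y X T : E} {t : Fork Y X} {t' : Fork X T},
    Over.mk (F.map t.ν) = Over.mk (F.map t'.μ) → Over.mk t.ν ≠ Over.mk t'.μ →
      W ⟨(Y, X), t⟩ * W ⟨(X, T), t'⟩ = 0

namespace IsForkSystem

variable {W : AnyFork E → A} (h : IsForkSystem F W)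
include h

theorem star_ofHom_mul {Y Y' X : E} (α : Y ⟶ X) (β : Y' ⟶ X) :
    Star.star (W (AnyFork.ofHom α)) * W (AnyFork.ofHom β) =
      W ⟨(Y, X), ⟨Y, 𝟙 Y, α⟩⟩ * W ⟨(X, Y'), ⟨Y', β, 𝟙 Y'⟩⟩ := by
  rw [h.star]
  rfl

theorem ofHom_mul_star {V Y X : E} (μ : V ⟶ Y) (ν : V ⟶ X) :
    W (AnyFork.ofHom μ) * Star.star (W (AnyFork.ofHom ν)) = W ⟨(Y, X), ⟨V, μ, ν⟩⟩ := by
  rw [h.star]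
  exact h.mul μ (𝟙 V) ν

/-- Refine (α,s(α)) over F(β). The pieces are (αγ,γ) with γ a lift of F(β); all with γ ≠ β are
annihilated by W(β,s(β)), and the remaining product is a matched one. -/
theorem ofHom_mul_ofHom {Z Y X : E} (β : Z ⟶ Y) (α : Y ⟶ X) :
    W (AnyFork.ofHom α) * W (AnyFork.ofHom β) = W (AnyFork.ofHom (β ≫ α)) := by
  rw [h.refinable (AnyFork.ofHom α) (Over.mk (F.map β)), Finset.sum_mul,
    Finset.sum_eq_single (Over.mk β)]
  · have e : (AnyFork.ofHom α).child (Over.mk β) = ⟨(X, Y), ⟨Z, β ≫ α, β⟩⟩ := by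
      change (⟨(X, Y), ⟨Z, β ≫ α, β ≫ 𝟙 Y⟩⟩ : AnyFork E) = _
      rw [Category.comp_id]
    rw [e]
    exact h.mul (β ≫ α) β (𝟙 Z)
  · intro γ hγ hne
    refine h.mul_eq_zero' (t := (AnyFork.ofHom α).2.child γ) (t' := ⟨Z, β, 𝟙 Z⟩) ?_ ?_
    · change Over.mk (F.map (γ.hom ≫ 𝟙 Y)) = Over.mk (F.map β)
      rw [Category.comp_id]
      exact mem_fib.1 hγ
    · change Over.mk (γ.hom ≫ 𝟙 Y) ≠ Over.mk β
      rw [Category.comp_id]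
      exact hne
  · exact fun hβ => (hβ (mem_fib.2 rfl)).elim

/-- The Cuntz-Krieger system of a family of elements indexed by forks. -/
def ckSystem : CKSystem F A where
  P X := W (AnyFork.ofHom (𝟙 X))
  S Y X α := W (AnyFork.ofHom α)
  isStarProjection X := ⟨h.mul (𝟙 X) (𝟙 X) (𝟙 X), h.star _⟩
  partialIsometry Y X α := by
    rw [h.ofHom_mul_star]
    exact h.mul α α (𝟙 Y)
  orthogonal X Y hne := h.mul_eq_zero hne
  comp Z Y X β α := (h.ofHom_mul_ofHom β α).symm
  id X := ⟨rfl, (h.star (AnyFork.ofHom (𝟙 X))).symm⟩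
  source Y X α := by
    rw [h.star_ofHom_mul]
    exact h.mul (𝟙 Y) α (𝟙 Y)
  disjoint Y X Y' X' α β e hne := by
    rw [h.star]
    by_cases hX : X' = X
    · subst hX
      refine h.mul_eq_zero' (t := ⟨Y', 𝟙 Y', β⟩) (t' := ⟨Y, α, 𝟙 Y⟩) ?_ ?_
      · have key : ∀ {c d d' : B} (f : d ⟶ c) (f' : d' ⟶ c), Arrow.mk f = Arrow.mk f' →
            Over.mk f' = Over.mk f := by
          intro c d d' f f' e
          have hd : d = d' := congrArg (fun a : Arrow B => a.left) e
          subst hd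
          have : f = f' := by injection e
          rw [this]
        exact key (F.map α) (F.map β) e
      · intro e'
        exact hne (congrArg (fun o : Over X' => Arrow.mk o.hom) e').symm
    · exact h.mul_eq_zero hX
  sum X b := by
    refine Eq.trans ?_ (h.refinable (AnyFork.ofHom (𝟙 X)) b).symm
    refine Finset.sum_congr rfl fun α _ => ?_
    rw [h.ofHom_mul_star]
    have e : (AnyFork.ofHom (𝟙 X)).child α = ⟨(X, X), ⟨α.left, α.hom, α.hom⟩⟩ := by
      change (⟨(X, X), ⟨α.left, α.hom ≫ 𝟙 X, α.hom ≫ 𝟙 X⟩⟩ : AnyFork E) = _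
      rw [Category.comp_id]
    rw [e]

theorem ckSystem_V (t : AnyFork E) : h.ckSystem.V t = W t := h.ofHom_mul_star t.2.μ t.2.ν

end IsForkSystem

end ForkSystems

/-! ### Cuntz–Krieger representations versus representations of C_c(G_F) -/

section Representations

open Filter Topology

variable {E : Type u₁} [Category.{v₁} E] {B : Type u₂} [Category.{v₂} B] {F : E ⥤ B}
  [hfin : IsRowFinite F]

theorem CKSystem.V_ofHom {A : Type*} [NonUnitalCStarAlgebra A] (c : CKSystem F A) {Y X : E}
    (α : Y ⟶ X) : c.V (AnyFork.ofHom α) = c.S α := by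
  change c.S α * star (c.S (𝟙 Y)) = c.S α
  rw [← (c.id Y).2, c.S_mul_P]

/-- The component at a Cuntz-Krieger representation, as a homomorphism. -/
noncomputable def evalCK (j : CKRepresentation F) :
    CuntzKriegerAlgebra F →⋆ₙₐ[ℂ] (j.H →L[ℂ] j.H) :=
  (BoundedFamily.atHom (H := CKRepresentation.H (F := F)) j).comp
    (NonUnitalStarSubalgebraClass.subtype _)

theorem evalCK_genS (j : CKRepresentation F) {Y X : E} (α : Y ⟶ X) :
    evalCK j (genS F α) = j.system.S α := rfl

theorem evalCK_genP (j : CKRepresentation F) (X : E) : evalCK j (genP F X) = j.system.P X := rfl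

/-- Relations in C*(F) can be verified in each representation; this makes its generators a
Cuntz–Krieger system. -/
theorem evalCK_ext {a b : CuntzKriegerAlgebra F} (h : ∀ j, evalCK j a = evalCK j b) : a = b :=
  Subtype.ext (BoundedFamily.ext h)

variable (F) in
/-- The universal Cuntz-Krieger system. -/
noncomputable def univSystem : CKSystem F (CuntzKriegerAlgebra F) where
  P := genP F
  S Y X α := genS F α
  isStarProjection X := by
    refine ⟨evalCK_ext fun j => ?_, evalCK_ext fun j => ?_⟩
    · rw [map_mul, evalCK_genP, (j.system.isStarProjection X).isIdempotentElem.eq]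
    · rw [map_star, evalCK_genP, j.system.star_P]
  partialIsometry Y X α := evalCK_ext fun j => by
    simp only [map_mul, map_star, evalCK_genS, j.system.partialIsometry]
  orthogonal X Y hne := evalCK_ext fun j => by
    simp only [map_mul, map_zero, evalCK_genP, j.system.orthogonal X Y hne]
  comp Z Y X β α := evalCK_ext fun j => by
    simp only [map_mul, evalCK_genS, j.system.comp]
  id X := by
    refine ⟨evalCK_ext fun j => ?_, evalCK_ext fun j => ?_⟩
    · rw [evalCK_genP, evalCK_genS, (j.system.id X).1]
    · rw [map_star, evalCK_genP, evalCK_genS, (j.system.id X).2]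
  source Y X α := evalCK_ext fun j => by
    simp only [map_mul, map_star, evalCK_genS, evalCK_genP, j.system.source]
  disjoint Y X Y' X' α β e hne := evalCK_ext fun j => by
    simp only [map_mul, map_star, map_zero, evalCK_genS, j.system.disjoint α β e hne]
  sum X b := evalCK_ext fun j => by
    simp only [map_sum, map_mul, map_star, evalCK_genS, evalCK_genP, j.system.sum]

theorem genP_eq_genS (X : E) : genP F X = genS F (𝟙 X) := ((univSystem F).id X).1

theorem evalCK_V (j : CKRepresentation F) (t : AnyFork E) :
    evalCK j ((univSystem F).V t) = j.system.V t := by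
  simp only [CKSystem.V, map_mul, map_star]
  rfl

variable [hF : IsKPFibration F] (hmono : ∀ ⦃a b : B⦄ (f : a ⟶ b), Mono f)

/-- The representation of `C_c(G_F)` given by a Cuntz-Krieger system. -/
noncomputable def convRep (j : CKRepresentation F) : ConvRepresentation (PathSpace F) where
  H := j.H
  π := (evalCK j : CuntzKriegerAlgebra F →ₗ[ℂ] (j.H →L[ℂ] j.H)) ∘ₗ
    (univSystem F).integrated hmono
  map_convolution f g h e :=
    (congrArg (evalCK j) ((univSystem F).integrated_convolution hmono e)).trans (map_mul _ _ _)
  map_involution f h e :=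
    (congrArg (evalCK j) ((univSystem F).integrated_involution hmono e)).trans (map_star _ _)
  tendsto f g hK hfg ξ ζ := by
    have h1 := ((continuous_starHom (evalCK j)).tendsto _).comp
      ((univSystem F).tendsto_integrated hmono hK hfg)
    exact tendsto_const_nhds.inner ((ContinuousLinearMap.apply ℂ j.H ξ).continuous.tendsto _ |>.comp h1)

/-- Each relation is an identity of indicator functions carried over by π; the vanishing products
use that the zero function is the convolution of the two indicators. -/
theorem convRep_isForkSystem (i : ConvRepresentation (PathSpace F)) :
    IsForkSystem F fun t => i.π (charC hmono t) where
  refinable t b := by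
    rw [← map_sum]
    refine congrArg i.π ?_
    refine DFunLike.coe_injective ?_
    rw [CompactlySupportedContinuousMap.coe_sum]
    exact charFn_isRefinable t b
  star t := (i.map_involution _ _ (involution_charFn t).symm).symm
  mul μ ν τ := (i.map_convolution _ _ _ (convolution_charFn μ ν τ).symm).symm
  mul_eq_zero {t t'} h :=
    (i.map_convolution (charC hmono t) (charC hmono t') 0
      (convolution_charFn_eq_zero h).symm).symm.trans (map_zero _)
  mul_eq_zero' {Y X T t t'} h hne :=
    (i.map_convolution (charC hmono ⟨(Y, X), t⟩) (charC hmono ⟨(X, T), t'⟩) 0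
      (convolution_charFn_eq_zero' h hne).symm).symm.trans (map_zero _)

/-- The Cuntz-Krieger system given by a representation of `C_c(G_F)`. -/
noncomputable def ckRep (i : ConvRepresentation (PathSpace F)) : CKRepresentation F where
  H := i.H
  system := (convRep_isForkSystem hmono i).ckSystem

/-- On step functions π agrees with the Cuntz–Krieger representation built from it, because both are
linear and agree on indicators. -/
theorem exists_compactlySupported_of_mem_graph (i : ConvRepresentation (PathSpace F))
    {p : (Arrow (PathSpace F) → ℂ) × CuntzKriegerAlgebra F} (hp : p ∈ (univSystem F).graph) :
    ∃ f : C_c(Arrow (PathSpace F), ℂ), ⇑f = p.1 ∧ i.π f = evalCK (ckRep hmono i) p.2 := by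
  induction hp using Submodule.span_induction with
  | mem p hp =>
    obtain ⟨t, rfl⟩ := hp
    refine ⟨charC hmono t, rfl, ?_⟩
    rw [evalCK_V]
    exact ((convRep_isForkSystem hmono i).ckSystem_V t).symm
  | zero => exact ⟨0, rfl, by rw [map_zero]; exact (map_zero (evalCK (ckRep hmono i))).symm⟩
  | add p q _ _ ih ih' =>
    obtain ⟨f, hf, hf'⟩ := ih
    obtain ⟨g, hg, hg'⟩ := ih'
    refine ⟨f + g, by rw [CompactlySupportedContinuousMap.coe_add, hf, hg]; rfl, ?_⟩
    rw [map_add, hf', hg']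
    exact (map_add (evalCK (ckRep hmono i)) _ _).symm
  | smul z p _ ih =>
    obtain ⟨f, hf, hf'⟩ := ih
    refine ⟨z • f, by rw [CompactlySupportedContinuousMap.coe_smul, hf]; rfl, ?_⟩
    rw [map_smul, hf']
    exact (map_smul (evalCK (ckRep hmono i)) _ _).symm

/-- Every representation of `C_c(G_F)` is determined by its Cuntz-Krieger system. -/
theorem evalCK_integrated (i : ConvRepresentation (PathSpace F))
    (f : C_c(Arrow (PathSpace F), ℂ)) :
    evalCK (ckRep hmono i) ((univSystem F).integrated hmono f) = i.π f := by
  obtain ⟨-, D, p, δ, -, hp, hD, hδ, -, hδ', hT⟩ := (univSystem F).isLimit_integrated hmono f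
  choose g hg hg' using fun n => exists_compactlySupported_of_mem_graph hmono i (hp n)
  have hK : ∃ K : Set (Arrow (PathSpace F)), IsCompact K ∧ ∀ᶠ n in atTop, tsupport ⇑(g n) ⊆ K := by
    refine ⟨cover F D, isCompact_cover D, Eventually.of_forall fun n => ?_⟩
    exact closure_minimal (by rw [hg n]; exact hD n) (isClosed_cover hmono D)
  have hu : TendstoUniformly (fun n => ⇑(g n)) ⇑f atTop := by
    rw [Metric.tendstoUniformly_iff]
    intro ε hε
    filter_upwards [hδ'.eventually_lt_const hε] with n hn a
    rw [dist_comm, dist_eq_norm, hg n]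
    exact (hδ n a).trans_lt hn
  -- Continuity of π is assumed only for matrix coefficients, so the two limits are compared
  -- coefficient by coefficient.
  refine ContinuousLinearMap.ext fun ξ => ext_inner_left ℂ fun ζ => ?_
  refine tendsto_nhds_unique ?_ (i.tendsto g f hK hu ξ ζ)
  have h1 := ((continuous_starHom (evalCK (ckRep hmono i))).tendsto _).comp hT
  have h2 := tendsto_const_nhds (x := ζ).inner (𝕜 := ℂ)
    ((ContinuousLinearMap.apply ℂ i.H ξ).continuous.tendsto _ |>.comp h1)
  refine h2.congr fun n => ?_
  rw [hg' n]
  rfl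

end Representations


/-! ### The two mutually inverse homomorphisms -/

section Isomorphism

variable {E : Type u₁} [Category.{v₁} E] {B : Type u₂} [Category.{v₂} B] {F : E ⥤ B}
  [hfin : IsRowFinite F] [hF : IsKPFibration F] (hmono : ∀ ⦃a b : B⦄ (f : a ⟶ b), Mono f)

/-- The component at a representation of `C_c(G_F)`, as a homomorphism. -/
noncomputable def evalConv (i : ConvRepresentation (PathSpace F)) :
    GroupoidCStarAlgebra (PathSpace F) →⋆ₙₐ[ℂ] (i.H →L[ℂ] i.H) :=
  (BoundedFamily.atHom (H := ConvRepresentation.H (U := PathSpace F)) i).comp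
    (NonUnitalStarSubalgebraClass.subtype _)

/-- The homomorphism from `C*(F)` to bounded families over the representations of `C_c(G_F)`. -/
noncomputable def toConvFamily :
    CuntzKriegerAlgebra F →⋆ₙₐ[ℂ] BoundedFamily (ConvRepresentation.H (U := PathSpace F)) :=
  BoundedFamily.lift (H := ConvRepresentation.H (U := PathSpace F))
    fun i => evalCK (ckRep hmono i)

theorem toConvFamily_mem (x : CuntzKriegerAlgebra F) :
    toConvFamily hmono x ∈ generated {a : BoundedFamily (ConvRepresentation.H (U := PathSpace F)) |
      ∃ f : C_c(Arrow (PathSpace F), ℂ), ∀ i : ConvRepresentation (PathSpace F),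
        a.at i = i.π f} := by
  refine generated_map_mem (toConvFamily hmono)
    (NonUnitalStarSubalgebra.isClosed_topologicalClosure _) (fun a ha => mem_generated _ ?_) x
  rcases ha with ⟨X, rfl⟩ | ⟨Y, X, α, rfl⟩
  · exact ⟨charC hmono (AnyFork.ofHom (𝟙 X)), fun i => rfl⟩
  · exact ⟨charC hmono (AnyFork.ofHom α), fun i => rfl⟩

/-- The homomorphism from `C*(F)` to `C*(G_F)`. -/
noncomputable def toGroupoidAlgebra :
    CuntzKriegerAlgebra F →⋆ₙₐ[ℂ] GroupoidCStarAlgebra (PathSpace F) :=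
  NonUnitalStarAlgHom.codRestrict (toConvFamily hmono) _ (toConvFamily_mem hmono)

/-- The homomorphism from `C*(G_F)` to bounded families over the Cuntz-Krieger representations. -/
noncomputable def toCKFamily :
    GroupoidCStarAlgebra (PathSpace F) →⋆ₙₐ[ℂ] BoundedFamily (CKRepresentation.H (F := F)) :=
  BoundedFamily.lift (H := CKRepresentation.H (F := F)) fun j => evalConv (convRep hmono j)

/-- The component at j evaluates a in `convRep hmono j`, which is by construction the component at j
of the universal integrated map. -/
theorem toCKFamily_of_isImageOf {a : GroupoidCStarAlgebra (PathSpace F)}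
    {f : C_c(Arrow (PathSpace F), ℂ)} (h : IsImageOf a f) :
    toCKFamily hmono a = ((univSystem F).integrated hmono f).1 :=
  BoundedFamily.ext fun j => h (convRep hmono j)

theorem toCKFamily_mem (x : GroupoidCStarAlgebra (PathSpace F)) :
    toCKFamily hmono x ∈ generated ({a | ∃ X : E, a = univP F X} ∪
      {a | ∃ (Y X : E) (α : Y ⟶ X), a = univS F α}) := by
  refine generated_map_mem (toCKFamily hmono)
    (NonUnitalStarSubalgebra.isClosed_topologicalClosure _) (fun a ha => ?_) x
  obtain ⟨f, hf⟩ := id ha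
  rw [toCKFamily_of_isImageOf hmono (a := ⟨a, mem_generated _ ha⟩) hf]
  exact ((univSystem F).integrated hmono f).2

/-- The homomorphism from `C*(G_F)` to `C*(F)`. -/
noncomputable def ofGroupoidAlgebra :
    GroupoidCStarAlgebra (PathSpace F) →⋆ₙₐ[ℂ] CuntzKriegerAlgebra F :=
  NonUnitalStarAlgHom.codRestrict (toCKFamily hmono) _ (toCKFamily_mem hmono)

theorem ofGroupoidAlgebra_of_isImageOf {a : GroupoidCStarAlgebra (PathSpace F)}
    {f : C_c(Arrow (PathSpace F), ℂ)} (h : IsImageOf a f) :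
    ofGroupoidAlgebra hmono a = (univSystem F).integrated hmono f :=
  Subtype.ext (toCKFamily_of_isImageOf hmono h)

theorem isImageOf_genS {Y X : E} (α : Y ⟶ X) :
    IsImageOf (toGroupoidAlgebra hmono (genS F α)) (charC hmono (AnyFork.ofHom α)) :=
  fun _ => rfl

theorem isImageOf_genP (X : E) :
    IsImageOf (toGroupoidAlgebra hmono (genP F X)) (charC hmono (AnyFork.ofHom (𝟙 X))) :=
  fun _ => rfl

theorem ofGroupoidAlgebra_toGroupoidAlgebra (x : CuntzKriegerAlgebra F) :
    ofGroupoidAlgebra hmono (toGroupoidAlgebra hmono x) = x := by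
  refine generated_hom_ext
    (φ := (ofGroupoidAlgebra hmono).comp (toGroupoidAlgebra hmono))
    (ψ := NonUnitalStarAlgHom.id ℂ _) (fun a ha => ?_) x
  rcases ha with ⟨X, rfl⟩ | ⟨Y, X, α, rfl⟩
  · refine (ofGroupoidAlgebra_of_isImageOf hmono (isImageOf_genP hmono X)).trans ?_
    rw [CKSystem.integrated_charC, CKSystem.V_ofHom]
    exact ((univSystem F).id X).1.symm
  · refine (ofGroupoidAlgebra_of_isImageOf hmono (isImageOf_genS hmono α)).trans ?_
    rw [CKSystem.integrated_charC, CKSystem.V_ofHom]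
    rfl

/-- The images of functions f generate C*(G_F); for them each component of the claim is
`evalCK_integrated`. -/
theorem toGroupoidAlgebra_ofGroupoidAlgebra (x : GroupoidCStarAlgebra (PathSpace F)) :
    toGroupoidAlgebra hmono (ofGroupoidAlgebra hmono x) = x := by
  refine generated_hom_ext
    (φ := (toGroupoidAlgebra hmono).comp (ofGroupoidAlgebra hmono))
    (ψ := NonUnitalStarAlgHom.id ℂ _) (fun a ha => ?_) x
  obtain ⟨f, hf⟩ := id ha
  refine Subtype.ext (BoundedFamily.ext fun i => ?_)
  refine Eq.trans ?_ (hf i).symm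
  refine Eq.trans ?_ (evalCK_integrated hmono i f)
  exact congrArg (evalCK (ckRep hmono i))
    (ofGroupoidAlgebra_of_isImageOf hmono (a := ⟨a, mem_generated _ ha⟩) hf)

/-- The isomorphism of `C*(F)` with `C*(G_F)`. -/
noncomputable def groupoidAlgebraEquiv :
    CuntzKriegerAlgebra F ≃⋆ₐ[ℂ] GroupoidCStarAlgebra (PathSpace F) where
  toFun := toGroupoidAlgebra hmono
  invFun := ofGroupoidAlgebra hmono
  left_inv := ofGroupoidAlgebra_toGroupoidAlgebra hmono
  right_inv := toGroupoidAlgebra_ofGroupoidAlgebra hmono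
  map_mul' := map_mul _
  map_add' := map_add _
  map_star' := map_star _
  map_smul' := map_smul _

end Isomorphism

end KPFib

theorem mainTheorem1 {E : Type u₁} [Category.{v₁} E] {B : Type u₂}
    [Category.{v₂} B] (F : E ⥤ B) [KPFib.IsKPFibration F] [KPFib.IsRowFinite F]
    (hmono : ∀ ⦃a b : B⦄ (f : a ⟶ b), Mono f) :
    ∃ Υ : KPFib.CuntzKriegerAlgebra F ≃⋆ₐ[ℂ] KPFib.GroupoidCStarAlgebra (KPFib.PathSpace F),
      (∀ ⦃Y X : E⦄ (α : Y ⟶ X), ∃ f : C_c(Arrow (KPFib.PathSpace F), ℂ),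
        ⇑f = Set.indicator (KPFib.bisection F α (𝟙 Y)) 1 ∧
          KPFib.IsImageOf (Υ (KPFib.genS F α)) f) ∧
      ∀ Φ : KPFib.CuntzKriegerAlgebra F →⋆ₙₐ[ℂ] KPFib.GroupoidCStarAlgebra (KPFib.PathSpace F),
        (∀ ⦃Y X : E⦄ (α : Y ⟶ X), Φ (KPFib.genS F α) = Υ (KPFib.genS F α)) →
          ∀ a, Φ a = Υ a := by
  refine ⟨KPFib.groupoidAlgebraEquiv hmono, fun Y X α =>
    ⟨KPFib.charC hmono (KPFib.AnyFork.ofHom α), rfl, KPFib.isImageOf_genS hmono α⟩,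
    fun Φ hΦ a => ?_⟩
  refine KPFib.generated_hom_ext (φ := Φ) (ψ := KPFib.toGroupoidAlgebra hmono)
    (fun a ha => ?_) a
  rcases ha with ⟨X, rfl⟩ | ⟨Y, X, α, rfl⟩
  -- The projections are no extra data: p_X = s_α for the identity α of X, so agreement on all s_α
  -- is enough.
  · change Φ (KPFib.genP F X) = KPFib.toGroupoidAlgebra hmono (KPFib.genP F X)
    rw [KPFib.genP_eq_genS]
    exact hΦ (𝟙 X)
  · exact hΦ α
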